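/- Let $\Bbbk$ be a commutative ring with unit and $X$ a simplicial set. For a simplicial set $Z$ let $C(Z)$ be the normalized chain complex with coefficients in $\Bbbk$, a dg coalgebra via the Alexander–Whitney diagonal, and let $C^*(Z)=C(Z)^\vee$ be its graded dual, the normalized cochain algebra. Fix a coaugmentation of the dg coalgebra $C(X)$ (for example the one given by a base point of $X$); it induces augmentations on $C^*(X)$, on $C^*(X)\otimes C^*(X)$ and, via the diagonal map $\Delta\colon X\to X\times X$, on $C^*(X\times X)$. Let $BA=\bigoplus_{k\ge0}(s^{-1}\bar A)^{\otimes k}$ be the reduced bar construction of an augmented dga $A$ with augmentation ideal $\bar A$, with the deconcatenation coproduct. Write $[a_1|\dots|a_k]=s^{-1}a_1\otimes\dots\otimes s^{-1}a_k$. All signs follow the Koszul rule; the transpose of a map $f$ of graded modules is $f^*(\beta)=(-1)^{|f||\beta|}\beta f$. *Hga multiplication.* For $l\ge1$ let $E_l\colon C^*(X)\otimes C^*(X)^{\otimes l}\to C^*(X)$ be the transpose of the interval cut operation of the surjection $(1,2,1,3,1,\dots,1,l+1,1)$ (with the Berger–Fresse permutation and position signs). Let $\mathbf E\colon BC^*(X)\otimes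 BC^*(X)\to\bar C^*(X)$ be the map with $\mathbf E([\,],[b])=b$, $\mathbf E([a],[\,])=a$, $\mathbf E\circ(s^{-1}\otimes (s^{-1})^{\otimes l})=E_l$, that is, $$\mathbf E([a],[b_1|\dots|b_l])=(-1)^{l|a|+\sum_i(l-i)|b_i|}E_l(a;b_1,\dots,b_l)\qquad(l\ge1),$$ and vanishing on all other pairs of words. The multiplication on $BC^*(X)$ given by the hga structure of $C^*(X)$ is the morphism of coalgebras $BC^*(X)\otimes BC^*(X)\to BC^*(X)$ with associated twisting cochain $\mathbf E$. *Gugenheim–Munkholm map.* For simplicial sets $X$, $Y$ let $AW\colon C(X\times Y)\to C(X)\otimes C(Y)$ be the Alexander–Whitney map and $h\colon C(X\times Y)\to C(X\times Y)$ the homotopy $$h(x,y)=\sum_{0\le p+q<n}\ \sum_{(\alpha,\beta)}(-1)^{p+q+(\alpha,\beta)}\bigl(s_\beta\,\partial_{p+1}\cdots\partial_{p+q}\,x,\ s_{p+q+1}\,s_\alpha\,\partial_0\cdots\partial_{p-1}\,y\bigr)\qquad (x,y)\in X_n\times Y_n,$$ where $(\alpha,\beta)$ runs over the partitions of $\{0,\dots,p+q\}$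 with $\#\alpha=p$ and $\#\beta=q+1$, $(-1)^{(\alpha,\beta)}$ is the signature of the corresponding shuffle, and $s_\alpha=s_{\alpha_p}\cdots s_{\alpha_1}$ for $\alpha=\{\alpha_1<\dots<\alpha_p\}$ (similarly $s_\beta$). Define maps $G_n\colon C(X\times Y)\to(C(X)\otimes C(Y))^{\otimes n}$ of degree $n-1$ by $G_1=AW$ and $$G_n=-\sum_{l=1}^{n-1}(-1)^{n-l}(G_l\otimes G_{n-l})\,\Delta_{C(X\times Y)}\,h\qquad(n\ge2).$$ For $Y=X$ the composition of the canonical map $C^*(X)\otimes C^*(X)\to(C(X)\otimes C(X))^\vee$ with the $A_\infty$-map whose components are the transposes $G_n^*$ is an $A_\infty$-map $C^*(X)\otimes C^*(X)\Rightarrow C^*(X\times X)$. Let $B\Phi^{\mathrm{GM}}\colon B(C^*(X)\otimes C^*(X))\to BC^*(X\times X)$ be the induced morphism of coalgebras, where an $A_\infty$-map with components $F_n\colon A^{\otimes n}\to A'$ corresponds to the twisting cochain $t[a_1|\dots|a_n]=(-1)^{\sum_i(n-i)|a_i|}F_n(a_1,\dots,a_n)$. **Claim.** The composition $$BC^*(X)\otimes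 BC^*(X)\xrightarrow{\ \text{shuffle}\ }B\bigl(C^*(X)\otimes C^*(X)\bigr)\xrightarrow{\ B\Phi^{\mathrm{GM}}\ }BC^*(X\times X)\xrightarrow{\ B\Delta^*\ }BC^*(X)$$ is equal to the multiplication on $BC^*(X)$ given by the hga structure of $C^*(X)$. -/

import Mathlib

open CategoryTheory Simplicial MonoidalCategory CartesianMonoidalCategory
open scoped DirectSum TensorProduct

universe u v w w'

noncomputable section

namespace BarGM

/-! ### Linear algebra of graded modules -/

section Linear

variable (k : Type v) [CommRing k]

/-- The multilinear map that is given on homogeneous arguments of degrees `P` by `f P`. -/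
def homMulti {ι : Type} [Fintype ι] [DecidableEq ι] {I : Type} [DecidableEq I]
    {M : I → Type w} [∀ i, AddCommMonoid (M i)] [∀ i, Module k (M i)]
    {N : Type w'} [AddCommMonoid N] [Module k N]
    (f : ∀ P : ι → I, MultilinearMap k (fun i => M (P i)) N) :
    MultilinearMap k (fun _ : ι => ⨁ i, M i) N :=
  MultilinearMap.fromDFinsuppEquiv (fun _ : ι => I) k f

/-- The degree involution `x ↦ (-1)^|x| x`. -/
def degSign (M : ℕ → Type w) [∀ n, AddCommMonoid (M n)] [∀ n, Module k (M n)] :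
    (⨁ n, M n) →ₗ[k] ⨁ n, M n :=
  DirectSum.lmap fun n => ((-1 : k) ^ n) • LinearMap.id

/-- The exponent `∑_{i<j} Dᵢ Dⱼ` of the Koszul sign of the pairing
`β₁ ⊗ ⋯ ⊗ βₙ (w₁ ⊗ ⋯ ⊗ wₙ)` where `|βᵢ| = |wᵢ| = Dᵢ`. -/
def koszulExp {n : ℕ} (D : Fin n → ℕ) : ℕ :=
  ∑ i, ∑ j ∈ Finset.univ.filter (i < ·), D i * D j

variable {k}
variable {V : Type w} [AddCommMonoid V] [Module k V]
variable {N : Type w'} [AddCommMonoid N] [Module k N]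

/-- A linear map on `⨁ₙ V^{⊗n}` (the module underlying the tensor algebra) given on each summand
by a multilinear map. -/
def wordLift (f : ∀ n, MultilinearMap k (fun _ : Fin n => V) N) : TensorAlgebra k V →ₗ[k] N :=
  DirectSum.toModule k ℕ N (fun n => PiTensorProduct.lift (f n)) ∘ₗ
    (TensorAlgebra.equivDirectSum (R := k) (M := V)).toLinearMap

/-- A linear map on `(⨁ₘ V^{⊗m}) ⊗ (⨁ₙ V^{⊗n})` given on each summand `V^{⊗m} ⊗ V^{⊗n}` by a
multilinear map. -/
def wordLift₂ (f : ∀ m n, MultilinearMap k (fun _ : Fin m ⊕ Fin n => V) N) :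
    TensorAlgebra k V ⊗[k] TensorAlgebra k V →ₗ[k] N :=
  DirectSum.toModule k (ℕ × ℕ) N
      (fun mn => PiTensorProduct.lift (f mn.1 mn.2) ∘ₗ
        (PiTensorProduct.tmulEquiv (ι := Fin mn.1) (ι₂ := Fin mn.2) k V).toLinearMap) ∘ₗ
    (TensorProduct.directSum k k (fun m => ⨂[k]^m V) (fun n => ⨂[k]^n V)).toLinearMap ∘ₗ
    TensorProduct.map (TensorAlgebra.equivDirectSum (R := k) (M := V)).toLinearMap
      (TensorAlgebra.equivDirectSum (R := k) (M := V)).toLinearMap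

/-- `(a, b) ↦ [a₁|…|aₘ] ⊗ [b₁|…|bₙ]`. -/
def wordPair (m n : ℕ) : MultilinearMap k (fun _ : Fin m ⊕ Fin n => V)
    (TensorAlgebra k V ⊗[k] TensorAlgebra k V) :=
  (TensorAlgebra.tprod k V m).domCoprod (TensorAlgebra.tprod k V n)

/-- The deconcatenation coproduct `[a₁|…|aₙ] ↦ ∑ᵢ [a₁|…|aᵢ] ⊗ [aᵢ₊₁|…|aₙ]`. -/
def deconcat : TensorAlgebra k V →ₗ[k] TensorAlgebra k V ⊗[k] TensorAlgebra k V :=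
  wordLift fun n => ∑ i : Fin (n + 1),
    (MultilinearMap.mkPiAlgebraFin k n (TensorAlgebra k V ⊗[k] TensorAlgebra k V)).compLinearMap
      fun j : Fin n =>
        if j.val < i.val then
          (Algebra.TensorProduct.includeLeft (R := k) (S := k) (A := TensorAlgebra k V)
            (B := TensorAlgebra k V)).toLinearMap ∘ₗ TensorAlgebra.ι k
        else
          (Algebra.TensorProduct.includeRight (R := k) (A := TensorAlgebra k V)
            (B := TensorAlgebra k V)).toLinearMap ∘ₗ TensorAlgebra.ι k

/-- The augmentation of `⨁ₙ V^{⊗n}`, the projection to `V^{⊗0} = k`. -/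
def wordCounit : TensorAlgebra k V →ₗ[k] k := (TensorAlgebra.algebraMapInv (R := k)).toLinearMap

/-- `t^{⊗n} Δ^{(n)}` for a coalgebra `(C, ε, Δ)` and a map `t : C → V` of degree `0`. -/
def coextPart {C : Type w'} [AddCommMonoid C] [Module k C] (ε : C →ₗ[k] k) (Δ : C →ₗ[k] C ⊗[k] C)
    (t : C →ₗ[k] V) (n : ℕ) : C →ₗ[k] TensorAlgebra k V :=
  match n with
  | 0 => Algebra.linearMap k (TensorAlgebra k V) ∘ₗ ε
  | n + 1 => LinearMap.mul' k (TensorAlgebra k V) ∘ₗ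
      TensorProduct.map (TensorAlgebra.ι k ∘ₗ t) (coextPart ε Δ t n) ∘ₗ Δ

end Linear

/-! ### Bar constructions -/

section Bar

/-- The part of the structure of an augmented dga that enters the bar construction as a
graded coalgebra: the unit, the augmentation and the degree involution `x ↦ (-1)^|x| x`. -/
structure Augmented (k : Type v) [CommRing k] (A : Type w) [AddCommMonoid A] [Module k A] where
  unit : A
  aug : A →ₗ[k] k
  aug_unit : aug unit = 1
  sgn : A →ₗ[k] A

namespace Augmented

variable {k : Type v} [CommRing k]
variable {A : Type w} [AddCommMonoid A] [Module k A] (a : Augmented k A)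
variable {B : Type w'} [AddCommMonoid B] [Module k B] (b : Augmented k B)

/-- The augmentation ideal. -/
abbrev ideal : Submodule k A := LinearMap.ker a.aug

/-- The projection `x ↦ x - ε(x)·1` onto the augmentation ideal. It is the identity on the
augmentation ideal; below it is often applied to elements that already lie there. -/
def proj : A →ₗ[k] a.ideal :=
  LinearMap.codRestrict a.ideal (LinearMap.id + (-1 : k) • a.aug.smulRight a.unit) (by
    intro x
    simp [ideal, a.aug_unit])

/-- The tensor product of two augmented algebras. -/
def tensor : Augmented k (A ⊗[k] B) where
  unit := a.unit ⊗ₜ b.unit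
  aug := LinearMap.mul' k k ∘ₗ TensorProduct.map a.aug b.aug
  aug_unit := by simp [a.aug_unit, b.aug_unit]
  sgn := TensorProduct.map a.sgn b.sgn

/-- The bar construction `⨁ₖ (s⁻¹ Ā)^{⊗k}`, with `[a₁|…|aₖ] = s⁻¹a₁ ⊗ ⋯ ⊗ s⁻¹aₖ` written as the
product of the generators `a₁, …, aₖ ∈ Ā` of the tensor algebra. In Koszul signs the letter `a`
has degree `|a| - 1`. -/
abbrev Bar : Type (max v w) := TensorAlgebra k a.ideal

/-- The map of bar constructions induced by a map of augmented algebras. -/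
def barMap (f : A →ₗ[k] B) : a.Bar →ₗ[k] b.Bar :=
  (TensorAlgebra.lift k (TensorAlgebra.ι k ∘ₗ b.proj ∘ₗ f ∘ₗ a.ideal.subtype)).toLinearMap

/-- The twisting cochain `BA → B̄` of an `A∞`-map with components `Fₙ : A^{⊗n} → B` of degree
`1 - n`. Since `Fₙ` is its composition with `(s⁻¹)^{⊗n}`, it is given by
`t[a₁|…|aₙ] = (-1)^{∑ᵢ (n-i)|aᵢ|} Fₙ(a₁,…,aₙ)`. -/
def twist (F : ∀ n, MultilinearMap k (fun _ : Fin n => A) B) : a.Bar →ₗ[k] b.ideal :=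
  wordLift fun n =>
    if n = 0 then 0
    else b.proj.compMultilinearMap
      ((F n).compLinearMap fun i => (a.sgn ^ (n - 1 - i.val)) ∘ₗ a.ideal.subtype)

/-- The morphism of coalgebras `BF : BA → BB` induced by an `A∞`-map with components `Fₙ`, that is,
`∑ₘ (s⁻¹ t)^{⊗m} Δ^{(m)}` for the twisting cochain `t` above. Only the summands with `m ≤ n` can be
non-zero on words of length `n`. -/
def barInfinity (F : ∀ n, MultilinearMap k (fun _ : Fin n => A) B) : a.Bar →ₗ[k] b.Bar :=
  wordLift fun n => ∑ m ∈ Finset.range (n + 1),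
    (coextPart wordCounit deconcat (a.twist b F) m).compMultilinearMap
      (TensorAlgebra.tprod k a.ideal n)

end Augmented

variable {k : Type v} [CommRing k]
variable {M : ℕ → Type w} [∀ n, AddCommMonoid (M n)] [∀ n, Module k (M n)]
variable (a : Augmented k (⨁ n, M n))

/-- The Koszul transposition `BA ⊗ BA → BA ⊗ BA`, `x ⊗ y ↦ (-1)^{|x||y|} y ⊗ x`. -/
def koszulSwap : a.Bar ⊗[k] a.Bar →ₗ[k] a.Bar ⊗[k] a.Bar :=
  wordLift₂ fun m n =>
    (homMulti k fun P : Fin m ⊕ Fin n → ℕ =>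
      ((-1 : k) ^ ((∑ i, (P (Sum.inl i) + 1)) * ∑ j, (P (Sum.inr j) + 1))) •
        ((TensorProduct.comm k a.Bar a.Bar).toLinearMap.compMultilinearMap
          (wordPair m n)).compLinearMap
            fun s => a.proj ∘ₗ DirectSum.lof k ℕ M (P s)).compLinearMap
      fun _ => a.ideal.subtype

/-- The coproduct `(1 ⊗ T ⊗ 1)(Δ ⊗ Δ)` of the tensor product coalgebra `BA ⊗ BA`. -/
def tensorCoprod :
    a.Bar ⊗[k] a.Bar →ₗ[k] (a.Bar ⊗[k] a.Bar) ⊗[k] (a.Bar ⊗[k] a.Bar) :=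
  (TensorProduct.assoc k a.Bar a.Bar (a.Bar ⊗[k] a.Bar)).symm.toLinearMap ∘ₗ
    LinearMap.lTensor a.Bar ((TensorProduct.assoc k a.Bar a.Bar a.Bar).toLinearMap ∘ₗ
      LinearMap.rTensor a.Bar (koszulSwap a) ∘ₗ
      (TensorProduct.assoc k a.Bar a.Bar a.Bar).symm.toLinearMap) ∘ₗ
    (TensorProduct.assoc k a.Bar a.Bar (a.Bar ⊗[k] a.Bar)).toLinearMap ∘ₗ
    TensorProduct.map deconcat deconcat

/-- The morphism of coalgebras `BA ⊗ BA → BA` with associated twisting cochain `E`, that is,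
`∑ₘ (s⁻¹ E)^{⊗m} Δ^{(m)}`. Only the summands with `m ≤ p + q` can be non-zero on pairs of words of
lengths `p` and `q`. -/
def barProduct (E : a.Bar ⊗[k] a.Bar →ₗ[k] a.ideal) : a.Bar ⊗[k] a.Bar →ₗ[k] a.Bar :=
  wordLift₂ fun p q => ∑ m ∈ Finset.range (p + q + 1),
    (coextPart (LinearMap.mul' k k ∘ₗ TensorProduct.map wordCounit wordCounit)
      (tensorCoprod a) E m).compMultilinearMap (wordPair p q)

/-- The `(p,q)`-shuffles, as bijections that send each letter of a pair of words to its position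
in the shuffled word. -/
def shuffles (p q : ℕ) : Finset (Fin p ⊕ Fin q ≃ Fin (p + q)) :=
  open Classical in
  Finset.univ.filter fun σ =>
    StrictMono (fun i => σ (Sum.inl i)) ∧ StrictMono (fun j => σ (Sum.inr j))

/-- The shuffle map `BA ⊗ BA → B(A ⊗ A)`: the sum over all shuffles, with Koszul signs, of the
letters `a ⊗ 1` for `a` from the first word and `1 ⊗ b` for `b` from the second. -/
def shuffleMap : a.Bar ⊗[k] a.Bar →ₗ[k] (a.tensor a).Bar :=
  wordLift₂ fun p q =>
    (homMulti k fun P : Fin p ⊕ Fin q → ℕ => ∑ σ ∈ shuffles p q,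
      ((-1 : k) ^ (∑ i, ∑ j, if σ (Sum.inr j) < σ (Sum.inl i) then
          (P (Sum.inl i) + 1) * (P (Sum.inr j) + 1) else 0)) •
        ((TensorAlgebra.tprod k (a.tensor a).ideal (p + q)).domDomCongr σ.symm).compLinearMap
          fun s => (a.tensor a).proj ∘ₗ
            (match s with
              | Sum.inl _ => (TensorProduct.mk k (⨁ n, M n) (⨁ n, M n)).flip a.unit
              | Sum.inr _ => TensorProduct.mk k (⨁ n, M n) (⨁ n, M n) a.unit) ∘ₗ
            DirectSum.lof k ℕ M (P s)).compLinearMap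
      fun _ => a.ideal.subtype

end Bar

/-! ### Normalized chains and cochains of simplicial sets -/

section Simplicial

variable (k : Type v) [CommRing k]

/-- Normalized `n`-chains: the free module on the `n`-simplices modulo the degenerate ones,
in other words the free module on the non-degenerate `n`-simplices. -/
abbrev NChain (X : SSet.{u}) (n : ℕ) : Type (max u v) := X.nonDegenerate n →₀ k

/-- The graded module `C(X)` of normalized chains. -/
abbrev Chains (X : SSet.{u}) : Type (max u v) := ⨁ n, NChain k X n

/-- The graded dual `C*(X)` of `C(X)`, the normalized cochains. -/
abbrev Cochains (X : SSet.{u}) : Type (max u v) := ⨁ n, Module.Dual k (NChain k X n)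

variable {X Y Z : SSet.{u}}

open Classical in
/-- The class of an `n`-simplex in the normalized `n`-chains; it is `0` for a degenerate one. -/
def simplexClass {n : ℕ} (x : X _⦋n⦌) : NChain k X n :=
  if h : x ∈ X.nonDegenerate n then Finsupp.single ⟨x, h⟩ 1 else 0

/-- The class of a simplex in `C(X)`. -/
def simplexChain {n : ℕ} (x : X _⦋n⦌) : Chains k X :=
  DirectSum.lof k ℕ (NChain k X) n (simplexClass k x)

variable {k} in
/-- The linear map on `C(X)` given by `f` on (non-degenerate) simplices. -/
def chainLift {N : Type w} [AddCommMonoid N] [Module k N] (f : ∀ n, X _⦋n⦌ → N) :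
    Chains k X →ₗ[k] N :=
  DirectSum.toModule k ℕ N fun n => Finsupp.linearCombination k fun s => f n s.1

/-- The map of normalized chains induced by a map of simplicial sets. -/
def chainMap (f : X ⟶ Y) (n : ℕ) : NChain k X n →ₗ[k] NChain k Y n :=
  Finsupp.linearCombination k fun s => simplexClass k (f.app _ s.1)

/-- The map of normalized cochains induced by a map of simplicial sets. -/
def cochainMap (f : X ⟶ Y) : Cochains k Y →ₗ[k] Cochains k X :=
  DirectSum.lmap fun n => (chainMap k f n).dualMap

/-- The augmentation `C₀(X) → k`, equal to `1` on vertices. It is also the unit of `C*(X)`. -/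
def counit (X : SSet.{u}) : NChain k X 0 →ₗ[k] k := Finsupp.linearCombination k fun _ => (1 : k)

lemma counit_chainMap (f : X ⟶ Y) (c : NChain k X 0) :
    counit k Y (chainMap k f 0 c) = counit k X c := by
  suffices h : counit k Y ∘ₗ chainMap k f 0 = counit k X from LinearMap.congr_fun h c
  ext s
  simp [counit, chainMap, simplexClass]

/-- The list `[i, i+1, …, j]` (for `i ≤ j`). -/
def interval (i j : ℕ) : List ℕ := List.range' i (j + 1 - i)

open Classical in
/-- The class in `C(X)` of the restriction `x(L)` of an `n`-simplex `x` to a non-empty weakly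
increasing list `L` of vertices in `{0,…,n}`. (A repeated vertex makes it degenerate.) -/
def restr {n : ℕ} (x : X _⦋n⦌) (L : List ℕ) : Chains k X :=
  if h : L ≠ [] ∧ L.Pairwise (· ≤ ·) then
    simplexChain k (X.map (SimplexCategory.mkHom (n := L.length - 1) (m := n)
      ⟨fun i => ⟨min (L[i.val]'(by
          have := List.length_pos_of_ne_nil h.1
          omega)) n, by omega⟩, by
        intro i j hij
        have := List.length_pos_of_ne_nil h.1
        refine Fin.mk_le_mk.2 (min_le_min_right n ?_)
        rcases eq_or_lt_of_le hij with rfl | hlt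
        · exact le_rfl
        · exact List.pairwise_iff_getElem.1 h.2 _ _ (by omega) (by omega) hlt⟩).op x)
  else 0

variable (X) in
/-- The diagonal of the coalgebra `C(X)`. -/
def chainDiag : Chains k X →ₗ[k] Chains k X ⊗[k] Chains k X :=
  chainLift fun n x => ∑ l : Fin (n + 1), restr k x (interval 0 l) ⊗ₜ[k] restr k x (interval l n)

/-- A coaugmentation `k → C(X)` of the dg coalgebra `C(X)`, given by the image of `1`.
(Compatibility with the differential is automatic in degree `0`.) -/
structure Coaugmentation (X : SSet.{u}) where
  elt : NChain k X 0
  counit_elt : counit k X elt = 1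
  diag_elt : chainDiag k X (DirectSum.lof k ℕ (NChain k X) 0 elt) =
    DirectSum.lof k ℕ (NChain k X) 0 elt ⊗ₜ[k] DirectSum.lof k ℕ (NChain k X) 0 elt

lemma restr_vertex (x : X _⦋0⦌) : restr k x [0] = simplexChain k x := by
  rw [restr, dif_pos (by simp)]
  have : (SimplexCategory.mkHom (n := [0].length - 1) (m := 0)
      ⟨fun i : Fin ([0].length - 1 + 1) => (0 : Fin (0 + 1)), monotone_const⟩) =
        𝟙 (SimplexCategory.mk 0) := by
    ext i : 3
    apply Subsingleton.elim (α := Fin 1)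
  congr 1
  refine Eq.trans ?_ ((congrArg (fun f => X.map (Quiver.Hom.op f) x) this).trans ?_)
  · congr 4
    ext i
    simp
  · simp

/-- The coaugmentation given by a base point. -/
def Coaugmentation.ofVertex (x : X _⦋0⦌) : Coaugmentation k X where
  elt := simplexClass k x
  counit_elt := by simp [counit, simplexClass]
  diag_elt := by
    have : interval 0 0 = [0] := rfl
    simp [chainDiag, chainLift, simplexClass, this, restr_vertex]
    simp [simplexChain, simplexClass]

/-- `C*(X)`, augmented by the evaluation on an element `c` of `C₀(X)`. -/
def cochainAug (c : NChain k X 0) (hc : counit k X c = 1) : Augmented k (Cochains k X) where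
  unit := DirectSum.lof k ℕ (fun n => Module.Dual k (NChain k X n)) 0 (counit k X)
  aug := Module.Dual.eval k (NChain k X 0) c ∘ₗ
    DirectSum.component k ℕ (fun n => Module.Dual k (NChain k X n)) 0
  aug_unit := by
    simpa using hc
  sgn := degSign k fun n => Module.Dual k (NChain k X n)

/-- The augmented algebra `C*(X)` of a coaugmented simplicial set. -/
def augC (c : Coaugmentation k X) : Augmented k (Cochains k X) :=
  cochainAug k c.elt c.counit_elt

variable (X) in
/-- The diagonal `X → X × X`. -/
def diagMap : X ⟶ X ⊗ X := lift (𝟙 X) (𝟙 X)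

/-- `C*(X × X)`, augmented via the composition `k → C(X) → C(X × X)` of the coaugmentation with
the diagonal of `X` (for a base point `x₀` this is the base point `(x₀, x₀)`). -/
def augCC (c : Coaugmentation k X) : Augmented k (Cochains k (X ⊗ X)) :=
  cochainAug k (chainMap k (diagMap X) 0 c.elt) (by rw [counit_chainMap, c.counit_elt])

variable {k} in
/-- The transpose `f*(β₁ ⊗ ⋯ ⊗ βₙ) = (-1)^{|f||β|} (β₁ ⊗ ⋯ ⊗ βₙ) f` of a map
`f : C(Z) → W^{⊗n}` of degree `d`, for functionals `βᵢ` of degree `Dᵢ` on a graded module `W`.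
The tensor product of the `βᵢ` is formed with the Koszul sign. -/
def transpose {W : Type w} [AddCommMonoid W] [Module k W] {n : ℕ}
    (f : Chains k Z →ₗ[k] ⨂[k]^n W) (d : ℕ) (D : Fin n → ℕ) :
    MultilinearMap k (fun _ : Fin n => Module.Dual k W) (Cochains k Z) :=
  if d ≤ ∑ i, D i then
    ((-1 : k) ^ (d * (∑ i, D i) + koszulExp D)) •
      (DirectSum.lof k ℕ (fun m => Module.Dual k (NChain k Z m)) ((∑ i, D i) - d) ∘ₗ
        (f ∘ₗ DirectSum.lof k ℕ (NChain k Z) ((∑ i, D i) - d)).dualMap ∘ₗ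
        PiTensorProduct.dualDistrib).compMultilinearMap (PiTensorProduct.tprod k)
  else 0

/-! ### Interval cut operations and the hga structure -/

/-- Whether `t` is the last position with its label (a final interval); the other
intervals are called inner. -/
def IsFinal {N r : ℕ} (u : Fin N → Fin r) (t : Fin N) : Prop := ∀ t', t < t' → u t' ≠ u t

open Classical in
/-- The degree of the interval `[mₜ, mₜ₊₁]`: its length, plus `1` if it is inner. -/
def intervalDeg {N r : ℕ} (u : Fin N → Fin r) (m : Fin (N + 1) → ℕ) (t : Fin N) : ℕ :=
  m t.succ - m t.castSucc + if IsFinal u t then 0 else 1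

open Classical in
/-- The exponent of the permutation sign, obtained by sorting the intervals by their labels. -/
def permExp {N r : ℕ} (u : Fin N → Fin r) (m : Fin (N + 1) → ℕ) : ℕ :=
  ∑ t, ∑ t', if t < t' ∧ u t' < u t then intervalDeg u m t * intervalDeg u m t' else 0

open Classical in
/-- The exponent of the position sign: the sum of the right end points of the inner intervals. -/
def posExp {N r : ℕ} (u : Fin N → Fin r) (m : Fin (N + 1) → ℕ) : ℕ :=
  ∑ t, if IsFinal u t then 0 else m t.succ

/-- The subdivisions `0 = m₀ ≤ m₁ ≤ ⋯ ≤ m_N = n` of `[0, n]` into `N` intervals. -/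
def subdivisions (N n : ℕ) : Finset (Fin (N + 1) → Fin (n + 1)) :=
  open Classical in
  Finset.univ.filter fun m => Monotone m ∧ m 0 = 0 ∧ m (Fin.last N) = Fin.last n

variable (X) in
/-- The interval cut operation `C(X) → C(X)^{⊗r}` of a surjection `u`. -/
def intervalCut {N r : ℕ} (u : Fin N → Fin r) : Chains k X →ₗ[k] ⨂[k]^r (Chains k X) :=
  chainLift fun n x => ∑ m ∈ subdivisions N n,
    ((-1 : k) ^ (permExp u (fun t => (m t).val) + posExp u (fun t => (m t).val))) •
      PiTensorProduct.tprod k fun j : Fin r =>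
        restr k x (((List.finRange N).filter fun t => u t = j).flatMap
          fun t => interval (m t.castSucc) (m t.succ))

/-- The surjection `(1,2,1,3,1,…,1,l+1,1)`, with labels shifted to start from `0`. -/
def hgaSurj (l : ℕ) (t : Fin (2 * l + 1)) : Fin (l + 1) :=
  if t.val % 2 = 0 then 0 else ⟨(t.val + 1) / 2, by omega⟩

variable (X) in
/-- The homotopy Gerstenhaber operation `E_l(a; b₁,…,b_l)` on `C*(X)`, the transpose of the
interval cut operation (of degree `l`) above. -/
def hgaOp (l : ℕ) : MultilinearMap k (fun _ : Fin (l + 1) => Cochains k X) (Cochains k X) :=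
  homMulti k (M := fun n => Module.Dual k (NChain k X n)) fun P : Fin (l + 1) → ℕ =>
    (transpose (intervalCut k X (hgaSurj l)) l P).compLinearMap
      fun i => (DirectSum.component k ℕ (NChain k X) (P i)).dualMap

/-- The twisting cochain `E : BC*(X) ⊗ BC*(X) → C̄*(X)` of the hga structure:
`E([], [b]) = b`, `E([a], []) = a`,
`E([a], [b₁|…|b_l]) = (-1)^{l|a| + ∑ᵢ (l-i)|bᵢ|} E_l(a; b₁,…,b_l)` for `l ≥ 1`
(that is, `E_l` is the composition of `E` with `(s⁻¹)^{⊗(l+1)}`),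
and `E` vanishes on all other pairs of words. -/
def hgaTwist (c : Coaugmentation k X) :
    (augC k c).Bar ⊗[k] (augC k c).Bar →ₗ[k] (augC k c).ideal :=
  wordLift₂ fun p q =>
    match p, q with
    | 0, 1 => (MultilinearMap.ofSubsingleton k (augC k c).ideal (augC k c).ideal
        (0 : Fin 1) LinearMap.id).domDomCongr (Equiv.emptySum (Fin 0) (Fin 1)).symm
    | 1, 0 => (MultilinearMap.ofSubsingleton k (augC k c).ideal (augC k c).ideal
        (0 : Fin 1) LinearMap.id).domDomCongr (Equiv.sumEmpty (Fin 1) (Fin 0)).symm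
    | 1, l + 1 => (augC k c).proj.compMultilinearMap
        (((hgaOp k X (l + 1)).compLinearMap
          fun i => ((augC k c).sgn ^ (l + 1 - i.val)) ∘ₗ (augC k c).ideal.subtype).domDomCongr
            ((finCongr (Nat.add_comm (l + 1) 1)).trans finSumFinEquiv.symm))
    | _, _ => 0

/-- The multiplication on `BC*(X)` given by the hga structure of `C*(X)`. -/
def hgaMul (c : Coaugmentation k X) : (augC k c).Bar ⊗[k] (augC k c).Bar →ₗ[k] (augC k c).Bar :=
  barProduct (augC k c) (hgaTwist k c)

/-! ### The Eilenberg–Zilber contraction and the Gugenheim–Munkholm construction -/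

/-- The simplicial operator `[m] → [n]` given by a monotone map `f` on vertices. (For the maps used
below one has `f i ≤ n` for all `i ≤ m`, so that the minimum plays no role.) -/
def simplexOp (f : ℕ →o ℕ) (m n : ℕ) : SimplexCategory.mk m ⟶ SimplexCategory.mk n :=
  SimplexCategory.mkHom ⟨fun i => ⟨min (f i.val) n, by omega⟩, fun _ _ hij =>
    Fin.mk_le_mk.2 (min_le_min_right n (f.monotone hij))⟩

/-- The effect `v ↦ v - #{s ∈ S | s < v}` on vertices of the repeated degeneracy operator
`s_S = s_{S_p} ∘ ⋯ ∘ s_{S_1}` for `S = {S_1 < ⋯ < S_p}`. -/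
def degenVertex (S : Finset ℕ) : ℕ →o ℕ where
  toFun v := v - (S.filter (· < v)).card
  monotone' := by
    refine monotone_nat_of_le_succ fun v => ?_
    have h : S.filter (· < v + 1) ⊆ insert v (S.filter (· < v)) := by
      intro s hs
      simp only [Finset.mem_filter, Finset.mem_insert] at hs ⊢
      have := hs.2
      rcases Nat.lt_or_ge s v with h | h
      · exact Or.inr ⟨hs.1, h⟩
      · exact Or.inl (by omega)
    have := (Finset.card_le_card h).trans (Finset.card_insert_le _ _)
    omega

/-- The effect on vertices of the repeated face operator `∂_i ∘ ∂_{i+1} ∘ ⋯ ∘ ∂_{i+l-1}`, which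
omits the vertices `i, …, i+l-1`. -/
def faceVertex (i l : ℕ) : ℕ →o ℕ where
  toFun v := if v < i then v else v + l
  monotone' := by
    intro v w hvw
    dsimp only
    split_ifs <;> omega

variable (X Y) in
/-- The Alexander–Whitney map. -/
def AW : Chains k (X ⊗ Y) →ₗ[k] Chains k X ⊗[k] Chains k Y :=
  chainLift fun n (z : (X ⊗ Y : SSet.{u}) _⦋n⦌) => ∑ l : Fin (n + 1),
    restr k (z.1 : X _⦋n⦌) (interval 0 l) ⊗ₜ[k] restr k (z.2 : Y _⦋n⦌) (interval l n)

variable (X Y) in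
/-- The (opposite) Eilenberg–Mac Lane homotopy `h(x, y)`, the sum over `0 ≤ p+q < n` and all
`(p,q+1)`-shuffles `(α, β)` of `{0,…,p+q}` of
`(-1)^{p+q+(α,β)} (s_β ∂_{p+1}^{p+q} x, s_{p+q+1} s_α ∂_0^{p-1} y)`.
The sign exponent `(α,β)` is the number of inversions `a > b` with `a ∈ α`, `b ∈ β`. -/
def emHomotopy : Chains k (X ⊗ Y) →ₗ[k] Chains k (X ⊗ Y) :=
  chainLift fun n (z : (X ⊗ Y : SSet.{u}) _⦋n⦌) => ∑ p ∈ Finset.range n, ∑ q ∈ Finset.range (n - p),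
    ∑ β ∈ (Finset.range (p + q + 1)).powersetCard (q + 1),
      let α := Finset.range (p + q + 1) \ β
      ((-1 : k) ^ (p + q + ((α ×ˢ β).filter fun s => s.2 < s.1).card)) •
        simplexChain k (X := X ⊗ Y) (n := n + 1)
          ((X.map (simplexOp ((faceVertex (p + 1) q).comp (degenVertex β)) (n + 1) n).op z.1,
            Y.map (simplexOp ((faceVertex 0 p).comp
              ((degenVertex α).comp (degenVertex {p + q + 1}))) (n + 1) n).op z.2))

variable (X Y) in
/-- The Gugenheim–Munkholm maps `Gₙ : C(X × Y) → (C(X) ⊗ C(Y))^{⊗n}` of degree `n - 1`: `G₁ = AW`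
and `Gₙ = -∑_{l=1}^{n-1} (-1)^{n-l} (G_l ⊗ G_{n-l}) Δ h`. By the Koszul sign rule
`(G_l ⊗ G_{n-l})(x ⊗ y) = (-1)^{(n-l-1)|x|} G_l(x) ⊗ G_{n-l}(y)`.
The target is written inside the tensor algebra of `C(X) ⊗ C(Y)`. -/
def gm (n : ℕ) : Chains k (X ⊗ Y) →ₗ[k] TensorAlgebra k (Chains k X ⊗[k] Chains k Y) :=
  match n with
  | 0 => 0
  | 1 => TensorAlgebra.ι k ∘ₗ AW k X Y
  | n + 2 => (-1 : k) • ∑ i : Fin (n + 1), ((-1 : k) ^ (n + 1 - i.val)) •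
      (LinearMap.mul' k (TensorAlgebra k (Chains k X ⊗[k] Chains k Y)) ∘ₗ
        TensorProduct.map
          (gm (i.val + 1) ∘ₗ (degSign k (NChain k (X ⊗ Y)) ^ (n - i.val)))
          (gm (n + 1 - i.val)) ∘ₗ
        chainDiag k (X ⊗ Y) ∘ₗ emHomotopy k X Y)
  termination_by n
  decreasing_by all_goals omega

variable (X Y) in
/-- `Gₙ` with values in `(C(X) ⊗ C(Y))^{⊗n}`. -/
def gmPart (n : ℕ) : Chains k (X ⊗ Y) →ₗ[k] ⨂[k]^n (Chains k X ⊗[k] Chains k Y) :=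
  DirectSum.component k ℕ (fun m => ⨂[k]^m (Chains k X ⊗[k] Chains k Y)) n ∘ₗ
    (TensorAlgebra.toDirectSum (R := k) (M := Chains k X ⊗[k] Chains k Y)).toLinearMap ∘ₗ
    gm k X Y n

variable (X Y) in
/-- The canonical map `C*(X) ⊗ C*(Y) → (C(X) ⊗ C(Y))^∨` in bidegree `(p, q)`,
`(a ⊗ b)(x ⊗ y) = (-1)^{|b||x|} a(x) b(y)`. -/
def tensorDual (p q : ℕ) :
    Module.Dual k (NChain k X p) ⊗[k] Module.Dual k (NChain k Y q) →ₗ[k]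
      Module.Dual k (Chains k X ⊗[k] Chains k Y) :=
  ((-1 : k) ^ (p * q)) •
    ((TensorProduct.map (DirectSum.component k ℕ (NChain k X) p)
      (DirectSum.component k ℕ (NChain k Y) q)).dualMap ∘ₗ
      TensorProduct.dualDistrib k (NChain k X p) (NChain k Y q))

variable (X Y) in
/-- The components of the `A∞`-map `C*(X) ⊗ C*(Y) → (C(X) ⊗ C(Y))^∨ ⇒ C*(X × Y)`, where the second
map is the transpose of `G`. -/
def gmTranspose (n : ℕ) : MultilinearMap k (fun _ : Fin n => Cochains k X ⊗[k] Cochains k Y)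
    (Cochains k (X ⊗ Y)) :=
  (homMulti k (M := fun pq : ℕ × ℕ => Module.Dual k (NChain k X pq.1) ⊗[k]
      Module.Dual k (NChain k Y pq.2)) fun P : Fin n → ℕ × ℕ =>
    (transpose (gmPart k X Y n) (n - 1) (fun i => (P i).1 + (P i).2)).compLinearMap
      fun i => tensorDual k X Y (P i).1 (P i).2).compLinearMap
    fun _ => (TensorProduct.directSum k k (fun p => Module.Dual k (NChain k X p))
      (fun q => Module.Dual k (NChain k Y q))).toLinearMap

/-- The map `BΦ^GM : B(C*(X) ⊗ C*(X)) → BC*(X × X)`. -/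
def barGM (c : Coaugmentation k X) :
    ((augC k c).tensor (augC k c)).Bar →ₗ[k] (augCC k c).Bar :=
  ((augC k c).tensor (augC k c)).barInfinity (augCC k c) (gmTranspose k X X)

/-- The map `BΔ* : BC*(X × X) → BC*(X)`. -/
def barDiag (c : Coaugmentation k X) : (augCC k c).Bar →ₗ[k] (augC k c).Bar :=
  (augCC k c).barMap (augC k c) (cochainMap k (diagMap X))

end Simplicial

end BarGM

end

/-! Both sides are built from twisting cochains by the formula `∑ₘ t^{⊗m} Δ^{(m)}`. This formula is
natural for coalgebra maps in the source and for linear maps of the letters in the target. The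
shuffle map is such a coalgebra map, so the composite is governed by one twisting cochain: the
signed sum, over all shuffles `W` of the letters `a ⊗ 1` and `1 ⊗ b`, of the pullback along `Δ` of
the Gugenheim–Munkholm cochain on `W` (`barMap_barInfinity_shuffleMap`). It remains to see that this
sum is `E` (`hgaTwist_eq_shSum`), that is, to evaluate `G_N` on simplices `(x, x)` against words in
`a ⊗ 1` and `1 ⊗ b`.

A term of `h(x, y)` is best seen as a path of pairs of vertices. It starts at `(0, p)` and reaches
`(p, p+q+1)` by steps that move only the first coordinate (those in `α`) or only the second one
(those in `β`). Then the first coordinate jumps to `p+q+1` while the second one rests, and from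
there both move together. A front or back face is degenerate in a component as soon as that
component has a degenerate step there.

Three consequences carry the proof. First, `h` vanishes on all front faces of such a path
(`emHomotopy_front`), so the recursion shrinks to `G_n = ± (AW ⊗ G_{n-1}) Δ h`. Second, `a ⊗ 1` and
`1 ⊗ b` see only one component of the front face, which therefore cannot rest before the cut, while
a cut made before the last step of `β` leaves a pinched back face. Words `1 ⊗ b₁, …, 1 ⊗ b_l, a ⊗ 1`
vanish on pinched simplices (`gmEval_of_pinched`). Hence every word of length at least 2 vanishes
unless it has this form (`gmEval_eq_zero_of_ne`). Third, for such a word exactly one path and one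
cut survive for each `(p, q)`: `b₁` is evaluated on `y(p,…,p+q+1)`, and the vertices `p+1,…,p+q` are
removed from `x` (`gmEval_inr_cons`). Iteration cuts `[0,n]` as the surjection
`(1,2,1,3,1,…,1,l+1,1)` does (`gmEval_pairMap`). The interval cut has additional summands in which
some `bᵢ` receives an interval of length 0; these repeat a vertex of `x` and vanish.

Thus only the shuffle that puts `a` last contributes for `[a] ⊗ [b₁|…|b_l]` with `l ≥ 1`. What is
left is a comparison of signs modulo 2: `cutTermExp_parity` for the permutation and position signs,
and `proj_twist_shuffle` for those from suspension, transposition and shuffling. -/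

noncomputable section

namespace BarGM

/-! ### Words in the tensor algebra and their deconcatenation -/

section Words

variable {k : Type v} [CommRing k] {V : Type w} [AddCommMonoid V] [Module k V]
variable {N : Type w'} [AddCommMonoid N] [Module k N] {Λ : Type*} (ℓ : Λ → V)

variable (k) in
/-- The word in the tensor algebra with the given letters. -/
def word (L : List Λ) : TensorAlgebra k V := (L.map fun x => TensorAlgebra.ι k (ℓ x)).prod

@[simp] lemma word_nil : word k ℓ [] = 1 := rfl

@[simp] lemma word_cons (x : Λ) (L : List Λ) :
    word k ℓ (x :: L) = TensorAlgebra.ι k (ℓ x) * word k ℓ L := by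
  simp [word]

lemma word_eq_tprod (L : List Λ) :
    word k ℓ L = TensorAlgebra.tprod k V L.length fun i => ℓ (L.get i) := by
  rw [TensorAlgebra.tprod_apply, word]
  congr 1
  apply List.ext_getElem <;> simp

lemma tprod_eq_word {n : ℕ} (x : Fin n → Λ) :
    TensorAlgebra.tprod k V n (fun i => ℓ (x i)) = word k ℓ (List.ofFn x) := by
  rw [TensorAlgebra.tprod_apply, word, List.map_ofFn]
  rfl

lemma wordLift_tprod (f : ∀ n, MultilinearMap k (fun _ : Fin n => V) N) {n : ℕ} (x : Fin n → V) :
    wordLift f (TensorAlgebra.tprod k V n x) = f n x := by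
  rw [wordLift]
  simp only [LinearMap.comp_apply, AlgEquiv.toLinearMap_apply,
    TensorAlgebra.equivDirectSum_apply, TensorAlgebra.toDirectSum_tensorPower_tprod]
  rw [← DirectSum.lof_eq_of k, DirectSum.toModule_lof, PiTensorProduct.lift.tprod]

lemma wordLift_word (f : ∀ n, MultilinearMap k (fun _ : Fin n => V) N) (L : List Λ) :
    wordLift f (word k ℓ L) = f L.length fun i => ℓ (L.get i) := by
  rw [word_eq_tprod, wordLift_tprod]

lemma wordLift₂_tprod (f : ∀ m n, MultilinearMap k (fun _ : Fin m ⊕ Fin n => V) N)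
    {m n : ℕ} (x : Fin m → V) (y : Fin n → V) :
    wordLift₂ f (TensorAlgebra.tprod k V m x ⊗ₜ TensorAlgebra.tprod k V n y) =
      f m n (Sum.elim x y) := by
  rw [wordLift₂]
  simp only [LinearMap.comp_apply, AlgEquiv.toLinearMap_apply, TensorProduct.map_tmul,
    TensorAlgebra.equivDirectSum_apply, TensorAlgebra.toDirectSum_tensorPower_tprod]
  rw [← DirectSum.lof_eq_of k, ← DirectSum.lof_eq_of k, LinearEquiv.coe_coe,
    TensorProduct.directSum_lof_tmul_lof, DirectSum.toModule_lof]
  simp only [LinearMap.comp_apply, LinearEquiv.coe_coe]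
  erw [PiTensorProduct.tmulEquiv_apply]
  rw [PiTensorProduct.lift.tprod]

lemma wordLift₂_word (f : ∀ m n, MultilinearMap k (fun _ : Fin m ⊕ Fin n => V) N)
    (L L' : List Λ) :
    wordLift₂ f (word k ℓ L ⊗ₜ word k ℓ L') =
      f L.length L'.length (fun s => ℓ (Sum.elim L.get L'.get s)) := by
  rw [word_eq_tprod, word_eq_tprod, wordLift₂_tprod]
  congr 1
  ext s
  cases s <;> rfl

lemma wordPair_apply {m n : ℕ} (x : Fin m ⊕ Fin n → V) :
    wordPair (k := k) m n x = TensorAlgebra.tprod k V m (fun i => x (Sum.inl i)) ⊗ₜ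
      TensorAlgebra.tprod k V n (fun i => x (Sum.inr i)) := rfl

variable {ℓ}

/-- The tensor algebra is generated by the given letters, and the subalgebra they generate is the
span of their finite products. Linear maps can therefore be compared on words in homogeneous
letters, where Koszul signs make sense. -/
lemma span_word (hℓ : Submodule.span k (Set.range ℓ) = ⊤) :
    Submodule.span k (Set.range (word k ℓ)) = ⊤ := by
  have h1 : Algebra.adjoin k (Set.range fun x => TensorAlgebra.ι k (ℓ x)) = ⊤ := by
    rw [eq_top_iff, ← TensorAlgebra.adjoin_range_ι, Algebra.adjoin_le_iff]
    rintro _ ⟨x, rfl⟩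
    have hx : x ∈ Submodule.span k (Set.range ℓ) := hℓ ▸ Submodule.mem_top
    induction hx using Submodule.span_induction with
    | mem x h =>
      obtain ⟨y, rfl⟩ := h
      exact Algebra.subset_adjoin ⟨y, rfl⟩
    | zero => simp
    | add x y _ _ hx hy => rw [map_add]; exact add_mem hx hy
    | smul c x _ hx => rw [map_smul]; exact Subalgebra.smul_mem _ hx c
  rw [eq_top_iff]
  rintro x -
  have hx : x ∈ Subalgebra.toSubmodule
      (Algebra.adjoin k (Set.range fun x => TensorAlgebra.ι k (ℓ x))) := by
    rw [h1]; trivial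
  rw [Algebra.adjoin_eq_span] at hx
  refine Submodule.span_mono ?_ hx
  intro y hy
  obtain ⟨l, hl, rfl⟩ := Submonoid.exists_list_of_mem_closure hy
  choose f hf using hl
  refine ⟨l.attach.map fun z => f z.1 z.2, ?_⟩
  rw [word, List.map_map]
  congr 1
  refine (List.map_congr_left fun z _ => hf z.1 z.2).trans ?_
  exact List.attach_map_subtype_val l

lemma hom_ext_word (hℓ : Submodule.span k (Set.range ℓ) = ⊤) {f g : TensorAlgebra k V →ₗ[k] N}
    (h : ∀ L, f (word k ℓ L) = g (word k ℓ L)) : f = g :=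
  LinearMap.ext_on_range (span_word hℓ) h

lemma hom_ext_word₂ (hℓ : Submodule.span k (Set.range ℓ) = ⊤)
    {f g : TensorAlgebra k V ⊗[k] TensorAlgebra k V →ₗ[k] N}
    (h : ∀ L L', f (word k ℓ L ⊗ₜ word k ℓ L') = g (word k ℓ L ⊗ₜ word k ℓ L')) : f = g := by
  apply TensorProduct.ext
  apply hom_ext_word hℓ
  intro L
  apply hom_ext_word hℓ
  intro L'
  exact h L L'

/-- The sum over all splittings of a list into two parts. -/
def splitSum {α : Type*} (f : List α → List α → N) (L : List α) : N :=
  match L with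
  | [] => f [] []
  | x :: L => f [] (x :: L) + splitSum (fun L₁ L₂ => f (x :: L₁) L₂) L

lemma splitSum_eq_sum {α : Type*} (f : List α → List α → N) (L : List α) :
    splitSum f L = ∑ i ∈ Finset.range (L.length + 1), f (L.take i) (L.drop i) := by
  induction L generalizing f with
  | nil => simp [splitSum]
  | cons x L ih => rw [splitSum, ih, List.length_cons, Finset.sum_range_succ' _ (L.length + 1)]
                   simp [add_comm]

lemma map_splitSum {α : Type*} {N' : Type*} [AddCommMonoid N'] [Module k N'] (φ : N →ₗ[k] N')
    (f : List α → List α → N) (L : List α) :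
    φ (splitSum f L) = splitSum (fun L₁ L₂ => φ (f L₁ L₂)) L := by
  simp [splitSum_eq_sum]

lemma splitSum_add {α : Type*} (f g : List α → List α → N) (L : List α) :
    splitSum (fun L₁ L₂ => f L₁ L₂ + g L₁ L₂) L = splitSum f L + splitSum g L := by
  simp [splitSum_eq_sum, Finset.sum_add_distrib]

lemma splitSum_congr {α : Type*} {f g : List α → List α → N} {L : List α}
    (h : ∀ L₁ L₂, L₁ ++ L₂ = L → f L₁ L₂ = g L₁ L₂) : splitSum f L = splitSum g L := by
  rw [splitSum_eq_sum, splitSum_eq_sum]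
  exact Finset.sum_congr rfl fun i _ => h _ _ (List.take_append_drop i L)

variable (ℓ)

lemma prod_ofFn_split {A Λ : Type*} [Monoid A] (g h : Λ → A) (L : List Λ) (i : ℕ) :
    (List.ofFn fun j : Fin L.length => if j.val < i then g (L.get j) else h (L.get j)).prod =
      ((L.take i).map g).prod * ((L.drop i).map h).prod := by
  rw [← List.prod_append]
  congr 1
  apply List.ext_getElem
  · simp; omega
  · intro n h1 h2
    simp only [List.getElem_ofFn, List.get_eq_getElem, List.getElem_append, List.length_map,
      List.length_take, List.getElem_map, List.getElem_take, List.getElem_drop]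
    simp only [List.length_ofFn] at h1
    split_ifs with h3 h4 h4
    · rfl
    · omega
    · omega
    · congr 2; omega

/-- In `T ⊗ T` the letters placed in the left factor multiply to `L₁ ⊗ 1` and those in the right one
to `1 ⊗ L₂`, so each summand of the definition is a cut of the word. -/
lemma deconcat_word (L : List Λ) :
    deconcat (word k ℓ L) = splitSum (fun L₁ L₂ => word k ℓ L₁ ⊗ₜ[k] word k ℓ L₂) L := by
  rw [deconcat, wordLift_word, splitSum_eq_sum, Finset.sum_range]
  simp only [sum_apply]
  refine Finset.sum_congr rfl fun i _ => ?_
  simp only [MultilinearMap.compLinearMap_apply, MultilinearMap.mkPiAlgebraFin_apply]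
  have h := prod_ofFn_split
    (fun x : Λ => (TensorAlgebra.ι k (ℓ x) ⊗ₜ[k] (1 : TensorAlgebra k V)))
    (fun x : Λ => ((1 : TensorAlgebra k V) ⊗ₜ[k] TensorAlgebra.ι k (ℓ x))) L i
  refine Eq.trans ?_ (h.trans ?_)
  · congr 2
    ext j
    split_ifs <;> simp
  · have h1 : ∀ L : List Λ, (L.map fun x =>
        (TensorAlgebra.ι k (ℓ x) ⊗ₜ[k] (1 : TensorAlgebra k V))).prod = word k ℓ L ⊗ₜ 1 := by
      intro L
      induction L with
      | nil => rfl
      | cons x L ih => simp [ih]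
    have h2 : ∀ L : List Λ, (L.map fun x =>
        ((1 : TensorAlgebra k V) ⊗ₜ[k] TensorAlgebra.ι k (ℓ x))).prod = 1 ⊗ₜ word k ℓ L := by
      intro L
      induction L with
      | nil => rfl
      | cons x L ih => simp [ih]
    rw [h1, h2]
    simp

lemma wordCounit_word_cons (x : Λ) (L : List Λ) : wordCounit (word k ℓ (x :: L)) = 0 := by
  simp [wordCounit, TensorAlgebra.algebraMapInv]

lemma wordCounit_word_nil : wordCounit (word k ℓ []) = 1 := by
  simp [wordCounit, TensorAlgebra.algebraMapInv]

end Words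

/-! ### Naturality of the coextension of a twisting cochain -/

section Coextension

variable {k : Type v} [CommRing k] {V V' : Type*} [AddCommMonoid V] [Module k V]
  [AddCommMonoid V'] [Module k V']
variable {C C' : Type*} [AddCommMonoid C] [Module k C] [AddCommMonoid C'] [Module k C']

/-- A coalgebra map can be moved past all iterated coproducts, and hence absorbed into the twisting
cochain. -/
lemma coextPart_comp {ε : C →ₗ[k] k} {Δ : C →ₗ[k] C ⊗[k] C} {ε' : C' →ₗ[k] k}
    {Δ' : C' →ₗ[k] C' ⊗[k] C'} (φ : C' →ₗ[k] C) (hε : ε ∘ₗ φ = ε')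
    (hΔ : Δ ∘ₗ φ = TensorProduct.map φ φ ∘ₗ Δ') (t : C →ₗ[k] V) (n : ℕ) :
    coextPart ε Δ t n ∘ₗ φ = coextPart ε' Δ' (t ∘ₗ φ) n := by
  induction n with
  | zero => rw [coextPart, coextPart, LinearMap.comp_assoc, hε]
  | succ n ih =>
    rw [coextPart, coextPart, ← ih, LinearMap.comp_assoc, LinearMap.comp_assoc, hΔ,
      ← LinearMap.comp_assoc _ _ (TensorProduct.map _ _), ← TensorProduct.map_comp]
    rfl

lemma lift_comp_coextPart (ε : C →ₗ[k] k) (Δ : C →ₗ[k] C ⊗[k] C) (t : C →ₗ[k] V)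
    (g : V →ₗ[k] V') (n : ℕ) :
    (TensorAlgebra.lift k (TensorAlgebra.ι k ∘ₗ g)).toLinearMap ∘ₗ coextPart ε Δ t n =
      coextPart ε Δ (g ∘ₗ t) n := by
  induction n with
  | zero =>
    ext x
    simp [coextPart]
  | succ n ih =>
    rw [coextPart, coextPart, ← ih]
    simp only [← LinearMap.comp_assoc]
    congr 1
    ext x y
    simp

end Coextension

/-! ### Signed shuffles, recursively and as bijections -/

section Shuffle

variable {k : Type v} [CommRing k] {N : Type w'} [AddCommMonoid N] [Module k N]
variable {Λ : Type w} (δ : Λ → ℕ)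

/-- The total degree of a word. -/
def wordDeg (L : List Λ) : ℕ := (L.map δ).sum

@[simp] lemma wordDeg_nil : wordDeg δ [] = 0 := rfl

@[simp] lemma wordDeg_cons (x : Λ) (L : List Λ) : wordDeg δ (x :: L) = δ x + wordDeg δ L := by
  simp [wordDeg]

lemma sum_get_eq_wordDeg (L : List Λ) : ∑ i, δ (L.get i) = wordDeg δ L := by
  induction L with
  | nil => rfl
  | cons x L ih =>
    rw [wordDeg_cons, ← ih]
    exact Fin.sum_univ_succ (n := L.length) (fun i => δ ((x :: L).get i))

variable (k) in
/-- The signed sum over all shuffles of two words, split according to the first letter. -/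
def shSum (f : List (Λ ⊕ Λ) → N) (L L' : List Λ) : N :=
  match L, L' with
  | [], L' => f (L'.map Sum.inr)
  | a :: L, [] => f ((a :: L).map Sum.inl)
  | a :: L, b :: L' => shSum (fun W => f (Sum.inl a :: W)) L (b :: L') +
      ((-1 : k) ^ (δ b * wordDeg δ (a :: L))) • shSum (fun W => f (Sum.inr b :: W)) (a :: L) L'
  termination_by L.length + L'.length

lemma shSum_nil_left (f : List (Λ ⊕ Λ) → N) (L' : List Λ) :
    shSum k δ f [] L' = f (L'.map Sum.inr) := by
  rw [shSum]

lemma shSum_nil_right (f : List (Λ ⊕ Λ) → N) (L : List Λ) :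
    shSum k δ f L [] = f (L.map Sum.inl) := by
  cases L with
  | nil => rw [shSum]; rfl
  | cons => rw [shSum]

lemma shSum_cons_cons (f : List (Λ ⊕ Λ) → N) (a b : Λ) (L L' : List Λ) :
    shSum k δ f (a :: L) (b :: L') = shSum k δ (fun W => f (Sum.inl a :: W)) L (b :: L') +
      ((-1 : k) ^ (δ b * wordDeg δ (a :: L))) •
        shSum k δ (fun W => f (Sum.inr b :: W)) (a :: L) L' := by
  rw [shSum]

lemma map_shSum {N' : Type*} [AddCommMonoid N'] [Module k N'] (φ : N →ₗ[k] N')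
    (f : List (Λ ⊕ Λ) → N) (L L' : List Λ) :
    φ (shSum k δ f L L') = shSum k δ (fun W => φ (f W)) L L' := by
  induction f, L, L' using shSum.induct with
  | case1 f L' => simp [shSum_nil_left]
  | case2 f a L => simp [shSum_nil_right]
  | case3 f a L b L' ih1 ih2 => rw [shSum_cons_cons, shSum_cons_cons, map_add, map_smul, ih1, ih2]

lemma shSum_add (f g : List (Λ ⊕ Λ) → N) (L L' : List Λ) :
    shSum k δ (fun W => f W + g W) L L' = shSum k δ f L L' + shSum k δ g L L' := by
  induction f, L, L' using shSum.induct generalizing g with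
  | case1 f L' => simp [shSum_nil_left]
  | case2 f a L => simp [shSum_nil_right]
  | case3 f a L b L' ih1 ih2 =>
    rw [shSum_cons_cons, shSum_cons_cons, shSum_cons_cons, ih1, ih2, smul_add]
    abel

/-- A word with letters of two kinds is a shuffle of its parts of either kind. -/
lemma shSum_congr {f g : List (Λ ⊕ Λ) → N} {L L' : List Λ}
    (h : ∀ W, W.filterMap Sum.getLeft? = L → W.filterMap Sum.getRight? = L' → f W = g W) :
    shSum k δ f L L' = shSum k δ g L L' := by
  induction f, L, L' using shSum.induct generalizing g with
  | case1 f L' =>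
    rw [shSum_nil_left, shSum_nil_left]
    have e : (Sum.getRight? ∘ Sum.inr (α := Λ) : Λ → Option Λ) = some := rfl
    exact h _ (by simp) (by simp [e])
  | case2 f a L =>
    rw [shSum_nil_right, shSum_nil_right]
    have e : (Sum.getLeft? ∘ Sum.inl (β := Λ) : Λ → Option Λ) = some := rfl
    exact h _ (by simp [e]) (by simp)
  | case3 f a L b L' ih1 ih2 =>
    rw [shSum_cons_cons, shSum_cons_cons, ih1 (g := fun W => g (Sum.inl a :: W)),
      ih2 (g := fun W => g (Sum.inr b :: W))]
    · intro W h1 h2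
      refine h (Sum.inr b :: W) ?_ ?_
      · simp only [List.filterMap_cons, Sum.getLeft?, h1]
      · simp only [List.filterMap_cons, Sum.getRight?, h2]
    · intro W h1 h2
      refine h (Sum.inl a :: W) ?_ ?_
      · simp only [List.filterMap_cons, Sum.getLeft?, h1]
      · simp only [List.filterMap_cons, Sum.getRight?, h2]

lemma shSum_zero (L L' : List Λ) : shSum k δ (fun _ => (0 : N)) L L' = 0 := by
  simpa using (map_shSum δ (0 : N →ₗ[k] N) (fun _ => (0 : N)) L L').symm

lemma splitSum_smul {α : Type*} (r : k) (f : List α → List α → N) (L : List α) :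
    r • splitSum f L = splitSum (fun L₁ L₂ => r • f L₁ L₂) L :=
  map_splitSum (LinearMap.lsmul k N r) f L

lemma splitSum_map {α β : Type*} (φ : α → β) (f : List β → List β → N) (L : List α) :
    splitSum f (L.map φ) = splitSum (fun L₁ L₂ => f (L₁.map φ) (L₂.map φ)) L := by
  simp [splitSum_eq_sum]

/-- Compatibility of shuffles and deconcatenation. -/
lemma shSum_splitSum (g : List (Λ ⊕ Λ) → List (Λ ⊕ Λ) → N) (L L' : List Λ) :
    shSum k δ (fun W => splitSum g W) L L' =
      splitSum (fun L₁ L₂ => splitSum (fun L₁' L₂' =>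
        ((-1 : k) ^ (wordDeg δ L₂ * wordDeg δ L₁')) •
          shSum k δ (fun W => shSum k δ (fun W' => g W W') L₂ L₂') L₁ L₁') L') L := by
  induction hn : L.length + L'.length generalizing g L L' with
  | zero =>
    obtain ⟨rfl, rfl⟩ : L = [] ∧ L' = [] := by
      constructor <;> apply List.eq_nil_of_length_eq_zero <;> omega
    simp [shSum_nil_left, splitSum]
  | succ n ih =>
    rcases L with _ | ⟨a, L⟩
    · simp only [shSum_nil_left, splitSum, wordDeg_nil, zero_mul, pow_zero, one_smul]
      rw [splitSum_map]
    · rcases L' with _ | ⟨b, L'⟩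
      · simp only [shSum_nil_right, splitSum, wordDeg_nil, mul_zero, pow_zero, one_smul]
        rw [splitSum_map]
        rfl
      · simp only [List.length_cons] at hn
        have ih1 := ih (fun W W' => g (Sum.inl a :: W) W') L (b :: L') (by simp; omega)
        have ih2 := ih (fun W W' => g (Sum.inr b :: W) W') (a :: L) L' (by simp; omega)
        rw [shSum_cons_cons]
        simp only [splitSum, shSum_add] at ih1 ih2 ⊢
        rw [ih1, ih2]
        simp only [shSum_cons_cons, shSum_nil_left, shSum_nil_right, wordDeg_cons, wordDeg_nil,
          mul_zero, pow_zero, one_smul, smul_add, splitSum_add, splitSum_smul, smul_smul,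
          ← pow_add, List.map_nil, List.map_cons]
        have e1 : ∀ x : ℕ, (-1 : k) ^ (δ b * (δ a + wordDeg δ L) + (δ a + wordDeg δ L) * x) =
            (-1 : k) ^ ((δ a + wordDeg δ L) * (δ b + x)) := fun x => by ring
        simp only [e1]
        -- When `b` is the first letter of a shuffle of `a :: L`, it passes `a`, `L₁` and `L₂`.
        -- After cutting, it passes `a :: L₁` inside the first shuffle, and `L₂` in the Koszul
        -- interchange of `L₂` with the part of the second word that starts with `b`.
        have e2 : ∀ L₁ L₂ L₁' : List Λ, L₁ ++ L₂ = L →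
            (-1 : k) ^ (δ b * (δ a + wordDeg δ L) + wordDeg δ L₂ * wordDeg δ L₁') =
            (-1 : k) ^ (wordDeg δ L₂ * (δ b + wordDeg δ L₁') + δ b * (δ a + wordDeg δ L₁)) := by
          rintro L₁ L₂ L₁' rfl
          have : wordDeg δ (L₁ ++ L₂) = wordDeg δ L₁ + wordDeg δ L₂ := by simp [wordDeg]
          rw [this]
          ring
        have e3 : splitSum (fun L₁ L₂ => splitSum (fun L₁' L₂' =>
            (-1 : k) ^ (δ b * (δ a + wordDeg δ L) + wordDeg δ L₂ * wordDeg δ L₁') •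
              shSum k δ (fun W => shSum k δ (fun W' => g (Sum.inr b :: W) W') L₂ L₂')
                (a :: L₁) L₁') L') L =
            splitSum (fun L₁ L₂ => splitSum (fun L₁' L₂' =>
            (-1 : k) ^ (wordDeg δ L₂ * (δ b + wordDeg δ L₁') + δ b * (δ a + wordDeg δ L₁)) •
              shSum k δ (fun W => shSum k δ (fun W' => g (Sum.inr b :: W) W') L₂ L₂')
                (a :: L₁) L₁') L') L :=
          splitSum_congr fun L₁ L₂ h => splitSum_congr fun L₁' L₂' _ => by rw [e2 _ _ _ h]
        rw [e3]
        rw [one_mul]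
        abel

variable {p q n : ℕ}

/-- Adding a first letter to the first word. -/
def optionSumLeft (p q : ℕ) : Option (Fin p ⊕ Fin q) ≃ Fin (p + 1) ⊕ Fin q where
  toFun s := s.elim (Sum.inl 0) (Sum.map Fin.succ id)
  invFun := Sum.elim (Fin.cons none fun i => some (Sum.inl i)) fun j => some (Sum.inr j)
  left_inv := by rintro (_ | _ | _) <;> rfl
  right_inv := by
    rintro (i | j)
    · refine Fin.cases rfl (fun i => rfl) i
    · rfl

/-- Adding a first letter to the second word. -/
def optionSumRight (p q : ℕ) : Option (Fin p ⊕ Fin q) ≃ Fin p ⊕ Fin (q + 1) where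
  toFun s := s.elim (Sum.inr 0) (Sum.map id Fin.succ)
  invFun := Sum.elim (fun j => some (Sum.inl j)) (Fin.cons none fun i => some (Sum.inr i))
  left_inv := by rintro (_ | _ | _) <;> rfl
  right_inv := by
    rintro (i | j)
    · rfl
    · refine Fin.cases rfl (fun i => rfl) j

/-- Extending a bijection with `Fin n` by a new first element. -/
def consEquiv {S T : Type*} (ψ : Option S ≃ T) (σ : S ≃ Fin n) : T ≃ Fin (n + 1) :=
  ψ.symm.trans ((Equiv.optionCongr σ).trans (finSuccEquiv n).symm)

lemma consEquiv_none {S T : Type*} (ψ : Option S ≃ T) (σ : S ≃ Fin n) :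
    consEquiv ψ σ (ψ none) = 0 := by simp [consEquiv]

lemma consEquiv_some {S T : Type*} (ψ : Option S ≃ T) (σ : S ≃ Fin n) (s : S) :
    consEquiv ψ σ (ψ (some s)) = (σ s).succ := by simp [consEquiv]

lemma consEquiv_symm_zero {S T : Type*} (ψ : Option S ≃ T) (σ : S ≃ Fin n) :
    (consEquiv ψ σ).symm 0 = ψ none := by rw [Equiv.symm_apply_eq, consEquiv_none]

lemma consEquiv_symm_succ {S T : Type*} (ψ : Option S ≃ T) (σ : S ≃ Fin n) (i : Fin n) :
    (consEquiv ψ σ).symm i.succ = ψ (some (σ.symm i)) := by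
  rw [Equiv.symm_apply_eq, consEquiv_some, Equiv.apply_symm_apply]

lemma consEquiv_injective {S T : Type*} (ψ : Option S ≃ T) :
    Function.Injective (consEquiv (n := n) ψ) := by
  intro σ τ h
  ext s : 1
  apply Fin.succ_injective
  rw [← consEquiv_some ψ, ← consEquiv_some ψ, h]

lemma exists_consEquiv {S T : Type*} (ψ : Option S ≃ T) (τ : T ≃ Fin (n + 1))
    (h : τ (ψ none) = 0) : ∃ σ, consEquiv ψ σ = τ := by
  let e := ψ.trans (τ.trans (finSuccEquiv n))
  have he : ∀ s, ∃ x, e (some s) = some x := by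
    intro s
    refine Option.ne_none_iff_exists'.1 fun hs => ?_
    have h0 : e none = none := by simp [e, h]
    exact Option.some_ne_none s (e.injective (hs.trans h0.symm))
  refine ⟨Equiv.removeNone e, ?_⟩
  ext t : 1
  obtain ⟨s | s, rfl⟩ := ψ.surjective t
  · rw [consEquiv_none, h]
  · rw [consEquiv_some]
    have := Equiv.removeNone_some e (he s)
    simpa [e] using congrArg (finSuccEquiv n).symm this

/-- The `(p,q)`-shuffles with values in `Fin n`. -/
def shufflesTo (p q n : ℕ) : Finset (Fin p ⊕ Fin q ≃ Fin n) :=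
  open Classical in
  Finset.univ.filter fun σ =>
    StrictMono (fun i => σ (Sum.inl i)) ∧ StrictMono (fun j => σ (Sum.inr j))

lemma mem_shufflesTo {σ : Fin p ⊕ Fin q ≃ Fin n} : σ ∈ shufflesTo p q n ↔
    StrictMono (fun i => σ (Sum.inl i)) ∧ StrictMono (fun j => σ (Sum.inr j)) := by
  simp [shufflesTo]

lemma strictMono_succ_iff {f : Fin p → Fin n} :
    StrictMono (fun i => (f i).succ) ↔ StrictMono f := by
  simp [StrictMono]

lemma strictMono_zero_cons_iff {g : Fin (p + 1) → Fin (n + 1)} {f : Fin p → Fin n}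
    (h0 : g 0 = 0) (h : ∀ i, g i.succ = (f i).succ) : StrictMono g ↔ StrictMono f := by
  constructor
  · intro hg i j hij
    have := hg (Fin.succ_lt_succ_iff.2 hij)
    rwa [h, h, Fin.succ_lt_succ_iff] at this
  · intro hf i j
    refine Fin.cases ?_ (fun i => ?_) i <;> refine Fin.cases ?_ (fun j => ?_) j
    · simp
    · intro _
      rw [h0, h]
      exact Fin.succ_pos _
    · simp
    · intro hij
      rw [h, h, Fin.succ_lt_succ_iff]
      exact hf (Fin.succ_lt_succ_iff.1 hij)

lemma consEquiv_left_mem {σ : Fin p ⊕ Fin q ≃ Fin n} :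
    consEquiv (optionSumLeft p q) σ ∈ shufflesTo (p + 1) q (n + 1) ↔ σ ∈ shufflesTo p q n := by
  rw [mem_shufflesTo, mem_shufflesTo]
  refine and_congr (strictMono_zero_cons_iff ?_ ?_) ?_
  · exact consEquiv_none (optionSumLeft p q) σ
  · exact fun i => consEquiv_some (optionSumLeft p q) σ (Sum.inl i)
  · rw [← strictMono_succ_iff (f := fun j => σ (Sum.inr j))]
    refine iff_of_eq (congrArg _ (funext fun j => ?_))
    exact consEquiv_some (optionSumLeft p q) σ (Sum.inr j)

lemma consEquiv_right_mem {σ : Fin p ⊕ Fin q ≃ Fin n} :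
    consEquiv (optionSumRight p q) σ ∈ shufflesTo p (q + 1) (n + 1) ↔ σ ∈ shufflesTo p q n := by
  rw [mem_shufflesTo, mem_shufflesTo]
  refine and_congr ?_ (strictMono_zero_cons_iff ?_ ?_)
  · rw [← strictMono_succ_iff (f := fun i => σ (Sum.inl i))]
    refine iff_of_eq (congrArg _ (funext fun j => ?_))
    exact consEquiv_some (optionSumRight p q) σ (Sum.inl j)
  · exact consEquiv_none (optionSumRight p q) σ
  · exact fun i => consEquiv_some (optionSumRight p q) σ (Sum.inr i)

/-- Position 0 of a shuffle of two non-empty words is taken by the first letter of one of them.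
Removing that letter leaves a shuffle of the remaining words. -/
lemma sum_shufflesTo_succ (F : (Fin (p + 1) ⊕ Fin (q + 1) ≃ Fin (n + 1)) → N) :
    ∑ σ ∈ shufflesTo (p + 1) (q + 1) (n + 1), F σ =
      ∑ σ ∈ shufflesTo p (q + 1) n, F (consEquiv (optionSumLeft p (q + 1)) σ) +
      ∑ σ ∈ shufflesTo (p + 1) q n, F (consEquiv (optionSumRight (p + 1) q) σ) := by
  classical
  rw [← Finset.sum_filter_add_sum_filter_not _ (fun σ => σ (Sum.inl 0) = 0)]
  congr 1
  · symm
    refine Finset.sum_bij (fun σ _ => consEquiv (optionSumLeft p (q + 1)) σ) ?_ ?_ ?_ ?_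
    · intro σ hσ
      rw [Finset.mem_filter, consEquiv_left_mem]
      exact ⟨hσ, consEquiv_none (optionSumLeft p (q + 1)) σ⟩
    · exact fun _ _ _ _ h => consEquiv_injective _ h
    · intro τ hτ
      rw [Finset.mem_filter] at hτ
      obtain ⟨σ, rfl⟩ := exists_consEquiv (optionSumLeft p (q + 1)) τ hτ.2
      exact ⟨σ, consEquiv_left_mem.1 hτ.1, rfl⟩
    · exact fun _ _ => rfl
  · symm
    refine Finset.sum_bij (fun σ _ => consEquiv (optionSumRight (p + 1) q) σ) ?_ ?_ ?_ ?_
    · intro σ hσ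
      rw [Finset.mem_filter, consEquiv_right_mem]
      refine ⟨hσ, fun h => ?_⟩
      exact Fin.succ_ne_zero _
        ((consEquiv_some (optionSumRight (p + 1) q) σ (Sum.inl 0)).symm.trans h)
    · exact fun _ _ _ _ h => consEquiv_injective _ h
    · intro τ hτ
      rw [Finset.mem_filter] at hτ
      -- Whichever letter sits at position 0, monotonicity forces the first letter of its word to
      -- sit there as well; by assumption this is not the first word.
      have h0 : τ (Sum.inr 0) = 0 := by
        obtain ⟨h1, h2⟩ := mem_shufflesTo.1 hτ.1
        obtain ⟨s, hs⟩ := τ.surjective 0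
        rcases s with i | j
        · exact absurd (Fin.le_zero_iff.1 (hs ▸ h1.monotone (Fin.zero_le i))) hτ.2
        · exact Fin.le_zero_iff.1 (hs ▸ h2.monotone (Fin.zero_le j))
      obtain ⟨σ, rfl⟩ := exists_consEquiv (optionSumRight (p + 1) q) τ h0
      exact ⟨σ, consEquiv_right_mem.1 hτ.1, rfl⟩
    · exact fun _ _ => rfl

lemma shufflesTo_zero_left : shufflesTo 0 q q = {Equiv.emptySum (Fin 0) (Fin q)} := by
  ext σ
  rw [mem_shufflesTo, Finset.mem_singleton]
  constructor
  · rintro ⟨-, h⟩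
    ext s : 1
    rcases s with i | j
    · exact i.elim0
    · exact congrFun h.eq_id j
  · rintro rfl
    exact ⟨fun i => i.elim0, fun i j h => h⟩

lemma shufflesTo_zero_right : shufflesTo p 0 p = {Equiv.sumEmpty (Fin p) (Fin 0)} := by
  ext σ
  rw [mem_shufflesTo, Finset.mem_singleton]
  constructor
  · rintro ⟨h, -⟩
    ext s : 1
    rcases s with i | j
    · exact congrFun h.eq_id i
    · exact j.elim0
  · rintro rfl
    exact ⟨fun i j h => h, fun i => i.elim0⟩

/-- The exponent of the Koszul sign of a shuffle. -/
def shuffleExp (D : Fin p → ℕ) (D' : Fin q → ℕ) (σ : Fin p ⊕ Fin q ≃ Fin n) : ℕ :=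
  ∑ i, ∑ j, if σ (Sum.inr j) < σ (Sum.inl i) then D i * D' j else 0

lemma shuffleExp_left (D : Fin (p + 1) → ℕ) (D' : Fin q → ℕ) (σ : Fin p ⊕ Fin q ≃ Fin n) :
    shuffleExp D D' (consEquiv (optionSumLeft p q) σ) = shuffleExp (fun i => D i.succ) D' σ := by
  rw [shuffleExp, Fin.sum_univ_succ]
  have h0 : consEquiv (optionSumLeft p q) σ (Sum.inl 0) = 0 := consEquiv_none _ σ
  have h1 : ∀ i : Fin p, consEquiv (optionSumLeft p q) σ (Sum.inl i.succ) =
    (σ (Sum.inl i)).succ := fun i => consEquiv_some (optionSumLeft p q) σ (Sum.inl i)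
  have h2 : ∀ i, consEquiv (optionSumLeft p q) σ (Sum.inr i) =
    (σ (Sum.inr i)).succ := fun i => consEquiv_some (optionSumLeft p q) σ (Sum.inr i)
  simp [h0, h1, h2, shuffleExp]

/-- A letter of the second word that comes first is inverted with every letter of the first word. -/
lemma shuffleExp_right (D : Fin p → ℕ) (D' : Fin (q + 1) → ℕ) (σ : Fin p ⊕ Fin q ≃ Fin n) :
    shuffleExp D D' (consEquiv (optionSumRight p q) σ) =
      D' 0 * ∑ i, D i + shuffleExp D (fun i => D' i.succ) σ := by
  rw [shuffleExp]
  simp_rw [Fin.sum_univ_succ]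
  have h0 : consEquiv (optionSumRight p q) σ (Sum.inr 0) = 0 := consEquiv_none _ σ
  have h1 : ∀ i, consEquiv (optionSumRight p q) σ (Sum.inr i.succ) =
    (σ (Sum.inr i)).succ := fun i => consEquiv_some (optionSumRight p q) σ (Sum.inr i)
  have h2 : ∀ i, consEquiv (optionSumRight p q) σ (Sum.inl i) =
    (σ (Sum.inl i)).succ := fun i => consEquiv_some (optionSumRight p q) σ (Sum.inl i)
  simp [h0, h1, h2, shuffleExp, Finset.sum_add_distrib, Finset.sum_mul, mul_comm (D' 0)]

lemma shuffle_term_left (f : List (Λ ⊕ Λ) → N) (u : Fin (p + 1) → Λ) (v : Fin q → Λ)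
    (σ : Fin p ⊕ Fin q ≃ Fin n) :
    ((-1 : k) ^ shuffleExp (fun i => δ (u i)) (fun j => δ (v j))
        (consEquiv (optionSumLeft p q) σ)) •
      f (List.ofFn fun i => Sum.map u v ((consEquiv (optionSumLeft p q) σ).symm i)) =
    ((-1 : k) ^ shuffleExp (fun i : Fin p => δ (u i.succ)) (fun j => δ (v j)) σ) •
      f (Sum.inl (u 0) :: List.ofFn fun i => Sum.map (fun i => u i.succ) v (σ.symm i)) := by
  rw [shuffleExp_left, List.ofFn_succ, consEquiv_symm_zero]
  simp_rw [consEquiv_symm_succ]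
  congr 4
  ext i : 1
  rcases σ.symm i with s | s <;> rfl

lemma shuffle_term_right (f : List (Λ ⊕ Λ) → N) (u : Fin p → Λ) (v : Fin (q + 1) → Λ)
    (σ : Fin p ⊕ Fin q ≃ Fin n) :
    ((-1 : k) ^ shuffleExp (fun i => δ (u i)) (fun j => δ (v j))
        (consEquiv (optionSumRight p q) σ)) •
      f (List.ofFn fun i => Sum.map u v ((consEquiv (optionSumRight p q) σ).symm i)) =
    ((-1 : k) ^ (δ (v 0) * ∑ i, δ (u i))) •
    ((-1 : k) ^ shuffleExp (fun i => δ (u i)) (fun j : Fin q => δ (v j.succ)) σ) •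
      f (Sum.inr (v 0) :: List.ofFn fun i => Sum.map u (fun j => v j.succ) (σ.symm i)) := by
  rw [shuffleExp_right, List.ofFn_succ, consEquiv_symm_zero, smul_smul, ← pow_add]
  simp_rw [consEquiv_symm_succ]
  congr 4
  ext i : 1
  rcases σ.symm i with s | s <;> rfl

/-- The shuffles of two words in terms of the recursion on the first letter. -/
lemma sum_shufflesTo (f : List (Λ ⊕ Λ) → N) (L L' : List Λ) (hn : L.length + L'.length = n) :
    ∑ σ ∈ shufflesTo L.length L'.length n,
      ((-1 : k) ^ shuffleExp (fun i => δ (L.get i)) (fun j => δ (L'.get j)) σ) •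
        f (List.ofFn fun i => Sum.map L.get L'.get (σ.symm i)) = shSum k δ f L L' := by
  induction f, L, L' using shSum.induct generalizing n with
  | case1 f L' =>
    obtain rfl : n = L'.length := by simpa using hn.symm
    rw [shSum_nil_left]
    have : shufflesTo (List.nil (α := Λ)).length L'.length L'.length = _ :=
      shufflesTo_zero_left (q := L'.length)
    rw [this, Finset.sum_singleton]
    have e : L'.map Sum.inr = List.ofFn fun i => Sum.inr (α := Λ) (L'.get i) := by
      apply List.ext_getElem <;> simp
    refine (congrArg₂ (fun (m : ℕ) x => ((-1 : k) ^ m) • f x)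
      (Finset.sum_eq_zero fun i _ => i.elim0) e.symm).trans ?_
    simp only [pow_zero, one_smul]
  | case2 f a L =>
    obtain rfl : n = (a :: L).length := by simpa using hn.symm
    rw [shSum_nil_right]
    have : shufflesTo (a :: L).length (List.nil (α := Λ)).length (a :: L).length = _ :=
      shufflesTo_zero_right (p := (a :: L).length)
    rw [this, Finset.sum_singleton]
    have e : (a :: L).map Sum.inl = List.ofFn fun i => Sum.inl (β := Λ) ((a :: L).get i) := by
      apply List.ext_getElem <;> simp
    refine (congrArg₂ (fun (m : ℕ) x => ((-1 : k) ^ m) • f x)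
      (Finset.sum_eq_zero fun i _ => Finset.sum_eq_zero fun j _ => j.elim0) e.symm).trans ?_
    simp only [pow_zero, one_smul]
  | case3 f a L b L' ih1 ih2 =>
    obtain ⟨n, rfl⟩ : ∃ m, n = m + 1 := ⟨L.length + L'.length + 1, by simp at hn; omega⟩
    rw [shSum_cons_cons]
    refine (sum_shufflesTo_succ _).trans (congrArg₂ _ ?_ ?_)
    · rw [← ih1 (n := n) (by simp at hn ⊢; omega)]
      exact Finset.sum_congr rfl fun σ _ =>
        shuffle_term_left δ f (a :: L).get (b :: L').get σ
    · rw [← ih2 (n := n) (by simp at hn ⊢; omega), Finset.smul_sum, ← sum_get_eq_wordDeg]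
      exact Finset.sum_congr rfl fun σ _ =>
        shuffle_term_right δ f (a :: L).get (b :: L').get σ

end Shuffle

/-! ### Homogeneous letters; the shuffle map as a coalgebra map; reduction to twisting cochains -/

section Letters

variable {k : Type v} [CommRing k]

lemma homMulti_lof {ι : Type} [Fintype ι] [DecidableEq ι] {I : Type} [DecidableEq I]
    {M : I → Type w} [∀ i, AddCommMonoid (M i)] [∀ i, Module k (M i)]
    {N : Type w'} [AddCommMonoid N] [Module k N]
    (f : ∀ P : ι → I, MultilinearMap k (fun i => M (P i)) N) (P : ι → I) (x : ∀ i, M (P i)) :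
    homMulti k f (fun i => DirectSum.lof k I M (P i) (x i)) = f P x :=
  MultilinearMap.fromDFinsuppEquiv_single f P x

lemma Augmented.proj_apply {A : Type w} [AddCommMonoid A] [Module k A] (a : Augmented k A)
    (x : A) : (a.proj x : A) = x + (-1 : k) • a.aug x • a.unit := rfl

lemma Augmented.coe_proj {A : Type w} [AddCommMonoid A] [Module k A] (a : Augmented k A)
    {x : A} (h : a.aug x = 0) : (a.proj x : A) = x := by
  rw [proj_apply, h, zero_smul, smul_zero, add_zero]

lemma Augmented.proj_coe {A : Type w} [AddCommMonoid A] [Module k A] (a : Augmented k A)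
    (x : a.ideal) : a.proj x = x :=
  Subtype.ext (a.coe_proj x.2)

lemma Augmented.proj_unit {A : Type w} [AddCommMonoid A] [Module k A] (a : Augmented k A) :
    a.proj a.unit = 0 := by
  apply Subtype.ext
  have : a.unit + (-1 : k) • a.unit = ((1 : k) + -1) • a.unit := by rw [add_smul, one_smul]
  rw [proj_apply, a.aug_unit, one_smul, this, add_neg_cancel, zero_smul]
  rfl

variable {M : ℕ → Type w} [∀ n, AddCommMonoid (M n)] [∀ n, Module k (M n)]
variable (a : Augmented k (⨁ n, M n))

/-- A homogeneous element of the augmentation ideal. -/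
structure Letter where
  deg : ℕ
  val : M deg
  mem : DirectSum.lof k ℕ M deg val ∈ a.ideal

variable {a}

/-- The element of the augmented algebra underlying a letter. -/
def Letter.toAlg (x : Letter a) : ⨁ n, M n := DirectSum.lof k ℕ M x.deg x.val

/-- A letter as an element of the augmentation ideal. -/
def Letter.toIdeal (x : Letter a) : a.ideal := ⟨x.toAlg, x.mem⟩

/-- The degree of a desuspended letter, up to a multiple of two. -/
def Letter.sdeg (x : Letter a) : ℕ := x.deg + 1

/-- The letters `a ⊗ 1` and `1 ⊗ b` of `B(A ⊗ A)`. -/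
def Letter.tensorIdeal : Letter a ⊕ Letter a → (a.tensor a).ideal :=
  Sum.elim (fun x => (a.tensor a).proj (x.toAlg ⊗ₜ a.unit))
    (fun x => (a.tensor a).proj (a.unit ⊗ₜ x.toAlg))

/-- The augmentation is concentrated in degree 0, so the homogeneous components of an element of the
augmentation ideal lie in it, too. -/
lemma span_letter (haug : ∀ n ≠ 0, ∀ m, a.aug (DirectSum.lof k ℕ M n m) = 0) :
    Submodule.span k (Set.range (Letter.toIdeal (a := a))) = ⊤ := by
  classical
  have hm : ∀ x ∈ a.ideal, ∀ i, DirectSum.lof k ℕ M i (x i) ∈ a.ideal := by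
    intro x hx i
    rcases eq_or_ne i 0 with rfl | hi
    · have h1 : ∑ i ∈ DFinsupp.support x, DirectSum.lof k ℕ M i (x i) = x :=
        DirectSum.sum_support_of x
      have h2 : a.aug x = 0 := hx
      rw [← h1, map_sum, Finset.sum_eq_single 0] at h2
      · exact h2
      · exact fun i _ hi => haug i hi _
      · intro h
        rw [DFinsupp.notMem_support_iff.1 h]
        simp
    · exact haug i hi _
  rw [eq_top_iff]
  rintro x -
  have h1 : x = ∑ i ∈ DFinsupp.support x.1,
      Letter.toIdeal ⟨i, x.1 i, hm x.1 x.2 i⟩ := by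
    ext1
    rw [AddSubmonoidClass.coe_finsetSum]
    exact (DirectSum.sum_support_of x.1).symm
  rw [h1]
  exact Submodule.sum_mem _ fun i _ => Submodule.subset_span ⟨_, rfl⟩

lemma koszulSwap_word (L L' : List (Letter a)) :
    koszulSwap a (word k Letter.toIdeal L ⊗ₜ word k Letter.toIdeal L') =
      ((-1 : k) ^ (wordDeg Letter.sdeg L * wordDeg Letter.sdeg L')) •
        (word k Letter.toIdeal L' ⊗ₜ word k Letter.toIdeal L) := by
  rw [koszulSwap, wordLift₂_word, MultilinearMap.compLinearMap_apply]
  refine (homMulti_lof _ (fun s => (Sum.elim L.get L'.get s).deg)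
    (fun s => (Sum.elim L.get L'.get s).val)).trans ?_
  rw [smul_apply, MultilinearMap.compLinearMap_apply,
    LinearMap.compMultilinearMap_apply, wordPair_apply]
  simp only [LinearMap.comp_apply]
  have h : ∀ x : Letter a, a.proj (DirectSum.lof k ℕ M x.deg x.val) = x.toIdeal :=
    fun x => a.proj_coe x.toIdeal
  simp only [h]
  rw [← sum_get_eq_wordDeg, ← sum_get_eq_wordDeg, word_eq_tprod, word_eq_tprod]
  rfl

lemma tensorCoprod_word (L L' : List (Letter a)) :
    tensorCoprod a (word k Letter.toIdeal L ⊗ₜ word k Letter.toIdeal L') =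
      splitSum (fun L₁ L₂ => splitSum (fun L₁' L₂' =>
        ((-1 : k) ^ (wordDeg Letter.sdeg L₂ * wordDeg Letter.sdeg L₁')) •
          ((word k Letter.toIdeal L₁ ⊗ₜ[k] word k Letter.toIdeal L₁') ⊗ₜ[k]
            (word k Letter.toIdeal L₂ ⊗ₜ[k] word k Letter.toIdeal L₂'))) L') L := by
  simp only [tensorCoprod, LinearMap.comp_apply, TensorProduct.map_tmul, deconcat_word]
  simp only [splitSum_eq_sum, TensorProduct.sum_tmul, TensorProduct.tmul_sum, map_sum,
    LinearEquiv.coe_coe]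
  rw [Finset.sum_comm]
  refine Finset.sum_congr rfl fun i _ => Finset.sum_congr rfl fun j _ => ?_
  simp only [TensorProduct.assoc_tmul, LinearMap.lTensor_tmul, LinearMap.comp_apply,
    LinearEquiv.coe_coe, TensorProduct.assoc_symm_tmul, LinearMap.rTensor_tmul, koszulSwap_word,
    TensorProduct.smul_tmul', TensorProduct.tmul_smul]

lemma shuffleMap_word (L L' : List (Letter a)) :
    shuffleMap a (word k Letter.toIdeal L ⊗ₜ word k Letter.toIdeal L') =
      shSum k Letter.sdeg (word k Letter.tensorIdeal) L L' := by
  rw [shuffleMap, wordLift₂_word, MultilinearMap.compLinearMap_apply]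
  refine (homMulti_lof _ (fun s => (Sum.elim L.get L'.get s).deg)
    (fun s => (Sum.elim L.get L'.get s).val)).trans ?_
  rw [← sum_shufflesTo _ _ L L' rfl, sum_apply]
  refine Finset.sum_congr rfl fun σ _ => ?_
  rw [smul_apply, MultilinearMap.compLinearMap_apply,
    MultilinearMap.domDomCongr_apply, ← tprod_eq_word]
  congr 2
  ext i : 1
  rcases σ.symm i with s | s <;> rfl

/-- To cut a shuffle is to cut both words and to shuffle the front parts and the back parts
separately. The sign of exchanging the two middle parts is the Koszul swap in `tensorCoprod`. -/
lemma deconcat_comp_shuffleMap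
    (haug : ∀ n ≠ 0, ∀ m, a.aug (DirectSum.lof k ℕ M n m) = 0) :
    deconcat ∘ₗ shuffleMap a = TensorProduct.map (shuffleMap a) (shuffleMap a) ∘ₗ tensorCoprod a := by
  refine hom_ext_word₂ (span_letter haug) fun L L' => ?_
  simp only [LinearMap.comp_apply]
  rw [shuffleMap_word, map_shSum, tensorCoprod_word]
  simp only [deconcat_word]
  rw [shSum_splitSum]
  simp only [map_splitSum, map_smul, TensorProduct.map_tmul, shuffleMap_word]
  refine splitSum_congr fun L₁ L₂ _ => splitSum_congr fun L₁' L₂' _ => ?_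
  congr 1
  have h1 : ∀ x, shSum k Letter.sdeg (fun W' => x ⊗ₜ[k] word k Letter.tensorIdeal W') L₂ L₂' =
      x ⊗ₜ[k] shSum k Letter.sdeg (word k Letter.tensorIdeal) L₂ L₂' := fun x =>
    (map_shSum _ (TensorProduct.mk k (a.tensor a).Bar (a.tensor a).Bar x) _ _ _).symm
  simp only [h1]
  exact (map_shSum _ ((TensorProduct.mk k (a.tensor a).Bar (a.tensor a).Bar).flip
    (shSum k Letter.sdeg (word k Letter.tensorIdeal) L₂ L₂')) _ _ _).symm

lemma wordCounit_comp_shuffleMap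
    (haug : ∀ n ≠ 0, ∀ m, a.aug (DirectSum.lof k ℕ M n m) = 0) :
    wordCounit ∘ₗ shuffleMap a =
      LinearMap.mul' k k ∘ₗ TensorProduct.map wordCounit wordCounit := by
  refine hom_ext_word₂ (span_letter haug) fun L L' => ?_
  simp only [LinearMap.comp_apply]
  rw [shuffleMap_word, TensorProduct.map_tmul, LinearMap.mul'_apply]
  rcases L with _ | ⟨x, L⟩
  · rw [shSum_nil_left, wordCounit_word_nil, one_mul]
    rcases L' with _ | ⟨y, L'⟩
    · rw [List.map_nil, wordCounit_word_nil, wordCounit_word_nil]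
    · rw [List.map_cons, wordCounit_word_cons, wordCounit_word_cons]
  · rw [wordCounit_word_cons, zero_mul]
    rcases L' with _ | ⟨y, L'⟩
    · rw [shSum_nil_right, List.map_cons, wordCounit_word_cons]
    · rw [shSum_cons_cons, map_add, map_smul, map_shSum, map_shSum]
      simp only [wordCounit_word_cons, shSum_zero, smul_zero, add_zero]

/-- A word of length `n` is mapped by `barInfinity` to the sum of the first `n + 1` summands. -/
lemma barInfinity_word {A : Type*} [AddCommMonoid A] [Module k A] {B : Type*} [AddCommMonoid B]
    [Module k B] (a : Augmented k A) (b : Augmented k B)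
    (F : ∀ n, MultilinearMap k (fun _ : Fin n => A) B) {Λ : Type*} (ℓ : Λ → a.ideal)
    (L : List Λ) :
    a.barInfinity b F (word k ℓ L) = ∑ m ∈ Finset.range (L.length + 1),
      coextPart wordCounit deconcat (a.twist b F) m (word k ℓ L) := by
  rw [Augmented.barInfinity, wordLift_word, sum_apply]
  refine Finset.sum_congr rfl fun m _ => ?_
  rw [LinearMap.compMultilinearMap_apply, word_eq_tprod]

lemma length_of_filterMap {α β : Type*} (W : List (α ⊕ β)) :
    W.length = (W.filterMap Sum.getLeft?).length + (W.filterMap Sum.getRight?).length := by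
  induction W with
  | nil => rfl
  | cons x W ih =>
    rcases x with x | x
    · simp only [List.filterMap_cons, Sum.getLeft?, Sum.getRight?, List.length_cons, ih]
      omega
    · simp only [List.filterMap_cons, Sum.getLeft?, Sum.getRight?, List.length_cons, ih]
      omega

/-- The composition of the shuffle map with morphisms of coalgebras is determined by the
associated twisting cochain. -/
theorem barMap_barInfinity_shuffleMap
    (haug : ∀ n ≠ 0, ∀ m, a.aug (DirectSum.lof k ℕ M n m) = 0)
    {B : Type*} [AddCommMonoid B] [Module k B] (b : Augmented k B)
    (F : ∀ n, MultilinearMap k (fun _ : Fin n => (⨁ n, M n) ⊗[k] ⨁ n, M n) B)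
    (f : B →ₗ[k] ⨁ n, M n) (E : a.Bar ⊗[k] a.Bar →ₗ[k] a.ideal)
    (h : ∀ L L' : List (Letter a),
      E (word k Letter.toIdeal L ⊗ₜ word k Letter.toIdeal L') =
        shSum k Letter.sdeg (fun W => a.proj (f ((a.tensor a).twist b F
          (word k Letter.tensorIdeal W)).1)) L L') :
    b.barMap a f ∘ₗ (a.tensor a).barInfinity b F ∘ₗ shuffleMap a = barProduct a E := by
  -- The hypothesis identifies `E` with the twisting cochain of the composite.
  have hE : (a.proj ∘ₗ f ∘ₗ b.ideal.subtype) ∘ₗ ((a.tensor a).twist b F ∘ₗ shuffleMap a) = E := by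
    refine hom_ext_word₂ (span_letter haug) fun L L' => ?_
    rw [h, LinearMap.comp_apply]
    change a.proj (f ((a.tensor a).twist b F (shuffleMap a _)).1) = _
    rw [shuffleMap_word, map_shSum]
    exact map_shSum _ (a.proj ∘ₗ f ∘ₗ b.ideal.subtype) _ _ _
  refine hom_ext_word₂ (span_letter haug) fun L L' => ?_
  have hR : barProduct a E (word k Letter.toIdeal L ⊗ₜ word k Letter.toIdeal L') =
      ∑ m ∈ Finset.range (L.length + L'.length + 1),
        coextPart (LinearMap.mul' k k ∘ₗ TensorProduct.map wordCounit wordCounit)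
          (tensorCoprod a) E m (word k Letter.toIdeal L ⊗ₜ word k Letter.toIdeal L') := by
    rw [barProduct, wordLift₂_word, sum_apply]
    refine Finset.sum_congr rfl fun m _ => ?_
    rw [LinearMap.compMultilinearMap_apply, wordPair_apply, word_eq_tprod, word_eq_tprod]
    rfl
  rw [hR, LinearMap.comp_apply, LinearMap.comp_apply, shuffleMap_word, map_shSum]
  -- All shuffles of `L` and `L'` have the same length. Hence the range of summation in
  -- `barInfinity` is the same for all of them and agrees with the one in `barProduct`.
  have hL : shSum k Letter.sdeg (fun W => (a.tensor a).barInfinity b F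
        (word k Letter.tensorIdeal W)) L L' =
      ∑ m ∈ Finset.range (L.length + L'.length + 1),
        coextPart wordCounit deconcat ((a.tensor a).twist b F) m
          (shSum k Letter.sdeg (word k Letter.tensorIdeal) L L') := by
    rw [← LinearMap.sum_apply, map_shSum]
    refine shSum_congr _ fun W h1 h2 => ?_
    rw [barInfinity_word, length_of_filterMap, h1, h2, LinearMap.sum_apply]
  rw [hL, map_sum]
  refine Finset.sum_congr rfl fun m _ => ?_
  rw [← shuffleMap_word, ← hE, ← lift_comp_coextPart,
    ← coextPart_comp (shuffleMap a) (wordCounit_comp_shuffleMap haug)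
      (deconcat_comp_shuffleMap haug)]
  rfl

end Letters

/-! ### Simplicial operators as monotone functions, and degenerate steps of a simplex -/

section Operators

variable {X Y Z : SSet.{u}} {n : ℕ}

/-- The `m`-simplex obtained from an `n`-simplex by the operator `f` on vertices. -/
def opMap (x : X _⦋n⦌) (m : ℕ) (f : ℕ →o ℕ) : X _⦋m⦌ := X.map (simplexOp f m n).op x

lemma simplexOp_congr {f g : ℕ →o ℕ} {m n : ℕ} (h : ∀ i ≤ m, min (f i) n = min (g i) n) :
    simplexOp f m n = simplexOp g m n := by
  unfold simplexOp
  congr 1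
  ext i : 2
  exact Fin.ext (h i.1 (by omega))

lemma simplexOp_comp {f g : ℕ →o ℕ} {l m n : ℕ} (h : ∀ i ≤ l, g i ≤ m) :
    simplexOp g l m ≫ simplexOp f m n = simplexOp (f.comp g) l n := by
  ext i : 3
  apply Fin.ext
  have : min (g i.1) m = g i.1 := min_eq_left (h _ (by have := i.2; simp at this; omega))
  change min (f (min (g i.1) m)) n = min (f (g i.1)) n
  rw [this]

lemma simplexOp_id (n : ℕ) : simplexOp OrderHom.id n n = 𝟙 _ := by
  ext i : 3
  apply Fin.ext
  change min i.1 n = i.1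
  have := i.2
  simp at this
  omega

lemma opMap_congr (x : X _⦋n⦌) {m : ℕ} {f g : ℕ →o ℕ} (h : ∀ i ≤ m, f i = g i) :
    opMap x m f = opMap x m g := by
  have h1 : simplexOp f m n = simplexOp g m n := simplexOp_congr fun i hi => by rw [h i hi]
  rw [opMap, opMap, h1]

lemma opMap_opMap (x : X _⦋n⦌) {m l : ℕ} {f g : ℕ →o ℕ} (h : ∀ i ≤ l, g i ≤ m) :
    opMap (opMap x m f) l g = opMap x l (f.comp g) := by
  rw [opMap, opMap, opMap, ← simplexOp_comp h, op_comp, Functor.map_comp]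
  rfl

lemma opMap_id (x : X _⦋n⦌) : opMap x n OrderHom.id = x := by
  rw [opMap, simplexOp_id]
  simp

lemma faceVertex_apply (i l v : ℕ) : faceVertex i l v = if v < i then v else v + l := rfl

lemma degenVertex_singleton_apply (t v : ℕ) :
    degenVertex {t} v = if t < v then v - 1 else v := by
  change v - _ = _
  rw [Finset.filter_singleton]
  split_ifs <;> simp

/-- The operator on vertices that collapses `{a,…,b}` to `a`. -/
def collapse (a b : ℕ) : ℕ →o ℕ where
  toFun v := if a ≤ v ∧ v ≤ b then a else v
  monotone' := by
    intro v w hvw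
    dsimp only
    split_ifs <;> omega

lemma collapse_apply (a b v : ℕ) : collapse a b v = if a ≤ v ∧ v ≤ b then a else v := rfl

lemma collapse_le (a b v : ℕ) : collapse a b v ≤ v := by
  rw [collapse_apply]
  split_ifs <;> omega

/-- The simplex is constant on the vertices `{a,…,b}` (in the sense of iterated degeneracies). -/
def ConstOn (x : X _⦋n⦌) (a b : ℕ) : Prop := opMap x n (collapse a b) = x

/-- The step from the vertex `t` to the vertex `t + 1` is degenerate. -/
def DegAt (x : X _⦋n⦌) (t : ℕ) : Prop := ConstOn x t (t + 1)

lemma constOn_self (x : X _⦋n⦌) (a : ℕ) : ConstOn x a a := by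
  rw [ConstOn]
  conv_rhs => rw [← opMap_id x]
  refine opMap_congr x fun i _ => ?_
  rw [collapse_apply, OrderHom.id_coe, id]
  split_ifs <;> omega

/-- Collapsing `{a,…,b+1}` amounts to sending `b+1` to `b` and then collapsing `{a,…,b}`. -/
lemma constOn_of_degAt {x : X _⦋n⦌} {a b : ℕ} (hab : a ≤ b)
    (h : ∀ t, a ≤ t → t < b → DegAt x t) : ConstOn x a b := by
  induction b, hab using Nat.le_induction with
  | base => exact constOn_self x a
  | succ b hab ih =>
    have h1 := ih fun t h1 h2 => h t h1 (by omega)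
    have h2 : opMap x n (collapse b (b + 1)) = x := h b hab (by omega)
    rw [ConstOn] at h1 ⊢
    conv_rhs => rw [← h2, ← h1]
    rw [opMap_opMap x fun i hi => (collapse_le _ _ _).trans hi]
    refine opMap_congr x fun i _ => ?_
    simp only [OrderHom.comp_coe, Function.comp_apply, collapse_apply]
    split_ifs <;> omega

/-- The simplex `x` factors through the collapse of `{f t,…,f (t+1)}`. After this collapse `f` takes
the same value at `t` and `t+1`, so identifying these two vertices beforehand changes nothing. -/
lemma degAt_opMap {x : X _⦋n⦌} {m t : ℕ} {f : ℕ →o ℕ} (hf : ∀ i ≤ m, f i ≤ n)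
    (h : ConstOn x (f t) (f (t + 1))) : DegAt (opMap x m f) t := by
  have h1 : opMap x m f = opMap x m ((collapse (f t) (f (t + 1))).comp f) := by
    conv_lhs => rw [← show opMap x n (collapse (f t) (f (t + 1))) = x from h]
    rw [opMap_opMap x hf]
  rw [DegAt, ConstOn, h1, opMap_opMap x fun i hi => (collapse_le _ _ _).trans hi]
  refine opMap_congr x fun i _ => ?_
  simp only [OrderHom.comp_coe, Function.comp_apply]
  rw [collapse_apply t]
  split_ifs with hi
  · have h3 : i = t ∨ i = t + 1 := by omega
    have h4 : f t ≤ f (t + 1) := f.monotone (Nat.le_succ t)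
    rcases h3 with rfl | rfl
    · rfl
    · simp only [collapse_apply]
      split_ifs <;> omega
  · rfl

lemma degAt_opMap_of_eq {x : X _⦋n⦌} {m t : ℕ} {f : ℕ →o ℕ} (hf : ∀ i ≤ m, f i ≤ n)
    (h : f (t + 1) = f t) : DegAt (opMap x m f) t :=
  degAt_opMap hf (h ▸ constOn_self x _)

lemma degAt_opMap_of_succ {x : X _⦋n⦌} {m t s : ℕ} {f : ℕ →o ℕ} (hf : ∀ i ≤ m, f i ≤ n)
    (h0 : f t = s) (h1 : f (t + 1) = s + 1) (h : DegAt x s) : DegAt (opMap x m f) t :=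
  degAt_opMap hf (by rw [h0, h1]; exact h)

lemma mem_degenerate_of_degAt {x : X _⦋n⦌} {t : ℕ} (ht : t < n) (h : DegAt x t) :
    x ∈ X.degenerate n := by
  obtain ⟨n, rfl⟩ : ∃ m, n = m + 1 := ⟨n - 1, by omega⟩
  rw [← show opMap x (n + 1) (collapse t (t + 1)) = x from h]
  have h1 : opMap x (n + 1) (collapse t (t + 1)) =
      opMap (opMap x n (faceVertex (t + 1) 1)) (n + 1) (degenVertex {t}) := by
    rw [opMap_opMap]
    · refine opMap_congr x fun i _ => ?_
      simp only [OrderHom.comp_coe, Function.comp_apply, collapse_apply, faceVertex_apply,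
        degenVertex_singleton_apply]
      split_ifs <;> omega
    · intro i hi
      rw [degenVertex_singleton_apply]
      split_ifs <;> omega
  rw [h1]
  exact ⟨n, by omega, _, _, rfl⟩

/-- A degenerate simplex lies in the image of some `σ i`, which repeats the vertex `i`. Together
with `mem_degenerate_of_degAt` this turns degeneracy into a condition on single steps, which can be
followed through vertex operators. -/
lemma exists_degAt_of_mem_degenerate {x : X _⦋n⦌} (h : x ∈ X.degenerate n) :
    ∃ t < n, DegAt x t := by
  obtain _ | n := n
  · simp at h
  rw [SSet.degenerate_eq_iUnion_range_σ] at h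
  obtain ⟨i, y, rfl⟩ := Set.mem_iUnion.1 h
  refine ⟨i, i.2, ?_⟩
  have h1 : SimplexCategory.σ i = simplexOp (degenVertex {i.1}) (n + 1) n := by
    ext j : 3
    apply Fin.ext
    change (i.predAbove j).1 = min (degenVertex {i.1} j.1) n
    have := j.2
    simp only [SimplexCategory.len_mk] at this
    rw [degenVertex_singleton_apply, Fin.predAbove]
    by_cases hi : i.1 < j.1
    · rw [if_pos hi, dif_pos (by simpa [Fin.lt_def] using hi)]
      simp
      omega
    · rw [if_neg hi, dif_neg (by simpa [Fin.lt_def] using hi)]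
      simp
      omega
  have h2 : X.σ i y = opMap y (n + 1) (degenVertex {i.1}) := by
    rw [opMap, ← h1]
    rfl
  rw [h2]
  refine degAt_opMap_of_eq ?_ ?_
  · intro j hj
    rw [degenVertex_singleton_apply]
    have := i.2
    split_ifs <;> omega
  · simp [degenVertex_singleton_apply]

lemma degAt_prod_iff {z : (X ⊗ Y : SSet.{u}) _⦋n⦌} {t : ℕ} :
    DegAt z t ↔ DegAt (X := X) z.1 t ∧ DegAt (X := Y) z.2 t :=
  Prod.ext_iff

variable (k : Type v) [CommRing k]

lemma simplexChain_eq_zero {x : X _⦋n⦌} {t : ℕ} (ht : t < n) (h : DegAt x t) :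
    simplexChain k x = 0 := by
  rw [simplexChain, simplexClass, dif_neg, map_zero]
  rw [← SSet.mem_degenerate_iff_notMem_nonDegenerate]
  exact mem_degenerate_of_degAt ht h

variable {k} in
-- By definition `chainLift` knows only the non-degenerate simplices. The formula extends to all
-- simplices once it gives 0 on those with a degenerate step; this is needed because faces and
-- homotopy terms may be degenerate.
lemma chainLift_simplexChain {N : Type w} [AddCommMonoid N] [Module k N] (f : ∀ n, X _⦋n⦌ → N)
    (x : X _⦋n⦌) (h : ∀ t < n, DegAt x t → f n x = 0) :
    chainLift f (simplexChain k x) = f n x := by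
  rw [simplexChain, chainLift, DirectSum.toModule_lof, simplexClass]
  split_ifs with hx
  · simp
  · rw [map_zero]
    obtain ⟨t, ht, h1⟩ := exists_degAt_of_mem_degenerate
      (SSet.mem_degenerate_iff_notMem_nonDegenerate _ _ |>.2 hx)
    exact (h t ht h1).symm

lemma restr_eq_simplexChain (x : X _⦋n⦌) {L : List ℕ} {m : ℕ} {f : ℕ →o ℕ}
    (hL : L.length = m + 1) (h : ∀ (i : ℕ) (hi : i < L.length), L[i] = f i) :
    restr k x L = simplexChain k (opMap x m f) := by
  obtain rfl : m = L.length - 1 := by omega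
  have h1 : L ≠ [] ∧ L.Pairwise (· ≤ ·) := by
    refine ⟨by rintro rfl; simp at hL, ?_⟩
    rw [List.pairwise_iff_getElem]
    intro i j hi hj hij
    rw [h, h]
    exact f.monotone hij.le
  rw [restr, dif_pos h1, opMap]
  congr 4
  unfold simplexOp
  congr 1
  ext i : 3
  apply Fin.ext
  change min L[i.1] n = min (f i) n
  rw [h]

/-- The restriction to a list of vertices with a repetition is zero. -/
lemma restr_eq_zero (x : X _⦋n⦌) {L : List ℕ} (hL : ∀ v ∈ L, v ≤ n) (h : ¬ L.Nodup) :
    restr k x L = 0 := by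
  rw [restr]
  split_ifs with h1
  swap
  · rfl
  obtain ⟨i, hi, h2⟩ : ∃ (i : ℕ) (hi : i + 1 < L.length), L[i] = L[i + 1] := by
    by_contra! h3
    refine h (List.Pairwise.imp (fun h => ne_of_lt h) ((List.pairwise_iff_getElem (R := (· < ·))).2 ?_))
    intro i j hi hj hij
    have h4 : L[i] < L[i + 1] := lt_of_le_of_ne
      (List.pairwise_iff_getElem.1 h1.2 _ _ _ _ (by omega)) (h3 i (by omega))
    rcases eq_or_lt_of_le (show i + 1 ≤ j by omega) with rfl | h5
    · exact h4
    · exact h4.trans_le (List.pairwise_iff_getElem.1 h1.2 _ _ _ _ h5)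
  -- The list as a monotone function on all of `ℕ`, constant from its last entry on.
  let f : ℕ →o ℕ :=
    { toFun := fun v => L[min v (L.length - 1)]'(by omega)
      monotone' := by
        intro v w hvw
        dsimp only
        rcases eq_or_lt_of_le (min_le_min_right (L.length - 1) hvw) with h3 | h3
        · simp only [h3, le_refl]
        · exact List.pairwise_iff_getElem.1 h1.2 _ _ _ _ h3 }
  have hf : ∀ (j : ℕ) (hj : j < L.length), L[j] = f j := by
    intro j hj
    change L[j] = L[min j (L.length - 1)]
    congr 1
    omega
  have h3 := restr_eq_simplexChain k x (f := f) (m := L.length - 1) (by omega) hf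
  rw [restr, dif_pos h1] at h3
  rw [h3]
  refine simplexChain_eq_zero k (t := i) (by omega) (degAt_opMap_of_eq ?_ ?_)
  · intro j hj
    rw [← hf j (by omega)]
    exact hL _ (List.getElem_mem _)
  · rw [← hf (i + 1) hi, ← hf i (by omega), h2]

end Operators

/-! ### Front and back faces, and the paths in the Eilenberg–Mac Lane homotopy -/

section Homotopy

variable {X Y Z : SSet.{u}} {n : ℕ}

/-- The front face `x(0,…,c)`. -/
def front (x : X _⦋n⦌) (c : ℕ) : X _⦋c⦌ := opMap x c OrderHom.id

/-- The back face `x(c,…,n)`. -/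
def back (x : X _⦋n⦌) (c : ℕ) : X _⦋n - c⦌ := opMap x (n - c) (faceVertex 0 c)

lemma shift_apply (c v : ℕ) : faceVertex 0 c v = v + c := rfl

lemma degAt_front {x : X _⦋n⦌} {c t : ℕ} (hc : c ≤ n) (h : DegAt x t) : DegAt (front x c) t :=
  degAt_opMap_of_succ (fun _ hi => hi.trans hc) rfl rfl h

lemma degAt_back {x : X _⦋n⦌} {c t : ℕ} (hc : c ≤ n) (h : DegAt x (t + c)) :
    DegAt (back x c) t :=
  degAt_opMap_of_succ (fun i hi => by rw [shift_apply]; omega) rfl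
    (by rw [shift_apply, shift_apply]; omega) h

lemma interval_length (i j : ℕ) : (interval i j).length = j + 1 - i := by simp [interval]

lemma getElem_interval (i j a : ℕ) (h : a < (interval i j).length) :
    (interval i j)[a] = i + a := by simp [interval]

lemma mem_interval {i j a : ℕ} : a ∈ interval i j ↔ i ≤ a ∧ a ≤ j := by
  simp only [interval, List.mem_range'_1]
  omega

variable (k : Type v) [CommRing k]

lemma restr_front (x : X _⦋n⦌) (c : ℕ) :
    restr k x (interval 0 c) = simplexChain k (front x c) :=
  restr_eq_simplexChain k x (by simp [interval_length]) fun i hi => by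
    rw [getElem_interval, zero_add]
    rfl

lemma restr_back (x : X _⦋n⦌) {c : ℕ} (hc : c ≤ n) :
    restr k x (interval c n) = simplexChain k (back x c) :=
  restr_eq_simplexChain k x (by rw [interval_length]; omega) fun i hi => by
    rw [getElem_interval, add_comm]
    rfl

/-- The formula respects degeneracies, as a degenerate step lies either in the front face or in the
back face. -/
lemma chainDiag_simplexChain (x : X _⦋n⦌) :
    chainDiag k X (simplexChain k x) = ∑ c ∈ Finset.range (n + 1),
      simplexChain k (front x c) ⊗ₜ[k] simplexChain k (back x c) := by
  rw [chainDiag, chainLift_simplexChain, Finset.sum_range]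
  · refine Finset.sum_congr rfl fun c _ => ?_
    rw [restr_front, restr_back k x (by omega)]
  · intro t ht h
    refine Finset.sum_eq_zero fun c _ => ?_
    rw [restr_front, restr_back k x (by omega)]
    by_cases hc : t < c
    · rw [simplexChain_eq_zero k hc (degAt_front (by omega) h), TensorProduct.zero_tmul]
    · rw [simplexChain_eq_zero k (t := t - c) (by omega) (degAt_back (by omega) _),
        TensorProduct.tmul_zero]
      rwa [Nat.sub_add_cancel (by omega)]

lemma AW_simplexChain (z : (X ⊗ Y : SSet.{u}) _⦋n⦌) :
    AW k X Y (simplexChain k z) = ∑ c ∈ Finset.range (n + 1),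
      simplexChain k (front (X := X) z.1 c) ⊗ₜ[k] simplexChain k (back (X := Y) z.2 c) := by
  rw [AW, chainLift_simplexChain, Finset.sum_range]
  · refine Finset.sum_congr rfl fun c _ => ?_
    rw [restr_front, restr_back k _ (by omega)]
  · intro t ht h
    obtain ⟨h1, h2⟩ := degAt_prod_iff.1 h
    refine Finset.sum_eq_zero fun c _ => ?_
    rw [restr_front, restr_back k _ (by omega)]
    by_cases hc : t < c
    · rw [simplexChain_eq_zero k hc (degAt_front (by omega) h1), TensorProduct.zero_tmul]
    · rw [simplexChain_eq_zero k (t := t - c) (by omega) (degAt_back (by omega) _),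
        TensorProduct.tmul_zero]
      rwa [Nat.sub_add_cancel (by omega)]

/-- The number of elements of `S` that are less than `v`. -/
def countBelow (S : Finset ℕ) (v : ℕ) : ℕ := (S.filter (· < v)).card

lemma countBelow_succ (S : Finset ℕ) (v : ℕ) :
    countBelow S (v + 1) = countBelow S v + if v ∈ S then 1 else 0 := by
  have h : S.filter (· < v + 1) = if v ∈ S then insert v (S.filter (· < v)) else
      S.filter (· < v) := by
    ext s
    split_ifs with hv
    · simp only [Finset.mem_filter, Finset.mem_insert]
      constructor
      · rintro ⟨h1, h2⟩
        by_cases h : s = v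
        · exact Or.inl h
        · exact Or.inr ⟨h1, by omega⟩
      · rintro (rfl | ⟨h1, h2⟩)
        · exact ⟨hv, by omega⟩
        · exact ⟨h1, by omega⟩
    · simp only [Finset.mem_filter]
      constructor
      · rintro ⟨h1, h2⟩
        refine ⟨h1, lt_of_le_of_ne (by omega) ?_⟩
        rintro rfl
        exact hv h1
      · rintro ⟨h1, h2⟩
        exact ⟨h1, by omega⟩
  rw [countBelow, h]
  split_ifs
  · rw [Finset.card_insert_of_notMem (by simp), countBelow]
  · rfl

@[simp] lemma countBelow_zero (S : Finset ℕ) : countBelow S 0 = 0 := by simp [countBelow]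

/-- The counting function starts at 0 and grows by one exactly at the elements of `S`, so it leaves
each value `t` below its final one at some element of `S`. -/
lemma exists_countBelow {S : Finset ℕ} {N t : ℕ} (h : t < countBelow S N) :
    ∃ s < N, s ∈ S ∧ countBelow S s = t := by
  induction N with
  | zero => simp at h
  | succ N ih =>
    rw [countBelow_succ] at h
    by_cases h1 : t < countBelow S N
    · obtain ⟨s, h2, h3⟩ := ih h1
      exact ⟨s, by omega, h3⟩
    · split_ifs at h with h2
      · exact ⟨N, by omega, h2, by omega⟩
      · omega

lemma countBelow_of_subset {S : Finset ℕ} {N : ℕ} (h : S ⊆ Finset.range N) :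
    countBelow S N = S.card := by
  rw [countBelow, Finset.filter_true_of_mem]
  exact fun s hs => Finset.mem_range.1 (h hs)

lemma countBelow_of_le {S : Finset ℕ} {N v : ℕ} (h : S ⊆ Finset.range N) (hv : N ≤ v) :
    countBelow S v = S.card :=
  countBelow_of_subset (h.trans (Finset.range_mono hv))

lemma countBelow_sdiff {S : Finset ℕ} {N v : ℕ} (hv : v ≤ N) :
    countBelow (Finset.range N \ S) v + countBelow S v = v := by
  induction v with
  | zero => simp
  | succ v ih =>
    have := ih (by omega)
    rw [countBelow_succ, countBelow_succ]
    have h1 : v ∈ Finset.range N \ S ↔ v ∉ S := by simp; omega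
    simp only [h1]
    split_ifs <;> omega

/-- The first component, as a function on vertices, of a term of the homotopy. -/
def homotopyX (p q : ℕ) (β : Finset ℕ) : ℕ →o ℕ := (faceVertex (p + 1) q).comp (degenVertex β)

/-- The second component, as a function on vertices, of a term of the homotopy. -/
def homotopyY (p q : ℕ) (β : Finset ℕ) : ℕ →o ℕ := (faceVertex 0 p).comp
  ((degenVertex (Finset.range (p + q + 1) \ β)).comp (degenVertex {p + q + 1}))

section Vertices

variable {p q v : ℕ} {β : Finset ℕ}

lemma degenVertex_apply (S : Finset ℕ) (v : ℕ) : degenVertex S v = v - countBelow S v := rfl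

lemma card_sdiff_of_mem (hβ : β ∈ (Finset.range (p + q + 1)).powersetCard (q + 1)) :
    (Finset.range (p + q + 1) \ β).card = p := by
  rw [Finset.mem_powersetCard] at hβ
  rw [Finset.card_sdiff_of_subset hβ.1, hβ.2, Finset.card_range]
  omega

/-- On the initial part of the path the first coordinate counts the steps in `α`. It never exceeds
`p`, so the omitted vertices `p+1,…,p+q` do not matter before the jump. -/
lemma homotopyX_of_le (hβ : β ∈ (Finset.range (p + q + 1)).powersetCard (q + 1))
    (hv : v ≤ p + q + 1) :
    homotopyX p q β v = countBelow (Finset.range (p + q + 1) \ β) v := by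
  have h1 := countBelow_sdiff (S := β) hv
  have h2 : countBelow (Finset.range (p + q + 1) \ β) v ≤ p :=
    (Finset.card_le_card (Finset.filter_subset _ _)).trans_eq (card_sdiff_of_mem hβ)
  change faceVertex (p + 1) q (degenVertex β v) = _
  rw [degenVertex_apply, faceVertex_apply]
  split_ifs <;> omega

lemma homotopyX_of_gt (hβ : β ∈ (Finset.range (p + q + 1)).powersetCard (q + 1))
    (hv : p + q + 2 ≤ v) : homotopyX p q β v = v - 1 := by
  rw [Finset.mem_powersetCard] at hβ
  have h1 := countBelow_of_le hβ.1 (show p + q + 1 ≤ v by omega)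
  change faceVertex (p + 1) q (degenVertex β v) = _
  rw [degenVertex_apply, faceVertex_apply]
  split_ifs <;> omega

lemma homotopyY_of_le (hv : v ≤ p + q + 1) : homotopyY p q β v = p + countBelow β v := by
  have h1 := countBelow_sdiff (S := β) hv
  change degenVertex _ (degenVertex {p + q + 1} v) + p = _
  rw [degenVertex_singleton_apply, if_neg (by omega), degenVertex_apply]
  omega

lemma homotopyY_of_gt (hβ : β ∈ (Finset.range (p + q + 1)).powersetCard (q + 1))
    (hv : p + q + 2 ≤ v) : homotopyY p q β v = v - 1 := by
  have h1 := countBelow_of_le (v := v - 1)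
    (Finset.sdiff_subset (s := Finset.range (p + q + 1)) (t := β)) (by omega)
  rw [card_sdiff_of_mem hβ] at h1
  change degenVertex _ (degenVertex {p + q + 1} v) + p = _
  rw [degenVertex_singleton_apply, if_pos (by omega), degenVertex_apply]
  omega

lemma homotopyX_end (hβ : β ∈ (Finset.range (p + q + 1)).powersetCard (q + 1)) :
    homotopyX p q β (p + q + 1) = p := by
  rw [homotopyX_of_le hβ le_rfl, countBelow_of_subset Finset.sdiff_subset, card_sdiff_of_mem hβ]

lemma homotopyY_end (hβ : β ∈ (Finset.range (p + q + 1)).powersetCard (q + 1)) :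
    homotopyY p q β (p + q + 1) = p + q + 1 := by
  rw [Finset.mem_powersetCard] at hβ
  rw [homotopyY_of_le le_rfl, countBelow_of_subset hβ.1, hβ.2]
  omega

lemma homotopyX_le (hβ : β ∈ (Finset.range (p + q + 1)).powersetCard (q + 1)) (hpq : p + q < n) :
    ∀ i ≤ n + 1, homotopyX p q β i ≤ n := by
  intro i hi
  rcases Nat.lt_or_ge (p + q + 1) i with h | h
  · rw [homotopyX_of_gt hβ h]
    omega
  · have := (homotopyX p q β).monotone h
    rw [homotopyX_end hβ] at this
    omega

lemma homotopyY_le (hβ : β ∈ (Finset.range (p + q + 1)).powersetCard (q + 1)) (hpq : p + q < n) :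
    ∀ i ≤ n + 1, homotopyY p q β i ≤ n := by
  intro i hi
  rcases Nat.lt_or_ge (p + q + 1) i with h | h
  · rw [homotopyY_of_gt hβ h]
    omega
  · have := (homotopyY p q β).monotone h
    rw [homotopyY_end hβ] at this
    omega

end Vertices

/-- A term of the Eilenberg–Mac Lane homotopy. -/
def homotopyTerm (z : (X ⊗ Y : SSet.{u}) _⦋n⦌) (p q : ℕ) (β : Finset ℕ) :
    (X ⊗ Y : SSet.{u}) _⦋n + 1⦌ :=
  (opMap (X := X) z.1 (n + 1) (homotopyX p q β), opMap (X := Y) z.2 (n + 1) (homotopyY p q β))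

/-- The sign exponent of a term of the Eilenberg–Mac Lane homotopy. -/
def homotopyExp (p q : ℕ) (β : Finset ℕ) : ℕ :=
  p + q + (((Finset.range (p + q + 1) \ β) ×ˢ β).filter fun s => s.2 < s.1).card

section Terms

variable {z : (X ⊗ Y : SSet.{u}) _⦋n⦌} {p q s t : ℕ} {β : Finset ℕ}

lemma degAt_fst_of_mem (hβ : β ∈ (Finset.range (p + q + 1)).powersetCard (q + 1))
    (hpq : p + q < n) (hs : s ∈ β) : DegAt (X := X) (homotopyTerm z p q β).1 s := by
  have h1 := Finset.mem_range.1 ((Finset.mem_powersetCard.1 hβ).1 hs)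
  refine degAt_opMap_of_eq (homotopyX_le hβ hpq) ?_
  rw [homotopyX_of_le hβ (by omega), homotopyX_of_le hβ (by omega), countBelow_succ,
    if_neg (by simp [hs]), add_zero]

lemma degAt_snd_of_notMem (hβ : β ∈ (Finset.range (p + q + 1)).powersetCard (q + 1))
    (hpq : p + q < n) (hs : s ∉ β) (hs' : s ≤ p + q) :
    DegAt (X := Y) (homotopyTerm z p q β).2 s := by
  refine degAt_opMap_of_eq (homotopyY_le hβ hpq) ?_
  rw [homotopyY_of_le (by omega), homotopyY_of_le (by omega), countBelow_succ,
    if_neg hs, add_zero]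

lemma degAt_snd_jump (hβ : β ∈ (Finset.range (p + q + 1)).powersetCard (q + 1))
    (hpq : p + q < n) : DegAt (X := Y) (homotopyTerm z p q β).2 (p + q + 1) := by
  refine degAt_opMap_of_eq (homotopyY_le hβ hpq) ?_
  rw [homotopyY_of_gt hβ (by omega), homotopyY_end hβ]
  omega

/-- The first coordinate passes from `t` to `t+1` during some step in `α`, while the second one
rests. If `x` is degenerate there, then both components are. -/
lemma homotopyTerm_eq_zero_of_fst (hβ : β ∈ (Finset.range (p + q + 1)).powersetCard (q + 1))
    (hpq : p + q < n) (ht : t < p) (h : DegAt (X := X) z.1 t) :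
    simplexChain k (homotopyTerm z p q β) = 0 := by
  obtain ⟨s, h1, h2, h3⟩ := exists_countBelow (S := Finset.range (p + q + 1) \ β) (t := t)
    (N := p + q + 1) (by rwa [countBelow_of_subset Finset.sdiff_subset, card_sdiff_of_mem hβ])
  refine simplexChain_eq_zero k (t := s) (by omega) (degAt_prod_iff.2 ⟨?_, ?_⟩)
  · refine degAt_opMap_of_succ (homotopyX_le hβ hpq) ?_ ?_ h
    · rw [homotopyX_of_le hβ h1.le, h3]
    · rw [homotopyX_of_le hβ h1, countBelow_succ, if_pos h2, h3]
  · exact degAt_snd_of_notMem hβ hpq (Finset.mem_sdiff.1 h2).2 (by omega)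

/-- Likewise, the second coordinate passes from `t` to `t+1` during a step in `β`, while the first
one rests. -/
lemma homotopyTerm_eq_zero_of_snd (hβ : β ∈ (Finset.range (p + q + 1)).powersetCard (q + 1))
    (hpq : p + q < n) (ht : p ≤ t) (ht' : t ≤ p + q) (h : DegAt (X := Y) z.2 t) :
    simplexChain k (homotopyTerm z p q β) = 0 := by
  have hβ' := Finset.mem_powersetCard.1 hβ
  obtain ⟨s, h1, h2, h3⟩ := exists_countBelow (S := β) (t := t - p)
    (N := p + q + 1) (by rw [countBelow_of_subset hβ'.1]; omega)
  refine simplexChain_eq_zero k (t := s) (by omega) (degAt_prod_iff.2 ⟨?_, ?_⟩)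
  · exact degAt_fst_of_mem hβ hpq h2
  · refine degAt_opMap_of_succ (homotopyY_le hβ hpq) ?_ ?_ h
    · rw [homotopyY_of_le h1.le, h3]
      omega
    · rw [homotopyY_of_le h1, countBelow_succ, if_pos h2, h3]
      omega

/-- The jump of the first coordinate covers exactly the steps `p,…,p+q` of `x`, while the second
coordinate rests. -/
lemma homotopyTerm_eq_zero_of_jump (hβ : β ∈ (Finset.range (p + q + 1)).powersetCard (q + 1))
    (hpq : p + q < n) (h : ∀ t, p ≤ t → t ≤ p + q → DegAt (X := X) z.1 t) :
    simplexChain k (homotopyTerm z p q β) = 0 := by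
  refine simplexChain_eq_zero k (t := p + q + 1) (by omega) (degAt_prod_iff.2 ⟨?_, ?_⟩)
  · refine degAt_opMap (homotopyX_le hβ hpq) ?_
    rw [homotopyX_end hβ, homotopyX_of_gt hβ (by omega)]
    exact constOn_of_degAt (by omega) fun t h1 h2 => h t h1 (by omega)
  · exact degAt_snd_jump hβ hpq

lemma homotopyTerm_eq_zero_of_degAt (hβ : β ∈ (Finset.range (p + q + 1)).powersetCard (q + 1))
    (hpq : p + q < n) (ht : t < n) (h : DegAt z t) :
    simplexChain k (homotopyTerm z p q β) = 0 := by
  obtain ⟨h1, h2⟩ := degAt_prod_iff.1 h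
  rcases Nat.lt_or_ge t p with h3 | h3
  · exact homotopyTerm_eq_zero_of_fst k hβ hpq h3 h1
  rcases Nat.lt_or_ge (p + q) t with h4 | h4
  -- Beyond the jump both coordinates follow `v ↦ v - 1`, so the step `t` of `z` reappears as the
  -- step `t+1`.
  · refine simplexChain_eq_zero k (t := t + 1) (by omega) (degAt_prod_iff.2 ⟨?_, ?_⟩)
    · refine degAt_opMap_of_succ (homotopyX_le hβ hpq) ?_ ?_ h1
      · rw [homotopyX_of_gt hβ (by omega)]
        omega
      · rw [homotopyX_of_gt hβ (by omega)]
        omega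
    · refine degAt_opMap_of_succ (homotopyY_le hβ hpq) ?_ ?_ h2
      · rw [homotopyY_of_gt hβ (by omega)]
        omega
      · rw [homotopyY_of_gt hβ (by omega)]
        omega
  · exact homotopyTerm_eq_zero_of_snd k hβ hpq h3 h4 h2

variable (z) in
lemma emHomotopy_simplexChain : emHomotopy k X Y (simplexChain k z) =
    ∑ p ∈ Finset.range n, ∑ q ∈ Finset.range (n - p),
      ∑ β ∈ (Finset.range (p + q + 1)).powersetCard (q + 1),
        ((-1 : k) ^ homotopyExp p q β) • simplexChain k (homotopyTerm z p q β) := by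
  rw [emHomotopy, chainLift_simplexChain]
  · rfl
  · intro t ht h
    refine Finset.sum_eq_zero fun p hp => Finset.sum_eq_zero fun q hq =>
      Finset.sum_eq_zero fun β hβ => ?_
    rw [Finset.mem_range] at hp hq
    have h0 := homotopyTerm_eq_zero_of_degAt k hβ (by omega) ht h
    exact (congrArg (fun c => ((-1 : k) ^ homotopyExp p q β) • c) h0).trans (smul_zero _)

/-- The homotopy vanishes on the front faces of the simplices that appear in the homotopy. -/
lemma emHomotopy_front (hβ : β ∈ (Finset.range (p + q + 1)).powersetCard (q + 1))
    (hpq : p + q < n) {c : ℕ} (hc : c ≤ n + 1) :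
    emHomotopy k X Y (simplexChain k (front (homotopyTerm z p q β) c)) = 0 := by
  rw [emHomotopy_simplexChain]
  refine Finset.sum_eq_zero fun p' hp' => Finset.sum_eq_zero fun q' hq' =>
      Finset.sum_eq_zero fun β' hβ' => ?_
  rw [Finset.mem_range] at hp' hq'
  refine (congrArg _ ?_).trans (smul_zero _)
  have hpq' : p' + q' < c := by omega
  have hX : ∀ t, DegAt (X := X) (homotopyTerm z p q β).1 t →
    DegAt (X := X) (front (homotopyTerm z p q β) c).1 t := fun t h => degAt_front hc h
  have hY : ∀ t, DegAt (X := Y) (homotopyTerm z p q β).2 t →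
    DegAt (X := Y) (front (homotopyTerm z p q β) c).2 t := fun t h => degAt_front hc h
  -- The new path `(p', q', β')` traverses the steps below `p'` of the first component singly, those
  -- from `p'` to `p'+q'` of the second component singly, and the latter of the first component in
  -- one jump. Either a step in `β` lies below `p'`, or the old jump or a step outside `β` lies in
  -- `[p', p'+q']`, or all steps in `[p', p'+q']` belong to `β`. Each case meets one of the three
  -- vanishing criteria.
  rcases Nat.lt_or_ge (p + q) (p' + q') with h1 | h1
  · rcases Nat.lt_or_ge (p + q + 1) p' with h2 | h2
    · obtain ⟨s, hs⟩ : β.Nonempty := by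
        rw [← Finset.card_pos, (Finset.mem_powersetCard.1 hβ).2]
        omega
      have h3 := Finset.mem_range.1 ((Finset.mem_powersetCard.1 hβ).1 hs)
      exact homotopyTerm_eq_zero_of_fst k hβ' hpq' (t := s) (by omega)
        (hX _ (degAt_fst_of_mem hβ hpq hs))
    · exact homotopyTerm_eq_zero_of_snd k hβ' hpq' h2 h1 (hY _ (degAt_snd_jump hβ hpq))
  · by_cases h2 : ∃ s, p' ≤ s ∧ s ≤ p' + q' ∧ s ∉ β
    · obtain ⟨s, h3, h4, h5⟩ := h2
      exact homotopyTerm_eq_zero_of_snd k hβ' hpq' h3 h4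
        (hY _ (degAt_snd_of_notMem hβ hpq h5 (by omega)))
    · push Not at h2
      exact homotopyTerm_eq_zero_of_jump k hβ' hpq' fun t h3 h4 =>
        hX _ (degAt_fst_of_mem hβ hpq (h2 t h3 h4))

end Terms

end Homotopy

/-! ### Evaluating tensor products of functionals on words -/

section Evaluation

variable {k : Type v} [CommRing k] {W : Type w} [AddCommMonoid W] [Module k W]

/-- The evaluation of `φ₁ ⊗ ⋯ ⊗ φₙ` on `W^{⊗n}`, extended by zero to the tensor algebra. -/
def evalWord {n : ℕ} (φ : Fin n → Module.Dual k W) : TensorAlgebra k W →ₗ[k] k :=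
  PiTensorProduct.dualDistrib (PiTensorProduct.tprod k φ) ∘ₗ
    DirectSum.component k ℕ (fun m => ⨂[k]^m W) n ∘ₗ
    (TensorAlgebra.toDirectSum (R := k) (M := W)).toLinearMap

lemma evalWord_tprod {n : ℕ} (φ : Fin n → Module.Dual k W) (x : Fin n → W) :
    evalWord φ (TensorAlgebra.tprod k W n x) = ∏ i, φ i (x i) := by
  simp only [evalWord, LinearMap.comp_apply, AlgHom.toLinearMap_apply]
  rw [TensorAlgebra.toDirectSum_tensorPower_tprod, ← DirectSum.lof_eq_of k,
    DirectSum.component.lof_self, PiTensorProduct.dualDistrib_apply]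

lemma evalWord_tprod_of_ne {m n : ℕ} (h : m ≠ n) (φ : Fin n → Module.Dual k W) (x : Fin m → W) :
    evalWord φ (TensorAlgebra.tprod k W m x) = 0 := by
  simp only [evalWord, LinearMap.comp_apply, AlgHom.toLinearMap_apply]
  rw [TensorAlgebra.toDirectSum_tensorPower_tprod, ← DirectSum.lof_eq_of k,
    DirectSum.component.of, dif_neg h, map_zero]

lemma evalWord_ι_mul {n : ℕ} (φ : Fin (n + 1) → Module.Dual k W) (w : W)
    (v : TensorAlgebra k W) :
    evalWord φ (TensorAlgebra.ι k w * v) = φ 0 w * evalWord (fun i => φ i.succ) v := by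
  have h : evalWord φ ∘ₗ LinearMap.mulLeft k (TensorAlgebra.ι k w) =
      φ 0 w • evalWord (fun i => φ i.succ) := by
    refine hom_ext_word (ℓ := id) (by simp) fun L => ?_
    have h1 : TensorAlgebra.ι k w * word k id L =
        TensorAlgebra.tprod k W (L.length + 1) (Fin.cons w L.get) := by
      rw [TensorAlgebra.tprod_apply, List.ofFn_succ, List.prod_cons, word_eq_tprod,
        TensorAlgebra.tprod_apply]
      rfl
    rw [LinearMap.comp_apply, LinearMap.mulLeft_apply, h1, LinearMap.smul_apply, smul_eq_mul,
      word_eq_tprod]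
    by_cases hn : L.length = n
    · subst hn
      rw [evalWord_tprod, evalWord_tprod, Fin.prod_univ_succ]
      rfl
    · rw [evalWord_tprod_of_ne hn, evalWord_tprod_of_ne (by omega), mul_zero]
  exact LinearMap.congr_fun h v

end Evaluation

/-! ### The collapsed recursion for the Gugenheim–Munkholm maps -/

section GugenheimMunkholm

variable {X Y : SSet.{u}} {n : ℕ} (k : Type v) [CommRing k]

lemma degSign_pow_simplexChain (x : X _⦋n⦌) (e : ℕ) :
    (degSign k (NChain k X) ^ e) (simplexChain k x) = ((-1 : k) ^ (n * e)) • simplexChain k x := by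
  have h1 : degSign k (NChain k X) (simplexChain k x) = ((-1 : k) ^ n) • simplexChain k x := by
    rw [simplexChain, degSign, DirectSum.lmap_lof, LinearMap.smul_apply, LinearMap.id_apply,
      map_smul]
  induction e with
  | zero => simp
  | succ e ih =>
    rw [pow_succ', Module.End.mul_apply, ih, map_smul, h1, smul_smul, ← pow_add, mul_add, mul_one]

lemma gm_one : gm k X Y 1 = TensorAlgebra.ι k ∘ₗ AW k X Y := by
  rw [gm]

lemma gm_add_two (n : ℕ) : gm k X Y (n + 2) =
    (-1 : k) • ∑ i : Fin (n + 1), ((-1 : k) ^ (n + 1 - i.val)) •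
      (LinearMap.mul' k (TensorAlgebra k (Chains k X ⊗[k] Chains k Y)) ∘ₗ
        TensorProduct.map
          (gm k X Y (i.val + 1) ∘ₗ (degSign k (NChain k (X ⊗ Y)) ^ (n - i.val)))
          (gm k X Y (n + 1 - i.val)) ∘ₗ
        chainDiag k (X ⊗ Y) ∘ₗ emHomotopy k X Y) := by
  rw [gm]

lemma gm_eq_zero_of_emHomotopy (m : ℕ) {c : Chains k (X ⊗ Y)} (h : emHomotopy k X Y c = 0) :
    gm k X Y (m + 2) c = 0 := by
  simp [gm_add_two, LinearMap.sum_apply, h]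

/-- The factor `G_l` with `l ≥ 2` begins with `h`, which kills the front faces of the terms of `h`;
so only `l = 1` remains. The exponent `m` is left of the prefactor `-(-1)^{m+1}`, and `c * m` is the
Koszul sign of moving `G_{m+1}`, of degree `m`, past a front face of degree `c`. -/
lemma gm_add_two_simplexChain (m : ℕ) (z : (X ⊗ Y : SSet.{u}) _⦋n⦌) :
    gm k X Y (m + 2) (simplexChain k z) =
      ∑ p ∈ Finset.range n, ∑ q ∈ Finset.range (n - p),
      ∑ β ∈ (Finset.range (p + q + 1)).powersetCard (q + 1), ∑ c ∈ Finset.range (n + 1 + 1),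
        ((-1 : k) ^ (m + homotopyExp p q β + c * m)) •
          (TensorAlgebra.ι k (AW k X Y (simplexChain k (front (homotopyTerm z p q β) c))) *
            gm k X Y (m + 1) (simplexChain k (back (homotopyTerm z p q β) c))) := by
  rw [gm_add_two, LinearMap.smul_apply, LinearMap.sum_apply, Finset.sum_eq_single 0]
  · simp only [LinearMap.smul_apply, LinearMap.comp_apply, emHomotopy_simplexChain, map_sum,
      map_smul, chainDiag_simplexChain, Finset.smul_sum, smul_smul, TensorProduct.map_tmul,
      LinearMap.mul'_apply]
    refine Finset.sum_congr rfl fun p _ => Finset.sum_congr rfl fun q _ =>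
      Finset.sum_congr rfl fun β _ => Finset.sum_congr rfl fun c _ => ?_
    rw [degSign_pow_simplexChain]
    simp only [Fin.val_zero, zero_add, Nat.sub_zero, gm_one, LinearMap.comp_apply, map_smul,
      smul_mul_assoc, smul_smul]
    congr 1
    ring
  · intro i _ hi
    obtain ⟨i, rfl⟩ := Fin.exists_succ_eq.2 hi
    rw [LinearMap.smul_apply]
    refine (congrArg _ ?_).trans (smul_zero _)
    simp only [LinearMap.comp_apply, emHomotopy_simplexChain, map_sum,
      map_smul, chainDiag_simplexChain, TensorProduct.map_tmul, LinearMap.mul'_apply]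
    refine Finset.sum_eq_zero fun p hp => Finset.sum_eq_zero fun q hq =>
      Finset.sum_eq_zero fun β hβ => ?_
    rw [Finset.mem_range] at hp hq
    refine (congrArg _ ?_).trans (smul_zero _)
    refine Finset.sum_eq_zero fun c hc => ?_
    rw [Finset.mem_range] at hc
    rw [degSign_pow_simplexChain, map_smul, Fin.val_succ,
      gm_eq_zero_of_emHomotopy k i (emHomotopy_front k hβ (by omega) (by omega)), smul_zero,
      zero_mul]
  · simp

variable {k}

/-- The augmentation `C(X) → k`. -/
def augmentation (k : Type v) [CommRing k] (X : SSet.{u}) : Chains k X →ₗ[k] k :=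
  counit k X ∘ₗ DirectSum.component k ℕ (NChain k X) 0

lemma augmentation_simplexChain_zero (x : X _⦋0⦌) : augmentation k X (simplexChain k x) = 1 := by
  rw [augmentation, simplexChain, LinearMap.comp_apply, DirectSum.component.lof_self]
  simp [counit, simplexClass]

lemma augmentation_simplexChain_of_pos (hn : n ≠ 0) (x : X _⦋n⦌) :
    augmentation k X (simplexChain k x) = 0 := by
  rw [augmentation, simplexChain, LinearMap.comp_apply, DirectSum.component.of, dif_neg hn,
    map_zero]

/-- The functionals `a ⊗ 1` and `1 ⊗ b` on `C(X) ⊗ C(Y)`. -/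
def letterFun : Module.Dual k (Chains k X) ⊕ Module.Dual k (Chains k Y) →
    Module.Dual k (Chains k X ⊗[k] Chains k Y) :=
  Sum.elim (fun A => LinearMap.mul' k k ∘ₗ TensorProduct.map A (augmentation k Y))
    (fun B => LinearMap.mul' k k ∘ₗ TensorProduct.map (augmentation k X) B)

/-- The augmentation of `C(Y)` keeps only the summand of `AW` whose back face is a vertex, and there
the front face is all of `x`. -/
lemma letterFun_inl_AW (A : Module.Dual k (Chains k X)) (z : (X ⊗ Y : SSet.{u}) _⦋n⦌) :
    letterFun (Y := Y) (Sum.inl A) (AW k X Y (simplexChain k z)) =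
      A (simplexChain k (X := X) z.1) := by
  rw [AW_simplexChain, map_sum, Finset.sum_eq_single n]
  · have h : augmentation k Y (simplexChain k (back (X := Y) z.2 n)) = 1 := by
      have h1 : ∀ m (y : Y _⦋m⦌), m = 0 → augmentation k Y (simplexChain k y) = 1 := by
        rintro _ y rfl
        exact augmentation_simplexChain_zero y
      exact h1 _ _ (Nat.sub_self n)
    simp only [letterFun, Sum.elim_inl, LinearMap.comp_apply, TensorProduct.map_tmul, h,
      LinearMap.mul'_apply, mul_one, front, opMap_id]
  · intro c hc hcn
    rw [Finset.mem_range] at hc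
    simp only [letterFun, Sum.elim_inl, LinearMap.comp_apply, TensorProduct.map_tmul,
      LinearMap.mul'_apply]
    rw [augmentation_simplexChain_of_pos (by omega), mul_zero]
  · simp

lemma letterFun_inr_AW (B : Module.Dual k (Chains k Y)) (z : (X ⊗ Y : SSet.{u}) _⦋n⦌) :
    letterFun (X := X) (Sum.inr B) (AW k X Y (simplexChain k z)) =
      B (simplexChain k (X := Y) z.2) := by
  rw [AW_simplexChain, map_sum, Finset.sum_eq_single 0]
  · have h : back (X := Y) z.2 0 = z.2 := by
      rw [back]
      conv_rhs => rw [← opMap_id (X := Y) z.2]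
      exact opMap_congr (X := Y) _ fun i _ => rfl
    simp only [letterFun, Sum.elim_inr, LinearMap.comp_apply, TensorProduct.map_tmul,
      augmentation_simplexChain_zero, LinearMap.mul'_apply, one_mul]
    exact congrArg (fun y => B (simplexChain k y)) h
  · intro c hc hcn
    simp only [letterFun, Sum.elim_inr, LinearMap.comp_apply, TensorProduct.map_tmul,
      LinearMap.mul'_apply]
    rw [augmentation_simplexChain_of_pos hcn, zero_mul]
  · simp

/-- The value of a tensor product of functionals on the image of a simplex under the
Gugenheim–Munkholm map. -/
def gmValue {N : ℕ} (φ : Fin N → Module.Dual k (Chains k X ⊗[k] Chains k Y))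
    (z : (X ⊗ Y : SSet.{u}) _⦋n⦌) : k :=
  evalWord.{v, max v u} φ (gm k X Y N (simplexChain k z))

/-- The value of a word in functionals `a ⊗ 1` and `1 ⊗ b` on the image of a simplex under the
Gugenheim–Munkholm map. -/
def gmEval (W : List (Module.Dual k (Chains k X) ⊕ Module.Dual k (Chains k Y)))
    (z : (X ⊗ Y : SSet.{u}) _⦋n⦌) : k :=
  gmValue (fun i => letterFun (W.get i)) z

lemma gmEval_eq_zero {W : List (Module.Dual k (Chains k X) ⊕ Module.Dual k (Chains k Y))}
    {z : (X ⊗ Y : SSet.{u}) _⦋n⦌} {t : ℕ} (ht : t < n) (h1 : DegAt (X := X) z.1 t)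
    (h2 : DegAt (X := Y) z.2 t) : gmEval W z = 0 := by
  rw [gmEval, gmValue, simplexChain_eq_zero k ht (degAt_prod_iff.2 ⟨h1, h2⟩), map_zero, map_zero]

lemma gmEval_singleton (φ : Module.Dual k (Chains k X) ⊕ Module.Dual k (Chains k Y))
    (z : (X ⊗ Y : SSet.{u}) _⦋n⦌) :
    gmEval [φ] z = letterFun φ (AW k X Y (simplexChain k z)) := by
  rw [gmEval, gmValue]
  change evalWord _ (gm k X Y 1 _) = _
  rw [gm_one, LinearMap.comp_apply, ← mul_one (TensorAlgebra.ι k _)]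
  refine (evalWord_ι_mul.{v, max v u} (n := 0) _ _ _).trans ?_
  have h : (1 : TensorAlgebra k (Chains k X ⊗[k] Chains k Y)) = TensorAlgebra.tprod k _ 0 ![] := by
    rw [TensorAlgebra.tprod_apply]
    rfl
  rw [h, evalWord_tprod]
  simp

lemma gmEval_cons (φ : Module.Dual k (Chains k X) ⊕ Module.Dual k (Chains k Y))
    {W : List (Module.Dual k (Chains k X) ⊕ Module.Dual k (Chains k Y))} {m : ℕ}
    (hW : W.length = m + 1) (z : (X ⊗ Y : SSet.{u}) _⦋n⦌) :
    gmEval (φ :: W) z = ∑ p ∈ Finset.range n, ∑ q ∈ Finset.range (n - p),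
      ∑ β ∈ (Finset.range (p + q + 1)).powersetCard (q + 1), ∑ c ∈ Finset.range (n + 1 + 1),
        (-1 : k) ^ (m + homotopyExp p q β + c * m) *
          (letterFun φ (AW k X Y (simplexChain k (front (homotopyTerm z p q β) c))) *
            gmEval W (back (homotopyTerm z p q β) c)) := by
  rw [gmEval, gmValue]
  have h : gm k X Y (φ :: W).length = gm k X Y (m + 2) := by rw [List.length_cons, hW]
  rw [h, gm_add_two_simplexChain]
  simp only [map_sum, map_smul, smul_eq_mul]
  refine Finset.sum_congr rfl fun p _ => Finset.sum_congr rfl fun q _ =>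
      Finset.sum_congr rfl fun β _ => Finset.sum_congr rfl fun c _ => ?_
  congr 1
  refine (evalWord_ι_mul.{v, max v u} (n := W.length) _ _ _).trans ?_
  have h1 : gm k X Y W.length = gm k X Y (m + 1) := by rw [hW]
  rw [gmEval, gmValue, h1]
  rfl

end GugenheimMunkholm

/-! ### Pinched simplices and the words that vanish -/

section Vanishing

variable {X Y : SSet.{u}} {n : ℕ} {k : Type v} [CommRing k]

/-- There is a degenerate step in the second component that is preceded only by steps that are
degenerate in one of the components, at least once in the first one. -/
def Pinched (z : (X ⊗ Y : SSet.{u}) _⦋n⦌) : Prop :=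
  ∃ J < n, DegAt (X := Y) z.2 J ∧
    (∀ t < J, DegAt (X := X) z.1 t ∨ DegAt (X := Y) z.2 t) ∧ ∃ t < J, DegAt (X := X) z.1 t

section Terms

variable {z : (X ⊗ Y : SSet.{u}) _⦋n⦌} {p q s c : ℕ} {β : Finset ℕ}

lemma front_fst_eq_zero (hβ : β ∈ (Finset.range (p + q + 1)).powersetCard (q + 1))
    (hpq : p + q < n) (hc : c ≤ n + 1) (hs : s ∈ β) (hsc : s < c) :
    simplexChain k (X := X) (front (homotopyTerm z p q β) c).1 = 0 :=
  simplexChain_eq_zero k hsc (degAt_front hc (degAt_fst_of_mem hβ hpq hs))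

lemma front_snd_eq_zero (hβ : β ∈ (Finset.range (p + q + 1)).powersetCard (q + 1))
    (hpq : p + q < n) (hc : c ≤ n + 1) (hs : s ∉ β) (hs' : s ≤ p + q + 1) (hsc : s < c) :
    simplexChain k (X := Y) (front (homotopyTerm z p q β) c).2 = 0 := by
  refine simplexChain_eq_zero k hsc (degAt_front hc ?_)
  rcases Nat.lt_or_ge (p + q) s with h | h
  · obtain rfl : s = p + q + 1 := by omega
    exact degAt_snd_jump hβ hpq
  · exact degAt_snd_of_notMem hβ hpq hs h

/-- The jump serves as the degenerate step of the second component. All steps of the path before it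
lie in `α` or `β`, and the step `s ∈ β` is not before the cut. -/
lemma pinched_back (hβ : β ∈ (Finset.range (p + q + 1)).powersetCard (q + 1))
    (hpq : p + q < n) (hs : s ∈ β) (hsc : c ≤ s) : Pinched (back (homotopyTerm z p q β) c) := by
  have h1 := Finset.mem_range.1 ((Finset.mem_powersetCard.1 hβ).1 hs)
  have hc : c ≤ n + 1 := by omega
  have hX : ∀ t, DegAt (X := X) (homotopyTerm z p q β).1 (t + c) →
    DegAt (X := X) (back (homotopyTerm z p q β) c).1 t := fun t h => degAt_back hc h
  have hY : ∀ t, DegAt (X := Y) (homotopyTerm z p q β).2 (t + c) →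
    DegAt (X := Y) (back (homotopyTerm z p q β) c).2 t := fun t h => degAt_back hc h
  refine ⟨p + q + 1 - c, by omega, hY _ ?_, fun t ht => ?_, s - c, by omega, hX _ ?_⟩
  · rw [Nat.sub_add_cancel (by omega)]
    exact degAt_snd_jump hβ hpq
  · by_cases h : t + c ∈ β
    · exact Or.inl (hX _ (degAt_fst_of_mem hβ hpq h))
    · exact Or.inr (hY _ (degAt_snd_of_notMem hβ hpq h (by omega)))
  · rw [Nat.sub_add_cancel hsc]
    exact degAt_fst_of_mem hβ hpq hs

lemma nonempty_of_mem (hβ : β ∈ (Finset.range (p + q + 1)).powersetCard (q + 1)) :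
    ∃ s ∈ β, s ≤ p + q := by
  obtain ⟨s, hs⟩ : β.Nonempty := by
    rw [← Finset.card_pos, (Finset.mem_powersetCard.1 hβ).2]
    omega
  exact ⟨s, hs, Nat.lt_succ_iff.1 (Finset.mem_range.1 ((Finset.mem_powersetCard.1 hβ).1 hs))⟩

end Terms

/-- The operator `v ↦ b + (v - a)` on vertices. -/
def plateau (a b : ℕ) : ℕ →o ℕ where
  toFun v := b + (v - a)
  monotone' := by
    intro v w h
    dsimp only
    omega

lemma plateau_apply (a b v : ℕ) : plateau a b v = b + (v - a) := rfl

/-- The simplex that remains of a term of the homotopy after splitting off the `q + 1` steps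
in the second component, provided that they come first. -/
def reduceTerm (z : (X ⊗ Y : SSet.{u}) _⦋n⦌) (p q : ℕ) :
    (X ⊗ Y : SSet.{u}) _⦋n + 1 - (q + 1)⦌ :=
  (opMap (X := X) z.1 _ (faceVertex (p + 1) q), opMap (X := Y) z.2 _ (plateau (p + 1) (p + q + 1)))

variable {p q : ℕ}

lemma range_mem_powersetCard :
    Finset.range (q + 1) ∈ (Finset.range (p + q + 1)).powersetCard (q + 1) := by
  rw [Finset.mem_powersetCard]
  exact ⟨Finset.range_mono (by omega), Finset.card_range _⟩

lemma countBelow_range (N v : ℕ) : countBelow (Finset.range N) v = min N v := by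
  have h : (Finset.range N).filter (· < v) = Finset.range (min N v) := by
    ext s
    simp
  rw [countBelow, h, Finset.card_range]

lemma back_homotopyTerm (z : (X ⊗ Y : SSet.{u}) _⦋n⦌) (hpq : p + q < n) :
    back (homotopyTerm z p q (Finset.range (q + 1))) (q + 1) = reduceTerm z p q := by
  have hβ := range_mem_powersetCard (p := p) (q := q)
  refine Prod.ext ?_ ?_
  · change opMap (opMap (X := X) z.1 _ _) _ _ = opMap (X := X) z.1 _ _
    rw [opMap_opMap (X := X) _ fun i hi => by rw [shift_apply]; omega]
    refine opMap_congr (X := X) _ fun i hi => ?_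
    change homotopyX _ _ _ (i + (q + 1)) = _
    rw [faceVertex_apply]
    rcases Nat.lt_or_ge p i with h | h
    · rw [homotopyX_of_gt hβ (by omega), if_neg (by omega)]
      omega
    · have h1 := countBelow_sdiff (S := Finset.range (q + 1)) (N := p + q + 1)
        (v := i + (q + 1)) (by omega)
      rw [countBelow_range] at h1
      rw [homotopyX_of_le hβ (by omega), if_pos (by omega)]
      omega
  · change opMap (opMap (X := Y) z.2 _ _) _ _ = opMap (X := Y) z.2 _ _
    rw [opMap_opMap (X := Y) _ fun i hi => by rw [shift_apply]; omega]
    refine opMap_congr (X := Y) _ fun i hi => ?_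
    change homotopyY _ _ _ (i + (q + 1)) = _
    rw [plateau_apply]
    rcases Nat.lt_or_ge p i with h | h
    · rw [homotopyY_of_gt hβ (by omega)]
      omega
    · rw [homotopyY_of_le (by omega), countBelow_range]
      omega

lemma front_homotopyTerm (z : (X ⊗ Y : SSet.{u}) _⦋n⦌) (hpq : p + q < n) :
    (front (homotopyTerm z p q (Finset.range (q + 1))) (q + 1)).2 =
      opMap (X := Y) z.2 (q + 1) (faceVertex 0 p) := by
  change opMap (opMap (X := Y) z.2 _ _) _ _ = opMap (X := Y) z.2 _ _
  rw [opMap_opMap (X := Y) _ fun i hi => by rw [OrderHom.id_coe, id]; omega]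
  refine opMap_congr (X := Y) _ fun i hi => ?_
  change homotopyY _ _ _ i = _
  rw [shift_apply, homotopyY_of_le (by omega), countBelow_range]
  omega

/-- All of `β` comes before all of `α`, so each of the `p * (q+1)` pairs is an inversion. -/
lemma homotopyExp_range (p q : ℕ) :
    homotopyExp p q (Finset.range (q + 1)) = p + q + p * (q + 1) := by
  rw [homotopyExp, Finset.filter_true_of_mem]
  · rw [Finset.card_product, card_sdiff_of_mem range_mem_powersetCard, Finset.card_range]
  · rintro ⟨s, t⟩ h
    simp only [Finset.mem_product, Finset.mem_sdiff, Finset.mem_range] at h ⊢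
    omega

/-- The recursive formula for the values of a word that starts with `1 ⊗ b`. -/
lemma gmEval_inr_cons (B : Module.Dual k (Chains k Y))
    {W : List (Module.Dual k (Chains k X) ⊕ Module.Dual k (Chains k Y))} {m : ℕ}
    (hW : W.length = m + 1)
    (h : ∀ {n : ℕ} (z : (X ⊗ Y : SSet.{u}) _⦋n⦌), Pinched z → gmEval W z = 0)
    (z : (X ⊗ Y : SSet.{u}) _⦋n⦌) :
    gmEval (Sum.inr B :: W) z = ∑ p ∈ Finset.range n, ∑ q ∈ Finset.range (n - p),
      (-1 : k) ^ (m + (p + q + p * (q + 1)) + (q + 1) * m) *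
        (B (simplexChain k (opMap (X := Y) z.2 (q + 1) (faceVertex 0 p))) *
          gmEval W (reduceTerm z p q)) := by
  rw [gmEval_cons _ hW]
  refine Finset.sum_congr rfl fun p hp => Finset.sum_congr rfl fun q hq => ?_
  rw [Finset.mem_range] at hp hq
  have hpq : p + q < n := by omega
  rw [Finset.sum_eq_single_of_mem _ range_mem_powersetCard,
    Finset.sum_eq_single_of_mem (q + 1) (Finset.mem_range.2 (by omega)), homotopyExp_range,
    letterFun_inr_AW, back_homotopyTerm z hpq, front_homotopyTerm z hpq]
  · intro c hc hcq
    rw [Finset.mem_range] at hc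
    rw [letterFun_inr_AW]
    rcases Nat.lt_or_ge (q + 1) c with h1 | h1
    · rw [front_snd_eq_zero (s := q + 1) range_mem_powersetCard hpq (by omega) (by simp) (by omega) h1,
        map_zero, zero_mul, mul_zero]
    · rw [h _ (pinched_back (s := q) range_mem_powersetCard hpq (by simp) (by omega)), mul_zero,
        mul_zero]
  · intro β hβ hne
    refine Finset.sum_eq_zero fun c hc => ?_
    rw [Finset.mem_range] at hc
    rw [letterFun_inr_AW]
    by_cases h1 : ∃ s ∈ β, c ≤ s
    · obtain ⟨s, hs, hcs⟩ := h1
      rw [h _ (pinched_back hβ hpq hs hcs), mul_zero, mul_zero]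
    by_cases h2 : ∃ s < c, s ∉ β ∧ s ≤ p + q + 1
    · obtain ⟨s, hs, h3, h4⟩ := h2
      rw [front_snd_eq_zero hβ hpq (by omega) h3 h4 hs, map_zero, zero_mul, mul_zero]
    -- Now `β` lies entirely before the cut, and up to the jump no other step does. Since the jump
    -- `p+q+1` is never in `β`, this forces `β = {0,…,c-1}`, and counting elements gives `c = q+1`.
    push Not at h1 h2
    refine absurd ?_ hne
    have h3 : β = Finset.range c := by
      ext s
      rw [Finset.mem_range]
      constructor
      · exact h1 s
      · intro hs
        by_contra h4
        have h5 : p + q + 1 ∈ β := by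
          by_contra h6
          have h7 := h2 s hs h4
          exact absurd (h2 (p + q + 1) (by omega) h6) (by omega)
        have := Finset.mem_range.1 ((Finset.mem_powersetCard.1 hβ).1 h5)
        omega
    have h4 := (Finset.mem_powersetCard.1 hβ).2
    rw [h3, Finset.card_range] at h4
    rw [h3, h4]

/-- A single `a` sees the degenerate step of `x`. Otherwise consider a term `(p, q)` of the
recursion. Unless `b` vanishes, `y` has no degenerate step in `[p, p+q]`, so `J` lies below or above
this range. If `J < p`, the degenerate step `t < J` of `x` survives in the reduced simplex, where
`y` is constant so far. If `J > p+q`, the pinching condition makes `x` degenerate on all of `[p,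
p+q]`, so the step `p` of the reduced simplex is degenerate in both components. The induction
hypothesis is only needed to have the short form of the recursion. -/
lemma gmEval_of_pinched (Bs : List (Module.Dual k (Chains k Y))) (A : Module.Dual k (Chains k X))
    (z : (X ⊗ Y : SSet.{u}) _⦋n⦌) (hz : Pinched z) :
    gmEval (Bs.map Sum.inr ++ [Sum.inl A]) z = 0 := by
  induction Bs generalizing n with
  | nil =>
    obtain ⟨J, h1, h2, h3, t, h4, h5⟩ := hz
    rw [List.map_nil, List.nil_append, gmEval_singleton, letterFun_inl_AW,
      simplexChain_eq_zero k (by omega) h5, map_zero]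
  | cons B Bs ih =>
    rw [List.map_cons, List.cons_append, gmEval_inr_cons (m := Bs.length) B (by simp) ih]
    refine Finset.sum_eq_zero fun p hp => Finset.sum_eq_zero fun q hq => ?_
    rw [Finset.mem_range] at hp hq
    by_cases h0 : ∃ t, p ≤ t ∧ t ≤ p + q ∧ DegAt (X := Y) z.2 t
    · obtain ⟨t, h1, h2, h3⟩ := h0
      rw [simplexChain_eq_zero k (t := t - p) (by omega), map_zero, zero_mul, mul_zero]
      refine degAt_opMap_of_succ (s := t) (fun i hi => ?_) ?_ ?_ h3
      · rw [shift_apply]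
        omega
      · rw [shift_apply]
        omega
      · rw [shift_apply]
        omega
    · push Not at h0
      obtain ⟨J, h1, h2, h3, t, h4, h5⟩ := hz
      have hX : ∀ i ≤ n + 1 - (q + 1), faceVertex (p + 1) q i ≤ n := by
        intro i hi
        rw [faceVertex_apply]
        split_ifs <;> omega
      have hY : ∀ i ≤ n + 1 - (q + 1), plateau (p + 1) (p + q + 1) i ≤ n := by
        intro i hi
        rw [plateau_apply]
        omega
      rcases Nat.lt_or_ge J p with h6 | h6
      · rw [gmEval_eq_zero (t := t) (by omega), mul_zero, mul_zero]
        · refine degAt_opMap_of_succ (X := X) hX ?_ ?_ h5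
          · rw [faceVertex_apply, if_pos (by omega)]
          · rw [faceVertex_apply, if_pos (by omega)]
        · refine degAt_opMap_of_eq (X := Y) hY ?_
          rw [plateau_apply, plateau_apply]
          omega
      · have h7 : p + q < J := by
          by_contra h8
          exact h0 J h6 (by omega) h2
        rw [gmEval_eq_zero (t := p) (by omega), mul_zero, mul_zero]
        · refine degAt_opMap (X := X) hX ?_
          rw [faceVertex_apply, faceVertex_apply, if_pos (by omega), if_neg (by omega)]
          refine constOn_of_degAt (X := X) (by omega) fun t h8 h9 => ?_
          exact (h3 t (by omega)).resolve_right (h0 t h8 (by omega))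
        · refine degAt_opMap_of_eq (X := Y) hY ?_
          rw [plateau_apply, plateau_apply]
          omega

/-- A word in functionals `a ⊗ 1` and `1 ⊗ b` vanishes on the image of the Gugenheim–Munkholm map
unless all letters but the last one are of the form `1 ⊗ b` and the last one is `a ⊗ 1`. -/
lemma gmEval_eq_zero_of_ne (W : List (Module.Dual k (Chains k X) ⊕ Module.Dual k (Chains k Y)))
    (hW : 2 ≤ W.length) (h : ∀ (Bs : List (Module.Dual k (Chains k Y))) A, W ≠ Bs.map Sum.inr ++ [Sum.inl A])
    (z : (X ⊗ Y : SSet.{u}) _⦋n⦌) : gmEval W z = 0 := by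
  induction W generalizing n with
  | nil => simp at hW
  | cons φ W ih =>
    obtain _ | ⟨ψ, W⟩ := W
    · simp at hW
    rw [gmEval_cons (m := W.length) _ rfl]
    refine Finset.sum_eq_zero fun p hp => Finset.sum_eq_zero fun q hq =>
      Finset.sum_eq_zero fun β hβ => Finset.sum_eq_zero fun c hc => ?_
    rw [Finset.mem_range] at hp hq hc
    have hpq : p + q < n := by omega
    obtain ⟨s, hs, hs'⟩ := nonempty_of_mem hβ
    by_cases hg : ∃ (Bs : List (Module.Dual k (Chains k Y))) (A : _), ψ :: W = Bs.map Sum.inr ++ [Sum.inl A]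
    · obtain ⟨Bs, A, hBA⟩ := hg
      rcases φ with A' | B
      -- A step in `β` before the cut makes the front face of `x` degenerate; one after the cut
      -- makes the back face pinched, and the rest of the word vanishes there.
      · rw [letterFun_inl_AW]
        rcases Nat.lt_or_ge s c with h1 | h1
        · rw [front_fst_eq_zero hβ hpq (by omega) hs h1, map_zero, zero_mul, mul_zero]
        · rw [hBA, gmEval_of_pinched Bs A _ (pinched_back hβ hpq hs h1), mul_zero, mul_zero]
      · exact absurd (by rw [hBA]; rfl) (h (B :: Bs) A)
    · push Not at hg
      obtain _ | ⟨χ, W⟩ := W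
      · rcases ψ with A | B
        · exact absurd rfl (hg [] A)
        -- The second component rests at the jump. If the jump comes after the cut, then `b`
        -- vanishes on the back face. If it comes before, the front face has a resting step in
        -- either component, so the first letter vanishes whatever its kind.
        rcases Nat.lt_or_ge (p + q + 1) c with h1 | h1
        · have h2 : letterFun φ
              (AW k X Y (simplexChain k (front (homotopyTerm z p q β) c))) = 0 := by
            rcases φ with A | B
            · rw [letterFun_inl_AW, front_fst_eq_zero hβ hpq (by omega) hs (by omega), map_zero]
            · rw [letterFun_inr_AW, front_snd_eq_zero (s := p + q + 1) hβ hpq (by omega) ?_ le_rfl h1,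
                map_zero]
              intro h3
              have := Finset.mem_range.1 ((Finset.mem_powersetCard.1 hβ).1 h3)
              omega
          rw [h2, zero_mul, mul_zero]
        · have h2 : DegAt (X := Y) (back (homotopyTerm z p q β) c).2 (p + q + 1 - c) := by
            refine degAt_back (X := Y) (x := (homotopyTerm z p q β).2) (by omega) ?_
            rw [Nat.sub_add_cancel h1]
            exact degAt_snd_jump hβ hpq
          rw [gmEval_singleton, letterFun_inr_AW, simplexChain_eq_zero k (by omega) h2, map_zero,
            mul_zero, mul_zero]
      · rw [ih (by simp) hg, mul_zero, mul_zero]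

end Vanishing

/-! ### Unwinding the recursion into cuts of `[0, n]` -/

section CutSum

variable {X Y : SSet.{u}} {n : ℕ} {k : Type v} [CommRing k]
variable (A : Module.Dual k (Chains k X)) (x : X _⦋n⦌) (y : Y _⦋n⦌)

/-- The sign exponent for splitting off an interval of length `j` after `P` vertices, if there
remain `l` further intervals. -/
def cutExp (l P j : ℕ) : ℕ := l + P + (j + 1) + P * j + j * l

/-- The sum over all ways to cut out intervals from `[s,n]` for the functionals `Bs`, where the
remaining vertices are appended to `L`. -/
def cutSum (Bs : List (Module.Dual k (Chains k Y))) (L : List ℕ) (s : ℕ) : k :=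
  match Bs with
  | [] => A (restr k x (L ++ interval s n))
  | B :: Bs => ∑ i ∈ Finset.range (n - s + 1), ∑ j ∈ Finset.range (n - (s + i) + 1),
      (-1 : k) ^ cutExp Bs.length (L.length + i) j *
        (B (restr k y (interval (s + i) (s + i + j))) *
          cutSum Bs (L ++ interval s (s + i)) (s + i + j))

/-- The vertices in `L` and the vertex `s` all end up in the list to which `x` is finally
restricted, so a repetition persists. -/
lemma cutSum_eq_zero (Bs : List (Module.Dual k (Chains k Y))) {L : List ℕ} {s : ℕ}
    (hL : ∀ v ∈ L, v ≤ n) (hs : s ≤ n) (h : ¬ (L ++ [s]).Nodup) : cutSum A x y Bs L s = 0 := by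
  have hsub : ∀ j, s ≤ j → (L ++ [s]).Sublist (L ++ interval s j) := by
    intro j hj
    refine List.Sublist.append_left ?_ L
    rw [List.singleton_sublist, mem_interval]
    exact ⟨le_rfl, hj⟩
  induction Bs generalizing L s with
  | nil =>
    rw [cutSum, restr_eq_zero k x _ fun h1 => h (h1.sublist (hsub n hs)), map_zero]
    intro v hv
    rcases List.mem_append.1 hv with hv | hv
    · exact hL v hv
    · exact (mem_interval.1 hv).2
  | cons B Bs ih =>
    rw [cutSum]
    refine Finset.sum_eq_zero fun i hi => Finset.sum_eq_zero fun j hj => ?_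
    rw [Finset.mem_range] at hi hj
    rw [ih _ (by omega), mul_zero, mul_zero]
    · exact fun h1 => h (h1.sublist ((hsub _ (by omega)).trans (List.sublist_append_left _ _)))
    · intro j' hj'
      refine List.Sublist.append_left ?_ _
      rw [List.singleton_sublist, mem_interval]
      exact ⟨le_rfl, hj'⟩
    · intro v hv
      rcases List.mem_append.1 hv with hv | hv
      · exact hL v hv
      · have := (mem_interval.1 hv).2
        omega

/-- Here the interval just cut out has length 0: the vertex `t` ends one interval of `x` and begins
the next. Such summands occur in the interval cut but not in the homotopy. -/
lemma cutSum_interval_eq_zero (Bs : List (Module.Dual k (Chains k Y))) {L : List ℕ} {s t : ℕ}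
    (hL : ∀ v ∈ L, v ≤ n) (hst : s ≤ t) (ht : t ≤ n) :
    cutSum A x y Bs (L ++ interval s t) t = 0 := by
  refine cutSum_eq_zero A x y Bs ?_ ht fun h => ?_
  · intro v hv
    rcases List.mem_append.1 hv with hv | hv
    · exact hL v hv
    · exact (mem_interval.1 hv).2.trans ht
  · refine List.disjoint_of_nodup_append h (a := t) ?_ (List.mem_singleton_self t)
    exact List.mem_append_right L (mem_interval.2 ⟨hst, le_rfl⟩)

/-- The simplex of the product with components `x` and `y`. -/
def pair (x : X _⦋n⦌) (y : Y _⦋n⦌) : (X ⊗ Y : SSet.{u}) _⦋n⦌ := (x, y)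

/-- The simplex of the product with components `opMap x m f` and `opMap y m g`. -/
def pairMap (m : ℕ) (f g : ℕ →o ℕ) : (X ⊗ Y : SSet.{u}) _⦋m⦌ :=
  pair (opMap x m f) (opMap y m g)

lemma reduceTerm_pairMap {m p q m' : ℕ} {f g f' g' : ℕ →o ℕ} (hm : m' = m + 1 - (q + 1))
    (hpq : p + q < m) (hf : ∀ i ≤ m', f (faceVertex (p + 1) q i) = f' i)
    (hg : ∀ i ≤ m', g (plateau (p + 1) (p + q + 1) i) = g' i)
    (W : List (Module.Dual k (Chains k X) ⊕ Module.Dual k (Chains k Y))) :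
    gmEval W (reduceTerm (pairMap x y m f g) p q) = gmEval W (pairMap x y m' f' g') := by
  subst hm
  congr 1
  refine Prod.ext ?_ ?_
  · refine (opMap_opMap (X := X) x fun i hi => ?_).trans (opMap_congr (X := X) x hf)
    rw [faceVertex_apply]
    split_ifs <;> omega
  · refine (opMap_opMap (X := Y) y fun i hi => ?_).trans (opMap_congr (X := Y) y hg)
    rw [plateau_apply]
    omega

/-- The values of a word `(1 ⊗ b₁) ⋯ (1 ⊗ b_l) (a ⊗ 1)` as an iterated sum. -/
lemma gmEval_pairMap (Bs : List (Module.Dual k (Chains k Y))) {m s : ℕ} {L : List ℕ}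
    {f : ℕ →o ℕ} (hs : s ≤ n) (hm : m = L.length + (n - s)) (hfm : ∀ i ≤ m, f i ≤ n)
    (hf : ∀ (i : ℕ) (hi : i < L.length), L[i] = f i)
    (hf' : ∀ i, L.length ≤ i → i ≤ m → f i = s + (i - L.length)) :
    gmEval (Bs.map Sum.inr ++ [Sum.inl A]) (pairMap x y m f (plateau L.length s)) =
        cutSum A x y Bs L s := by
  induction Bs generalizing m s L f with
  | nil =>
    rw [List.map_nil, List.nil_append, gmEval_singleton, letterFun_inl_AW, cutSum]
    congr 1
    symm
    refine restr_eq_simplexChain k x (by rw [List.length_append, interval_length]; omega) ?_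
    intro i hi
    rw [List.length_append, interval_length] at hi
    rw [List.getElem_append]
    split_ifs with h
    · exact hf i h
    · rw [getElem_interval, hf' i (by omega) (by omega)]
  | cons B Bs ih =>
    have hL : ∀ v ∈ L, v ≤ n := by
      intro v hv
      obtain ⟨i, hi, rfl⟩ := List.getElem_of_mem hv
      rw [hf i hi]
      exact hfm i (by omega)
    have hgm : ∀ i ≤ m, plateau L.length s i ≤ n := by
      intro i hi
      rw [plateau_apply]
      omega
    have hB : ∀ p q, p + q < m → opMap (X := Y) (pairMap x y m f (plateau L.length s)).2 (q + 1)
        (faceVertex 0 p) = opMap y (q + 1) ((plateau L.length s).comp (faceVertex 0 p)) := by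
      intro p q h
      refine opMap_opMap (X := Y) y fun i hi => ?_
      rw [shift_apply]
      omega
    rw [List.map_cons, List.cons_append, gmEval_inr_cons (m := Bs.length) B (by simp)
      (gmEval_of_pinched Bs A), cutSum, Finset.sum_range_succ _ (n - s)]
    -- For `i = n - s` only an interval of length 0 fits, so this summand has no counterpart in the
    -- recursion.
    have hlast : ∑ j ∈ Finset.range (n - (s + (n - s)) + 1),
        (-1 : k) ^ cutExp Bs.length (L.length + (n - s)) j *
          (B (restr k y (interval (s + (n - s)) (s + (n - s) + j))) *
            cutSum A x y Bs (L ++ interval s (s + (n - s))) (s + (n - s) + j)) = 0 := by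
      refine Finset.sum_eq_zero fun j hj => ?_
      rw [Finset.mem_range] at hj
      obtain rfl : j = 0 := by omega
      rw [add_zero, cutSum_interval_eq_zero A x y Bs hL (by omega) (by omega), mul_zero, mul_zero]
    have hm' := Finset.sum_range_add (fun p => ∑ q ∈ Finset.range (m - p),
      (-1 : k) ^ (Bs.length + (p + q + p * (q + 1)) + (q + 1) * Bs.length) *
        (B (simplexChain k (opMap (X := Y) (pairMap x y m f (plateau L.length s)).2 (q + 1)
          (faceVertex 0 p))) * gmEval (Bs.map Sum.inr ++ [Sum.inl A])
            (reduceTerm (pairMap x y m f (plateau L.length s)) p q))) L.length (n - s)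
    rw [← hm] at hm'
    rw [hm', hlast, add_zero, Finset.sum_eq_zero, zero_add]
    · refine Finset.sum_congr rfl fun i hi => ?_
      rw [Finset.mem_range] at hi
      -- This splits off `j = 0`; the other lengths are `j = q + 1` with `q` from the homotopy.
      rw [Finset.sum_range_succ']
      simp only [add_zero]
      rw [cutSum_interval_eq_zero A x y Bs hL (by omega) (by omega), mul_zero, mul_zero, add_zero]
      rw [show m - (L.length + i) = n - (s + i) by omega]
      refine Finset.sum_congr rfl fun q hq => ?_
      rw [Finset.mem_range] at hq
      have hint : (interval s (s + i)).length = i + 1 := by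
        rw [interval_length]
        omega
      have hlen : (L ++ interval s (s + i)).length = L.length + i + 1 := by
        rw [List.length_append, hint]
        omega
      have h1 : restr k y (interval (s + i) (s + i + (q + 1))) =
          simplexChain k (opMap y (q + 1) ((plateau L.length s).comp
            (faceVertex 0 (L.length + i)))) := by
        refine restr_eq_simplexChain k y (by rw [interval_length]; omega) fun j hj => ?_
        rw [getElem_interval]
        change _ = s + (j + (L.length + i) - L.length)
        omega
      have h2 : (-1 : k) ^ (Bs.length + (L.length + i + q + (L.length + i) * (q + 1)) +
          (q + 1) * Bs.length) = (-1) ^ cutExp Bs.length (L.length + i) (q + 1) := by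
        have h3 : cutExp Bs.length (L.length + i) (q + 1) = Bs.length + (L.length + i + q +
          (L.length + i) * (q + 1)) + (q + 1) * Bs.length + 2 := by
          rw [cutExp]
          ring
        rw [h3, pow_add _ _ 2, neg_one_sq, mul_one]
      rw [h1, h2, hB _ _ (by omega)]
      congr 2
      -- With `p = L.length + i` the reduced simplex is again of the required form. The vertices of
      -- `x` up to `s + i` are now fixed, the next `q` are omitted, and `y` rests at the end of the
      -- interval just cut out.
      have h4 := ih (m := m - q) (s := s + i + (q + 1)) (L := L ++ interval s (s + i))
        (f := f.comp (faceVertex (L.length + i + 1) q)) (by omega) (by rw [hlen]; omega) ?_ ?_ ?_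
      · rw [← h4, hlen]
        refine reduceTerm_pairMap x y (by omega) (by omega) (fun j hj => rfl) (fun j hj => ?_) _
        simp only [plateau_apply]
        omega
      · intro j hj
        refine hfm _ ?_
        rw [faceVertex_apply]
        split_ifs <;> omega
      · intro j hj
        rw [hlen] at hj
        change _ = f (faceVertex _ _ _)
        rw [faceVertex_apply, if_pos hj, List.getElem_append]
        split_ifs with h
        · exact hf j h
        · rw [getElem_interval, hf' j (by omega) (by omega)]
      · intro j hj hj'
        rw [hlen] at hj ⊢
        change f (faceVertex _ _ _) = _
        rw [faceVertex_apply, if_neg (by omega), hf' _ (by omega) (by omega)]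
        omega
    -- For `p < L.length` the front face of `y` starts inside the plateau and has a degenerate first
    -- step.
    · intro p hp
      rw [Finset.mem_range] at hp
      refine Finset.sum_eq_zero fun q hq => ?_
      rw [Finset.mem_range] at hq
      rw [hB _ _ (by omega), simplexChain_eq_zero k (t := 0) (by omega), map_zero, zero_mul,
        mul_zero]
      refine degAt_opMap_of_eq (fun i hi => ?_) ?_
      · refine hgm _ ?_
        rw [shift_apply]
        omega
      · change s + (1 + p - L.length) = s + (0 + p - L.length)
        omega

/-- The value of a word `(1 ⊗ b₁) ⋯ (1 ⊗ b_l) (a ⊗ 1)` on the simplex `(x, y)`. -/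
lemma gmEval_eq_cutSum (Bs : List (Module.Dual k (Chains k Y))) :
    gmEval (Bs.map Sum.inr ++ [Sum.inl A]) (pair x y) =
      cutSum A x y Bs [] 0 := by
  rw [← gmEval_pairMap A x y Bs (m := n) (L := []) (f := OrderHom.id) (Nat.zero_le n) (by simp)
    (fun i hi => hi) (fun i hi => absurd hi (by simp)) (fun i _ _ => by simp)]
  congr 1
  refine Prod.ext (opMap_id (X := X) x).symm ?_
  refine (opMap_id (X := Y) y).symm.trans (opMap_congr (X := Y) y fun i hi => ?_)
  simp [plateau_apply]

end CutSum

/-! ### Sums over subdivisions as iterated sums -/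

section Sequences

/-- The sequence with first entry `a`, followed by `ν`. -/
def consSeq (a : ℕ) (ν : ℕ → ℕ) (t : ℕ) : ℕ := Nat.casesOn t a ν

lemma consSeq_zero (a : ℕ) (ν : ℕ → ℕ) : consSeq a ν 0 = a := rfl

lemma consSeq_succ (a : ℕ) (ν : ℕ → ℕ) (t : ℕ) : consSeq a ν (t + 1) = ν t := rfl

variable {k : Type v} [CommRing k]

/-- The sum over all weakly increasing sequences with values in `{s,…,n}` that are equal to `n`
from the index `N` on. -/
def seqSum (N s n : ℕ) (T : (ℕ → ℕ) → k) : k :=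
  match N with
  | 0 => T fun _ => n
  | N + 1 => ∑ i ∈ Finset.range (n - s + 1), seqSum N (s + i) n fun ν => T (consSeq (s + i) ν)

lemma mul_seqSum (c : k) (N s n : ℕ) (T : (ℕ → ℕ) → k) :
    c * seqSum N s n T = seqSum N s n fun ν => c * T ν := by
  induction N generalizing s T with
  | zero => rfl
  | succ N ih => simp only [seqSum, Finset.mul_sum, ih]

/-- The extension of a finite sequence by its last entry. -/
def extend {N n : ℕ} (m : Fin (N + 1) → Fin (n + 1)) (t : ℕ) : ℕ :=
  (m ⟨min t N, Nat.lt_succ_iff.2 (min_le_right t N)⟩).val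

lemma extend_val {N n : ℕ} (m : Fin (N + 1) → Fin (n + 1)) (t : Fin (N + 1)) :
    extend m t.val = (m t).val := by
  have h : (⟨min t.val N, Nat.lt_succ_iff.2 (min_le_right t.val N)⟩ : Fin (N + 1)) = t :=
    Fin.ext (min_eq_left (Nat.lt_succ_iff.1 t.2))
  rw [extend, h]

lemma extend_cons {N n : ℕ} (a : Fin (n + 1)) (m : Fin (N + 1) → Fin (n + 1)) :
    extend (Fin.cons a m : Fin (N + 1 + 1) → Fin (n + 1)) = consSeq a (extend m) := by
  funext t
  rcases t with _ | t
  · have h : (⟨min 0 (N + 1), Nat.lt_succ_iff.2 (min_le_right 0 (N + 1))⟩ : Fin (N + 1 + 1)) = 0 :=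
      Fin.ext (Nat.zero_min _)
    rw [extend, h]
    rfl
  · have h : (⟨min (t + 1) (N + 1), Nat.lt_succ_iff.2 (min_le_right (t + 1) (N + 1))⟩ :
        Fin (N + 1 + 1)) = Fin.succ ⟨min t N, Nat.lt_succ_iff.2 (min_le_right t N)⟩ :=
      Fin.ext (by simp)
    rw [extend, h, Fin.cons_succ]
    rfl

/-- The increasing sequences from a value `≥ s` to `n`. -/
def ascents (N s n : ℕ) : Finset (Fin (N + 1) → Fin (n + 1)) :=
  open Classical in
  Finset.univ.filter fun m => Monotone m ∧ s ≤ (m 0).val ∧ m (Fin.last N) = Fin.last n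

lemma mem_ascents {N s n : ℕ} {m : Fin (N + 1) → Fin (n + 1)} :
    m ∈ ascents N s n ↔ Monotone m ∧ s ≤ (m 0).val ∧ m (Fin.last N) = Fin.last n := by
  simp [ascents]

lemma monotone_cons_iff {N n : ℕ} {a : Fin (n + 1)} {m : Fin (N + 1) → Fin (n + 1)} :
    Monotone (Fin.cons a m : Fin (N + 1 + 1) → Fin (n + 1)) ↔ a ≤ m 0 ∧ Monotone m := by
  constructor
  · intro h
    refine ⟨by simpa using h (Fin.zero_le (Fin.succ 0)), fun i j hij => ?_⟩
    simpa using h (Fin.succ_le_succ_iff.2 hij)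
  · rintro ⟨h1, h2⟩ i j
    refine Fin.cases ?_ (fun i => ?_) i <;> refine Fin.cases ?_ (fun j => ?_) j
    · simp
    · intro _
      simpa using h1.trans (h2 (Fin.zero_le j))
    · intro h
      simp at h
    · intro h
      simpa using h2 (Fin.succ_le_succ_iff.1 h)

lemma cons_mem_ascents {N s n : ℕ} {a : Fin (n + 1)} {m : Fin (N + 1) → Fin (n + 1)} :
    (Fin.cons a m : Fin (N + 1 + 1) → Fin (n + 1)) ∈ ascents (N + 1) s n ↔
      s ≤ a.val ∧ m ∈ ascents N a.val n := by
  rw [mem_ascents, mem_ascents, monotone_cons_iff, ← Fin.succ_last, Fin.cons_succ, Fin.cons_zero,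
    Fin.le_def]
  tauto

/-- The outer sum chooses the first entry `s + i`, and the remaining entries ascend from there. -/
lemma sum_ascents (N : ℕ) {s n : ℕ} (hs : s ≤ n) (T : (ℕ → ℕ) → k) :
    ∑ m ∈ ascents N s n, T (extend m) = seqSum N s n T := by
  induction N generalizing s T with
  | zero =>
    rw [seqSum, Finset.sum_eq_single fun _ => Fin.last n]
    · rfl
    · intro m hm h
      refine absurd (funext fun i => ?_) h
      rw [← (mem_ascents.1 hm).2.2]
      congr 1
      exact Subsingleton.elim (α := Fin 1) _ _
    · intro h
      exact absurd (mem_ascents.2 ⟨monotone_const, hs, rfl⟩) h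
  | succ N ih =>
    rw [seqSum, Finset.sum_congr rfl fun i hi => (ih (s := s + i)
      (by rw [Finset.mem_range] at hi; omega) _).symm, Finset.sum_sigma']
    symm
    refine Finset.sum_bij
      -- The reduction modulo `n + 1` in `Fin.ofNat` has no effect because `s + i ≤ n`.
      (fun p _ => (Fin.cons (Fin.ofNat (n + 1) (s + p.1)) p.2 : Fin (N + 1 + 1) → Fin (n + 1)))
      ?_ ?_ ?_ ?_
    · rintro ⟨i, m⟩ h
      rw [Finset.mem_sigma, Finset.mem_range] at h
      dsimp only at h
      have h1 : (Fin.ofNat (n + 1) (s + i)).val = s + i := Nat.mod_eq_of_lt (by omega)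
      rw [cons_mem_ascents, h1]
      exact ⟨by omega, h.2⟩
    · rintro ⟨i, m⟩ h ⟨i', m'⟩ h' heq
      rw [Finset.mem_sigma, Finset.mem_range] at h h'
      dsimp only at h h'
      have h1 : (Fin.ofNat (n + 1) (s + i)).val = s + i := Nat.mod_eq_of_lt (by omega)
      have h1' : (Fin.ofNat (n + 1) (s + i')).val = s + i' := Nat.mod_eq_of_lt (by omega)
      obtain ⟨h2, rfl⟩ := Fin.cons_inj.1 heq
      rw [Fin.ext_iff, h1, h1'] at h2
      obtain rfl : i = i' := by omega
      rfl
    · intro m hm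
      rw [← Fin.cons_self_tail m, cons_mem_ascents] at hm
      have h2 := (m 0).2
      refine ⟨⟨(m 0).val - s, Fin.tail m⟩, ?_, ?_⟩
      · rw [Finset.mem_sigma, Finset.mem_range]
        dsimp only
        refine ⟨by omega, ?_⟩
        rw [show s + ((m 0).val - s) = (m 0).val by omega]
        exact hm.2
      · have h1 : Fin.ofNat (n + 1) (s + ((m 0).val - s)) = m 0 :=
          Fin.ext ((Nat.mod_eq_of_lt (by omega)).trans (by omega))
        dsimp only
        rw [h1, Fin.cons_self_tail]
    · rintro ⟨i, m⟩ h
      rw [Finset.mem_sigma, Finset.mem_range] at h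
      dsimp only at h
      have h1 : (Fin.ofNat (n + 1) (s + i)).val = s + i := Nat.mod_eq_of_lt (by omega)
      dsimp only
      rw [extend_cons, h1]

lemma sum_subdivisions (N n : ℕ) (T : (ℕ → ℕ) → k) :
    ∑ m ∈ subdivisions (N + 1) n, T (extend m) = seqSum N 0 n fun ν => T (consSeq 0 ν) := by
  rw [← sum_ascents N (Nat.zero_le n)]
  have hmem : ∀ m : Fin (N + 1) → Fin (n + 1),
      (Fin.cons 0 m : Fin (N + 1 + 1) → Fin (n + 1)) ∈ subdivisions (N + 1) n ↔
        m ∈ ascents N 0 n := by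
    intro m
    rw [mem_ascents, subdivisions, Finset.mem_filter, monotone_cons_iff, ← Fin.succ_last,
      Fin.cons_succ, Fin.cons_zero]
    simp
  symm
  refine Finset.sum_bij (fun m _ => (Fin.cons 0 m : Fin (N + 1 + 1) → Fin (n + 1))) ?_ ?_ ?_ ?_
  · exact fun m hm => (hmem m).2 hm
  · exact fun m _ m' _ h => (Fin.cons_inj.1 h).2
  · intro m hm
    have h0 : m 0 = 0 := by
      rw [subdivisions, Finset.mem_filter] at hm
      exact hm.2.2.1
    have h1 : (Fin.cons 0 (Fin.tail m) : Fin (N + 1 + 1) → Fin (n + 1)) = m := by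
      rw [← h0, Fin.cons_self_tail]
    exact ⟨Fin.tail m, (hmem _).1 (by rwa [h1]), h1⟩
  · intro m _
    rw [extend_cons]
    rfl

end Sequences

/-! ### The summand for a fixed sequence of end points -/

section CutTerm

variable {X Y : SSet.{u}} {n : ℕ} {k : Type v} [CommRing k]
variable (A : Module.Dual k (Chains k X)) (x : X _⦋n⦌) (y : Y _⦋n⦌)

/-- The summand of `cutSum` that belongs to the sequence `ν` of end points. -/
def cutTerm (Bs : List (Module.Dual k (Chains k Y))) (L : List ℕ) (ν : ℕ → ℕ) : k :=
  match Bs with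
  | [] => A (restr k x (L ++ interval (ν 0) (ν 1)))
  | B :: Bs => (-1 : k) ^ cutExp Bs.length (L.length + (ν 1 - ν 0)) (ν 2 - ν 1) *
        (B (restr k y (interval (ν 1) (ν 2))) *
          cutTerm Bs (L ++ interval (ν 0) (ν 1)) fun t => ν (t + 2))

lemma cutSum_eq_seqSum (Bs : List (Module.Dual k (Chains k Y))) (L : List ℕ) (s : ℕ) :
    cutSum A x y Bs L s =
      seqSum (2 * Bs.length) s n fun ν => cutTerm A x y Bs L (consSeq s ν) := by
  induction Bs generalizing L s with
  | nil => rfl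
  | cons B Bs ih =>
    rw [cutSum]
    refine Finset.sum_congr rfl fun i _ => Finset.sum_congr rfl fun j _ => ?_
    rw [ih, mul_seqSum, mul_seqSum]
    congr 1
    funext ν
    have h1 : s + i - s = i := by omega
    have h2 : s + i + j - (s + i) = j := by omega
    simp only [cutTerm, consSeq_zero, consSeq_succ, h1, h2]

/-- The sign exponent of `cutTerm`, where `P` is the number of vertices so far. -/
def cutTermExp (l P : ℕ) (ν : ℕ → ℕ) : ℕ :=
  match l with
  | 0 => 0
  | l + 1 => cutExp l (P + (ν 1 - ν 0)) (ν 2 - ν 1) +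
      cutTermExp l (P + (ν 1 + 1 - ν 0)) fun t => ν (t + 2)

/-- This solves the recursion: intervals with even index are collected for `x`, those with odd index
go to the successive `bᵢ`, and the signs add up to one exponent. -/
lemma cutTerm_eq {Λ : Type*} (φ : Λ → Module.Dual k (Chains k Y)) (bs : List Λ) (L : List ℕ)
    (ν : ℕ → ℕ) :
    cutTerm A x y (bs.map φ) L ν = (-1 : k) ^ cutTermExp bs.length L.length ν *
      (A (restr k x (L ++ (List.range (bs.length + 1)).flatMap
        fun i => interval (ν (2 * i)) (ν (2 * i + 1)))) *
          ∏ i : Fin bs.length,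
            φ (bs.get i) (restr k y (interval (ν (2 * i + 1)) (ν (2 * i + 2))))) := by
  induction bs generalizing L ν with
  | nil =>
    simp [cutTerm, cutTermExp]
  | cons b bs ih =>
    have h := Fin.prod_univ_succ (n := bs.length) fun i =>
      φ ((b :: bs).get i) (restr k y (interval (ν (2 * i + 1)) (ν (2 * i + 2))))
    refine Eq.trans ?_ (congrArg _ (congrArg _ h.symm))
    rw [List.map_cons, cutTerm, ih, List.length_append, interval_length, List.length_map]
    change _ = (-1 : k) ^ cutTermExp (bs.length + 1) L.length ν * (A (restr k x (L ++
      (List.range (bs.length + 1 + 1)).flatMap _)) * _)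
    have hr : ∀ (g : ℕ → List ℕ), (List.range (bs.length + 1 + 1)).flatMap g =
        g 0 ++ (List.range (bs.length + 1)).flatMap fun i => g (i + 1) := fun g => by
      rw [List.range_succ_eq_map, List.flatMap_cons, List.flatMap_map]
    rw [hr, ← List.append_assoc, cutTermExp, pow_add]
    have h0 : (List.get (b :: bs) 0) = b := rfl
    simp only [Fin.val_succ, Fin.val_zero, mul_zero, zero_add, h0]
    have h3 : ∀ i : Fin bs.length, (b :: bs).get i.succ = bs.get i := fun i => rfl
    simp only [h3]
    have h6 : ∀ i, 2 * (i + 1) = 2 * i + 2 := fun i => by ring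
    simp only [h6]
    ring

end CutTerm

/-! ### The accumulated sign and the permutation and position signs -/

section Signs

/-- The total degree of the intervals with the first label. -/
def cutDegFst (l : ℕ) (ν : ℕ → ℕ) : ℕ :=
  match l with
  | 0 => ν 1 - ν 0
  | l + 1 => ν 1 - ν 0 + 1 + cutDegFst l fun t => ν (t + 2)

/-- The total degree of the remaining intervals. -/
def cutDegSnd (l : ℕ) (ν : ℕ → ℕ) : ℕ :=
  match l with
  | 0 => 0
  | l + 1 => ν 2 - ν 1 + cutDegSnd l fun t => ν (t + 2)

/-- The exponent of the permutation sign. -/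
def cutPerm (l : ℕ) (ν : ℕ → ℕ) : ℕ :=
  match l with
  | 0 => 0
  | l + 1 => (ν 2 - ν 1) * cutDegFst l (fun t => ν (t + 2)) + cutPerm l fun t => ν (t + 2)

/-- The exponent of the position sign. -/
def cutPos (l : ℕ) (ν : ℕ → ℕ) : ℕ :=
  match l with
  | 0 => 0
  | l + 1 => ν 1 + cutPos l fun t => ν (t + 2)

/-- The offsets `P` and `ν 0` are there for the induction, which shifts `ν` by two and adds the
vertices of the first interval to `P`. For `P = ν 0 = 0` the sign of the recursion differs from the
permutation and position signs by `|a| ∑ |bᵢ| + l`, once the interval degrees match those of `a` and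
the `bᵢ`. -/
lemma cutTermExp_parity (l P : ℕ) (ν : ℕ → ℕ) (hν : Monotone ν) :
    ((cutTermExp l P ν : ℕ) : ZMod 2) = ((P + cutDegFst l ν) * cutDegSnd l ν + l + cutPerm l ν +
      cutPos l ν + l * (P + ν 0) : ℕ) := by
  induction l generalizing P ν with
  | zero => simp [cutTermExp, cutDegSnd, cutPerm, cutPos]
  | succ l ih =>
    obtain ⟨a, ha⟩ := Nat.exists_eq_add_of_le (hν (Nat.le_succ 0))
    obtain ⟨b, hb⟩ := Nat.exists_eq_add_of_le (hν (Nat.le_succ 1))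
    simp only [Nat.succ_eq_add_one, zero_add, Nat.reduceAdd] at ha hb
    have h1 : ν 1 - ν 0 = a := by omega
    have h2 : ν 2 - ν 1 = b := by omega
    have h3 : ν 1 + 1 - ν 0 = a + 1 := by omega
    have h4 := ih (P + (a + 1)) (fun t => ν (t + 2)) fun i j h => hν (Nat.add_le_add_right h 2)
    simp only [cutTermExp, cutDegFst, cutDegSnd, cutPerm, cutPos, h1, h2, h3, cutExp, Nat.cast_add,
      h4, zero_add]
    rw [hb, ha]
    push_cast
    generalize cutDegFst l (fun t => ν (t + 2)) = c
    generalize cutDegSnd l (fun t => ν (t + 2)) = d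
    generalize ν 0 = e
    generalize cutPerm l (fun t => ν (t + 2)) = f
    generalize cutPos l (fun t => ν (t + 2)) = g
    have two : (2 : ZMod 2) = 0 := rfl
    linear_combination ((l : ZMod 2) + l * a + l * b - b * c - e) * two

end Signs

/-! ### The intervals of the surjection `(1,2,1,3,1,…,1,l+1,1)` -/

section Surjection

lemma hgaSurj_val (l : ℕ) (t : Fin (2 * l + 1)) :
    (hgaSurj l t).val = if t.val % 2 = 0 then 0 else (t.val + 1) / 2 := by
  rw [hgaSurj]
  split_ifs <;> rfl

/-- The first label occupies the even positions up to the last one, `2 * l`, while each other label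
occurs only once. -/
lemma isFinal_hgaSurj {l : ℕ} {t : Fin (2 * l + 1)} :
    IsFinal (hgaSurj l) t ↔ t.val % 2 = 1 ∨ t.val = 2 * l := by
  have ht := t.2
  constructor
  · intro h
    by_contra! h1
    refine h (⟨2 * l, by omega⟩ : Fin (2 * l + 1)) (Fin.lt_def.2 (by simp; omega)) ?_
    rw [Fin.ext_iff, hgaSurj_val, hgaSurj_val]
    simp
    omega
  · intro h t' h1 h2
    have ht' := t'.2
    rw [Fin.lt_def] at h1
    rw [Fin.ext_iff, hgaSurj_val, hgaSurj_val] at h2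
    split_ifs at h2 <;> omega

/-- The labels at odd positions increase from left to right, so an inversion must have the smallest
label, at an even position, on its right. -/
lemma lt_hgaSurj_iff {l : ℕ} {t t' : Fin (2 * l + 1)} :
    (t < t' ∧ hgaSurj l t' < hgaSurj l t) ↔
      t < t' ∧ t.val % 2 = 1 ∧ t'.val % 2 = 0 := by
  refine and_congr_right fun h => ?_
  rw [Fin.lt_def] at h ⊢
  rw [hgaSurj_val, hgaSurj_val]
  split_ifs <;> omega

/-- The degree of the interval from `ν t` to `ν (t + 1)` for the surjection `(1,2,1,…,1,l+1,1)`. -/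
def hgaDeg (l : ℕ) (ν : ℕ → ℕ) (t : ℕ) : ℕ :=
  ν (t + 1) - ν t + if t % 2 = 1 ∨ t = 2 * l then 0 else 1

lemma intervalDeg_hgaSurj (l : ℕ) (ν : ℕ → ℕ) (t : Fin (2 * l + 1)) :
    intervalDeg (hgaSurj l) (fun t => ν t.val) t = hgaDeg l ν t := by
  rw [intervalDeg, hgaDeg]
  simp only [isFinal_hgaSurj]
  rfl

lemma hgaDeg_succ (l : ℕ) (ν : ℕ → ℕ) (t : ℕ) :
    hgaDeg (l + 1) ν (t + 2) = hgaDeg l (fun t => ν (t + 2)) t := by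
  rw [hgaDeg, hgaDeg]
  have h : ((t + 2) % 2 = 1 ∨ t + 2 = 2 * (l + 1)) ↔ (t % 2 = 1 ∨ t = 2 * l) := by omega
  simp only [h]

lemma sum_even_hgaDeg (l : ℕ) (ν : ℕ → ℕ) :
    ∑ t ∈ Finset.range (2 * l + 1), (if t % 2 = 0 then hgaDeg l ν t else 0) = cutDegFst l ν := by
  induction l generalizing ν with
  | zero => simp [hgaDeg, cutDegFst]
  | succ l ih =>
    rw [show 2 * (l + 1) + 1 = 2 * l + 1 + 1 + 1 by ring, Finset.sum_range_succ',
      Finset.sum_range_succ', cutDegFst, ← ih]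
    have h : ∀ t, (t + 1 + 1) % 2 = 0 ↔ t % 2 = 0 := fun t => by omega
    simp only [h, add_assoc, Nat.reduceAdd, hgaDeg_succ]
    simp [hgaDeg]
    omega

lemma permExp_hgaSurj (l : ℕ) (ν : ℕ → ℕ) :
    permExp (hgaSurj l) (fun t => ν t.val) = cutPerm l ν := by
  have h0 : permExp (hgaSurj l) (fun t => ν t.val) =
      ∑ t ∈ Finset.range (2 * l + 1), ∑ t' ∈ Finset.range (2 * l + 1),
        if t < t' ∧ t % 2 = 1 ∧ t' % 2 = 0 then hgaDeg l ν t * hgaDeg l ν t' else 0 := by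
    rw [permExp, Finset.sum_range]
    refine Finset.sum_congr rfl fun t _ => ?_
    rw [Finset.sum_range]
    refine Finset.sum_congr rfl fun t' _ => ?_
    simp only [lt_hgaSurj_iff, intervalDeg_hgaSurj]
    simp only [Fin.lt_def]
  rw [h0]
  clear h0
  induction l generalizing ν with
  | zero => simp [cutPerm]
  | succ l ih =>
    rw [show 2 * (l + 1) + 1 = 2 * l + 1 + 1 + 1 by ring, Finset.sum_range_succ',
      Finset.sum_range_succ', cutPerm, ← ih, ← sum_even_hgaDeg]
    simp only [Finset.sum_range_succ' _ (2 * l + 1 + 1), Finset.sum_range_succ' _ (2 * l + 1)]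
    have h : ∀ t, (t + 1 + 1) % 2 = t % 2 := fun t => by omega
    simp only [h, add_assoc, Nat.reduceAdd, hgaDeg_succ]
    have e : hgaDeg (l + 1) ν 1 = ν 2 - ν 1 := by simp [hgaDeg]
    simp [e, Finset.mul_sum, add_comm]

lemma posExp_hgaSurj (l : ℕ) (ν : ℕ → ℕ) :
    posExp (hgaSurj l) (fun t => ν t.val) = cutPos l ν := by
  have h0 : posExp (hgaSurj l) (fun t => ν t.val) =
      ∑ t ∈ Finset.range (2 * l + 1), if t % 2 = 1 ∨ t = 2 * l then 0 else ν (t + 1) := by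
    rw [posExp, Finset.sum_range]
    refine Finset.sum_congr rfl fun t _ => ?_
    simp only [isFinal_hgaSurj, Fin.val_succ]
  rw [h0]
  clear h0
  induction l generalizing ν with
  | zero => simp [cutPos]
  | succ l ih =>
    rw [show 2 * (l + 1) + 1 = 2 * l + 1 + 1 + 1 by ring, Finset.sum_range_succ',
      Finset.sum_range_succ', cutPos, ← ih]
    have h : ∀ t, ((t + 1 + 1) % 2 = 1 ∨ t + 1 + 1 = 2 * (l + 1)) ↔ (t % 2 = 1 ∨ t = 2 * l) :=
      fun t => by omega
    simp only [h]
    simp only [zero_add, true_or, if_true, Nat.zero_mod]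
    simp
    exact add_comm _ _

lemma filter_finRange (N : ℕ) (q : ℕ → Prop) [DecidablePred q] (g : ℕ → List ℕ) :
    ((List.finRange N).filter fun t => q t.val).flatMap (fun t => g t.val) =
      ((List.range N).filter fun t => q t).flatMap g := by
  rw [← List.map_coe_finRange_eq_range, List.filter_map, List.flatMap_map]
  rfl

lemma filter_even_range (l : ℕ) : (List.range (2 * l + 1)).filter (fun t => t % 2 = 0) =
    (List.range (l + 1)).map (2 * ·) := by
  induction l with
  | zero => rfl
  | succ l ih =>
    rw [show 2 * (l + 1) + 1 = 2 * l + 1 + 1 + 1 by ring, List.range_succ, List.range_succ,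
      List.filter_append, List.filter_append, ih, List.range_succ (n := l + 1), List.map_append]
    rw [List.filter_cons_of_neg (by simp), List.filter_cons_of_pos (by simp)]
    simp
    omega

lemma flatMap_hgaSurj_zero (l : ℕ) (g : ℕ → List ℕ) :
    ((List.finRange (2 * l + 1)).filter fun t => hgaSurj l t = 0).flatMap (fun t => g t.val) =
      (List.range (l + 1)).flatMap fun i => g (2 * i) := by
  have h : ∀ t : Fin (2 * l + 1), hgaSurj l t = 0 ↔ t.val % 2 = 0 := by
    intro t
    rw [Fin.ext_iff, hgaSurj_val, Fin.val_zero]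
    split_ifs <;> omega
  simp only [h]
  rw [filter_finRange _ (fun t => t % 2 = 0), filter_even_range, List.flatMap_map]

lemma flatMap_hgaSurj_succ {l : ℕ} (i : Fin l) (g : ℕ → List ℕ) :
    ((List.finRange (2 * l + 1)).filter fun t => hgaSurj l t = i.succ).flatMap (fun t => g t.val) =
      g (2 * i + 1) := by
  have hi := i.2
  have h : ∀ t : Fin (2 * l + 1), hgaSurj l t = i.succ ↔ t.val = 2 * i + 1 := by
    intro t
    rw [Fin.ext_iff, hgaSurj_val, Fin.val_succ]
    split_ifs with h
    · exact iff_of_false (by simp) fun h' => by omega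
    · obtain ⟨s, hs⟩ : ∃ s, t.val = 2 * s + 1 := ⟨t.val / 2, by omega⟩
      rw [hs]
      omega
  simp only [h]
  rw [filter_finRange _ (fun t => t = 2 * i + 1), List.filter_eq,
    List.count_eq_one_of_mem List.nodup_range (List.mem_range.2 (by omega))]
  simp

end Surjection

/-! ### Surviving words and interval cuts -/

section Comparison

variable {X Y : SSet.{u}} {n : ℕ} {k : Type v} [CommRing k]

/-- An interval has one vertex more than its length. The degree counts this extra vertex for the
inner intervals, which leaves the one of the final interval. -/
lemma length_flatMap_interval (l : ℕ) {ν : ℕ → ℕ} (hν : Monotone ν) :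
    ((List.range (l + 1)).flatMap fun i => interval (ν (2 * i)) (ν (2 * i + 1))).length =
      cutDegFst l ν + 1 := by
  induction l generalizing ν with
  | zero =>
    have := hν (Nat.zero_le 1)
    simp [interval_length, cutDegFst]
    omega
  | succ l ih =>
    rw [List.range_succ_eq_map, List.flatMap_cons, List.flatMap_map, List.length_append,
      interval_length, cutDegFst, add_assoc, ← ih fun i j h => hν (Nat.add_le_add_right h 2)]
    have := hν (Nat.zero_le 1)
    simp only [Nat.succ_eq_add_one, mul_add, mul_one, mul_zero, zero_add]
    have h : ∀ i, 2 * i + 2 + 1 = 2 * i + 1 + 2 := fun i => rfl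
    simp only [h]
    omega

lemma cutDegSnd_eq_sum (l : ℕ) (ν : ℕ → ℕ) :
    cutDegSnd l ν = ∑ i : Fin l, (ν (2 * i + 2) - ν (2 * i + 1)) := by
  induction l generalizing ν with
  | zero => rfl
  | succ l ih =>
    rw [cutDegSnd, ih, Fin.sum_univ_succ]
    rfl

lemma restr_mem_range (x : X _⦋n⦌) {L : List ℕ} {m : ℕ} (hL : L.length = m + 1) :
    ∃ c, restr k x L = DirectSum.lof k ℕ (NChain k X) m c := by
  obtain rfl : m = L.length - 1 := by omega
  rw [restr]
  split_ifs
  · exact ⟨_, rfl⟩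
  · exact ⟨0, (map_zero _).symm⟩

/-- The extension by zero of a functional on `C_d(X)` to `C(X)`. -/
def homFun {d : ℕ} (b : Module.Dual k (NChain k X d)) : Module.Dual k (Chains k X) :=
  b ∘ₗ DirectSum.component k ℕ (NChain k X) d

lemma homFun_restr {d m : ℕ} (b : Module.Dual k (NChain k X d)) (x : X _⦋n⦌) {L : List ℕ}
    (hL : L.length = m + 1) (h : m ≠ d) : homFun b (restr k x L) = 0 := by
  obtain ⟨c, hc⟩ := restr_mem_range (k := k) x hL
  rw [hc, homFun, LinearMap.comp_apply, DirectSum.component.of, dif_neg h, map_zero]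

lemma monotone_extend {N : ℕ} {m : Fin (N + 1) → Fin (n + 1)} (hm : Monotone m) :
    Monotone (extend m) :=
  fun _ _ h => hm (Fin.mk_le_mk.2 (min_le_min_right N h))

/-- The value of a word `(1 ⊗ b₁) ⋯ (1 ⊗ b_l) (a ⊗ 1)` on the simplex `(x, y)` in terms of the
intervals of the surjection `(1,2,1,3,1,…,1,l+1,1)`. -/
lemma gmEval_eq_sum_subdivisions {d : ℕ} (a : Module.Dual k (NChain k X d)) {Λ : Type*}
    (δ : Λ → ℕ) (φ : ∀ b, Module.Dual k (NChain k Y (δ b))) (bs : List Λ)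
    (x : X _⦋n⦌) (y : Y _⦋n⦌) :
    gmEval ((bs.map fun b => homFun (φ b)).map Sum.inr ++ [Sum.inl (homFun a)])
        (pair x y) =
      ∑ m ∈ subdivisions (2 * bs.length + 1) n,
        (-1 : k) ^ (d * wordDeg δ bs + bs.length +
          (permExp (hgaSurj bs.length) (fun t => (m t).val) +
            posExp (hgaSurj bs.length) (fun t => (m t).val))) *
        (homFun a (restr k x (((List.finRange (2 * bs.length + 1)).filter
            fun t => hgaSurj bs.length t = 0).flatMap
              fun t => interval (m t.castSucc) (m t.succ))) *
          ∏ i : Fin bs.length, homFun (φ (bs.get i)) (restr k y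
            (((List.finRange (2 * bs.length + 1)).filter
              fun t => hgaSurj bs.length t = i.succ).flatMap
                fun t => interval (m t.castSucc) (m t.succ)))) := by
  rw [gmEval_eq_cutSum, cutSum_eq_seqSum, List.length_map, ← sum_subdivisions]
  refine Finset.sum_congr rfl fun m hm => ?_
  rw [subdivisions, Finset.mem_filter] at hm
  obtain ⟨-, hm, hm0, -⟩ := hm
  have hν := monotone_extend hm
  have h0 : extend m 0 = 0 := by
    have := extend_val m 0
    rwa [hm0] at this
  have h1 : ∀ t, (m t).val = extend m t.val := fun t => (extend_val m t).symm
  simp only [h1, Fin.val_castSucc, Fin.val_succ]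
  generalize extend m = ν at hν h0
  rw [cutTerm_eq, permExp_hgaSurj, posExp_hgaSurj,
    flatMap_hgaSurj_zero _ fun t => interval (ν t) (ν (t + 1))]
  simp only [flatMap_hgaSurj_succ _ fun t => interval (ν t) (ν (t + 1)), List.nil_append,
    List.length_nil, add_assoc, Nat.reduceAdd]
  -- If an interval degree does not match the degree of its functional, both sides are 0. The signs
  -- have to agree only when all degrees match.
  by_cases hd : cutDegFst bs.length ν = d
  swap
  · rw [homFun_restr _ _ (length_flatMap_interval _ hν) hd]
    ring
  by_cases he : ∀ i : Fin bs.length, ν (2 * i + 2) - ν (2 * i + 1) = δ (bs.get i)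
  swap
  · push Not at he
    obtain ⟨i, hi⟩ := he
    have h3 : homFun (φ (bs.get i)) (restr k y (interval (ν (2 * i + 1)) (ν (2 * i + 2)))) = 0 := by
      refine homFun_restr _ _ ?_ hi
      have := hν (show 2 * i.val + 1 ≤ 2 * i + 2 by omega)
      rw [interval_length]
      omega
    rw [Finset.prod_eq_zero (Finset.mem_univ i) h3]
    ring
  congr 1
  refine neg_one_pow_congr ?_
  rw [← ZMod.natCast_eq_zero_iff_even, ← ZMod.natCast_eq_zero_iff_even, cutTermExp_parity _ _ _ hν,
    cutDegSnd_eq_sum, Finset.sum_congr rfl fun i _ => he i, sum_get_eq_wordDeg, hd, h0]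
  push_cast
  ring_nf

end Comparison

/-! ### Sign exponents of suspension and of pairing, on lists -/

section Exponents

/-- The exponent `∑ᵢ (n - i) Dᵢ`. -/
def suspExp (D : List ℕ) : ℕ :=
  match D with
  | [] => 0
  | d :: D => D.length * d + suspExp D

lemma sum_eq_suspExp {Λ : Type*} (δ : Λ → ℕ) (W : List Λ) :
    ∑ i : Fin W.length, δ (W.get i) * (W.length - 1 - i.val) = suspExp (W.map δ) := by
  induction W with
  | nil => rfl
  | cons x W ih =>
    refine (Fin.sum_univ_succ (n := W.length) _).trans ?_
    rw [List.map_cons, suspExp, List.length_map, ← ih, mul_comm W.length]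
    refine congrArg₂ _ rfl (Finset.sum_congr rfl fun i _ => congrArg _ ?_)
    change W.length + 1 - 1 - (i.val + 1) = _
    omega

lemma suspExp_append (D : List ℕ) (d : ℕ) : suspExp (D ++ [d]) = suspExp D + D.sum := by
  induction D with
  | nil => simp [suspExp]
  | cons e D ih =>
    rw [List.cons_append, suspExp, ih, suspExp, List.length_append, List.sum_cons,
      List.length_singleton]
    ring

/-- The exponent `∑_{i<j} Dᵢ Dⱼ`. -/
def listKoszul (D : List ℕ) : ℕ :=
  match D with
  | [] => 0
  | d :: D => d * D.sum + listKoszul D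

lemma koszulExp_eq_listKoszul {Λ : Type*} (δ : Λ → ℕ) (W : List Λ) :
    koszulExp (fun i => δ (W.get i)) = listKoszul (W.map δ) := by
  induction W with
  | nil => rfl
  | cons x W ih =>
    rw [koszulExp] at ih ⊢
    simp only [Finset.sum_filter] at ih ⊢
    refine (Fin.sum_univ_succ (n := W.length) _).trans ?_
    rw [List.map_cons, listKoszul, ← ih]
    refine congrArg₂ _ ?_ (Finset.sum_congr rfl fun i _ => ?_)
    · refine (Fin.sum_univ_succ (n := W.length) _).trans ?_
      have h := sum_get_eq_wordDeg δ W
      rw [wordDeg] at h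
      rw [← h, Finset.mul_sum]
      simp
    · refine (Fin.sum_univ_succ (n := W.length) _).trans ?_
      simp

lemma listKoszul_append (D : List ℕ) (d : ℕ) :
    listKoszul (D ++ [d]) = listKoszul D + d * D.sum := by
  induction D with
  | nil => simp [listKoszul]
  | cons e D ih =>
    rw [List.cons_append, listKoszul, ih, listKoszul, List.sum_append, List.sum_singleton,
      List.sum_cons]
    ring

lemma wordDeg_succ {Λ : Type*} (δ : Λ → ℕ) (W : List Λ) :
    wordDeg (fun x => δ x + 1) W = wordDeg δ W + W.length := by
  induction W with
  | nil => rfl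
  | cons x W ih => rw [wordDeg_cons, wordDeg_cons, ih, List.length_cons]; ring

end Exponents

/-! ### Transposes, pullback along the diagonal and letters as functionals -/

section Transpose

variable {k : Type v} [CommRing k] {X Y Z : SSet.{u}}

/-- The cochain of degree `S - d` that is given by a functional on `C(Z)`. -/
def degreePart (S d : ℕ) (F : Module.Dual k (Chains k Z)) : Cochains k Z :=
  if d ≤ S then
    DirectSum.lof k ℕ (fun m => Module.Dual k (NChain k Z m)) (S - d)
      (F ∘ₗ DirectSum.lof k ℕ (NChain k Z) (S - d))
  else 0

lemma degreePart_smul (S d : ℕ) (r : k) (F : Module.Dual k (Chains k Z)) :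
    degreePart S d (r • F) = r • degreePart S d F := by
  rw [degreePart, degreePart]
  split_ifs
  · rw [LinearMap.smul_comp, map_smul]
  · rw [smul_zero]

lemma degreePart_zero (S d : ℕ) : degreePart S d (0 : Module.Dual k (Chains k Z)) = 0 := by
  rw [← zero_smul k (0 : Module.Dual k (Chains k Z)), degreePart_smul, zero_smul]

lemma degreePart_homFun {d : ℕ} (b : Module.Dual k (NChain k Z d)) :
    degreePart d 0 (homFun b) =
      DirectSum.lof k ℕ (fun m => Module.Dual k (NChain k Z m)) d b := by
  have h : ∀ e, e = d → DirectSum.lof k ℕ (fun m => Module.Dual k (NChain k Z m)) e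
      (homFun b ∘ₗ DirectSum.lof k ℕ (NChain k Z) e) =
        DirectSum.lof k ℕ (fun m => Module.Dual k (NChain k Z m)) d b := by
    rintro _ rfl
    congr 1
    refine LinearMap.ext fun c => ?_
    rw [LinearMap.comp_apply, homFun, LinearMap.comp_apply, DirectSum.component.lof_self]
  rw [degreePart, if_pos (Nat.zero_le d)]
  exact h _ (Nat.sub_zero d)

lemma transpose_apply {W : Type*} [AddCommMonoid W] [Module k W] {n : ℕ}
    (f : Chains k Z →ₗ[k] ⨂[k]^n W) (d : ℕ) (D : Fin n → ℕ) (φ : Fin n → Module.Dual k W) :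
    transpose f d D φ = ((-1 : k) ^ (d * (∑ i, D i) + koszulExp D)) •
      degreePart (∑ i, D i) d
        (PiTensorProduct.dualDistrib (PiTensorProduct.tprod k φ) ∘ₗ f) := by
  rw [transpose, degreePart]
  split_ifs
  · rw [smul_apply, LinearMap.compMultilinearMap_apply, LinearMap.comp_apply, LinearMap.comp_apply]
    rfl
  · rw [smul_zero, zero_apply]

/-- The map of chains induced by a map of simplicial sets. -/
def chainsMap (g : X ⟶ Y) : Chains k X →ₗ[k] Chains k Y := DirectSum.lmap (chainMap k g)

lemma cochainMap_degreePart (g : X ⟶ Y) (S d : ℕ) (F : Module.Dual k (Chains k Y)) :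
    cochainMap k g (degreePart S d F) = degreePart S d (F ∘ₗ chainsMap g) := by
  rw [degreePart, degreePart]
  split_ifs
  · rw [cochainMap, DirectSum.lmap_lof]
    congr 1
    refine LinearMap.ext fun c => ?_
    change F (DirectSum.lof _ _ _ _ (chainMap k g _ c)) = F (chainsMap g (DirectSum.lof _ _ _ _ c))
    rw [chainsMap, DirectSum.lmap_lof]
  · rw [map_zero]

lemma cochainMap_unit (g : X ⟶ Y) :
    cochainMap k g (DirectSum.lof k ℕ (fun n => Module.Dual k (NChain k Y n)) 0 (counit k Y)) =
      DirectSum.lof k ℕ (fun n => Module.Dual k (NChain k X n)) 0 (counit k X) := by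
  rw [cochainMap, DirectSum.lmap_lof]
  congr 1
  refine LinearMap.ext fun c => ?_
  exact counit_chainMap k g c

lemma chainsMap_simplexChain (g : X ⟶ Y) {n : ℕ} (x : X.nonDegenerate n) :
    chainsMap g (simplexChain k x.1) = simplexChain k (g.app _ x.1) := by
  rw [chainsMap, simplexChain, DirectSum.lmap_lof, simplexClass, dif_pos x.2, simplexChain]
  simp [chainMap]

lemma chains_hom_ext {F G : Module.Dual k (Chains k X)}
    (h : ∀ (n : ℕ) (x : X.nonDegenerate n), F (simplexChain k x.1) = G (simplexChain k x.1)) :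
    F = G := by
  refine DirectSum.linearMap_ext k fun n => ?_
  ext x
  have := h n x
  rw [simplexChain, simplexClass, dif_pos x.2] at this
  exact this

lemma degSign_pow_lof {M : ℕ → Type*} [∀ n, AddCommMonoid (M n)] [∀ n, Module k (M n)] (d e : ℕ)
    (x : M d) : (degSign k M ^ e) (DirectSum.lof k ℕ M d x) =
      ((-1 : k) ^ (d * e)) • DirectSum.lof k ℕ M d x := by
  induction e with
  | zero => simp
  | succ e ih =>
    rw [pow_succ', Module.End.mul_apply, ih, map_smul, degSign, DirectSum.lmap_lof,
      LinearMap.smul_apply, LinearMap.id_apply, map_smul, smul_smul, ← pow_add, mul_add, mul_one]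

lemma tensorDual_counit_right {d : ℕ} (b : Module.Dual k (NChain k X d)) :
    tensorDual k X Y d 0 (b ⊗ₜ counit k Y) = letterFun (Sum.inl (homFun b)) := by
  rw [tensorDual, mul_zero, pow_zero, one_smul]
  apply TensorProduct.ext'
  intro x y
  rfl

lemma tensorDual_counit_left {d : ℕ} (b : Module.Dual k (NChain k Y d)) :
    tensorDual k X Y 0 d (counit k X ⊗ₜ b) = letterFun (Sum.inr (homFun b)) := by
  rw [tensorDual, zero_mul, pow_zero, one_smul]
  apply TensorProduct.ext'
  intro x y
  rfl

lemma gmValue_congr {N N' n : ℕ} (h : N = N')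
    {φ : Fin N → Module.Dual k (Chains k X ⊗[k] Chains k Y)}
    {φ' : Fin N' → Module.Dual k (Chains k X ⊗[k] Chains k Y)}
    (hφ : ∀ i, φ i = φ' (Fin.cast h i)) (z : (X ⊗ Y : SSet.{u}) _⦋n⦌) :
    gmValue φ z = gmValue φ' z := by
  subst h
  rw [show φ = φ' from funext hφ]

lemma gmEval_map {Λ : Type*} (g : Λ → Module.Dual k (Chains k X) ⊕ Module.Dual k (Chains k Y))
    (W : List Λ) {n : ℕ} (z : (X ⊗ Y : SSet.{u}) _⦋n⦌) :
    gmEval (W.map g) z = gmValue (fun i : Fin W.length => letterFun (g (W.get i))) z := by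
  refine gmValue_congr (List.length_map g) (fun i => congrArg letterFun ?_) _
  rw [List.get_eq_getElem, List.getElem_map]
  rfl

lemma dualDistrib_gmPart {N : ℕ} (φ : Fin N → Module.Dual k (Chains k X ⊗[k] Chains k Y)) {n : ℕ}
    (z : (X ⊗ Y : SSet.{u}) _⦋n⦌) :
    PiTensorProduct.dualDistrib (PiTensorProduct.tprod k φ) (gmPart k X Y N (simplexChain k z)) =
      gmValue φ z := rfl

end Transpose

/-! ### The letters `a ⊗ 1` and `1 ⊗ b` as elements of the tensor product -/

section TensorLetters

variable {k : Type v} [CommRing k]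
variable {M : ℕ → Type w} [∀ n, AddCommMonoid (M n)] [∀ n, Module k (M n)]
variable {a : Augmented k (⨁ n, M n)}

/-- The elements `a ⊗ 1` and `1 ⊗ b` of the tensor product of an algebra with itself. -/
def Letter.tensorAlg : Letter a ⊕ Letter a → (⨁ n, M n) ⊗[k] ⨁ n, M n :=
  Sum.elim (fun x => x.toAlg ⊗ₜ a.unit) (fun x => a.unit ⊗ₜ x.toAlg)

/-- The degrees of the letters `a ⊗ 1` and `1 ⊗ b`. -/
def Letter.sumDeg : Letter a ⊕ Letter a → ℕ := Sum.elim Letter.deg Letter.deg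

lemma Letter.coe_tensorIdeal (w : Letter a ⊕ Letter a) :
    (Letter.tensorIdeal w : (⨁ n, M n) ⊗[k] ⨁ n, M n) = Letter.tensorAlg w := by
  have h : ∀ x : Letter a, a.aug x.toAlg = 0 := fun x => x.mem
  rcases w with x | x
  · refine Augmented.coe_proj _ ?_
    simp [Augmented.tensor, h]
  · refine Augmented.coe_proj _ ?_
    simp [Augmented.tensor, h]

lemma Letter.proj_toAlg (x : Letter a) : a.proj x.toAlg = x.toIdeal := a.proj_coe x.toIdeal

end TensorLetters

/-! ### Both twisting cochains as functionals on chains -/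

section Cochain

variable {k : Type v} [CommRing k] {X : SSet.{u}} (c : Coaugmentation k X)

/-- The inner projection subtracts a multiple of the unit, which the diagonal pulls back to the unit
of `C*(X)`, and the outer projection kills that. -/
lemma proj_cochainMap_proj (y : Cochains k (X ⊗ X)) :
    (augC k c).proj (cochainMap k (diagMap X) ((augCC k c).proj y)) =
      (augC k c).proj (cochainMap k (diagMap X) y) := by
  have h : cochainMap k (diagMap X) (augCC k c).unit = (augC k c).unit := cochainMap_unit _
  rw [Augmented.proj_apply, map_add, map_smul, map_smul, h, map_add, map_smul, map_smul,
    Augmented.proj_unit, smul_zero, smul_zero, add_zero]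

variable {c}

/-- The extension of the cochain underlying a letter to a functional on `C(X)`. -/
def Letter.functional (x : Letter (augC k c)) : Module.Dual k (Chains k X) := homFun x.val

lemma aug_lof (n : ℕ) (hn : n ≠ 0) (m : Module.Dual k (NChain k X n)) :
    (augC k c).aug (DirectSum.lof k ℕ (fun n => Module.Dual k (NChain k X n)) n m) = 0 := by
  change Module.Dual.eval k (NChain k X 0) c.elt (DirectSum.component k ℕ
    (fun n => Module.Dual k (NChain k X n)) 0 (DirectSum.lof k ℕ _ n m)) = 0
  rw [DirectSum.component.of, dif_neg hn, map_zero]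

lemma sgn_toAlg (x : Letter (augC k c)) (e : ℕ) :
    ((augC k c).sgn ^ e) x.toAlg = ((-1 : k) ^ (x.deg * e)) • x.toAlg :=
  degSign_pow_lof (k := k) (M := fun n => Module.Dual k (NChain k X n)) x.deg e x.val

lemma sgn_unit : (augC k c).sgn (augC k c).unit = (augC k c).unit := by
  have h := degSign_pow_lof (k := k) (M := fun n => Module.Dual k (NChain k X n)) 0 1 (counit k X)
  rw [pow_one, zero_mul, pow_zero, one_smul] at h
  exact h

lemma sgn_tensorAlg (w : Letter (augC k c) ⊕ Letter (augC k c)) (e : ℕ) :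
    (((augC k c).tensor (augC k c)).sgn ^ e) (Letter.tensorAlg w) =
      ((-1 : k) ^ (Letter.sumDeg w * e)) • Letter.tensorAlg w := by
  have h1 : ∀ x : Letter (augC k c), (augC k c).sgn x.toAlg = ((-1 : k) ^ x.deg) • x.toAlg := by
    intro x
    have := sgn_toAlg x 1
    rwa [pow_one, mul_one] at this
  have h : ((augC k c).tensor (augC k c)).sgn (Letter.tensorAlg w) =
      ((-1 : k) ^ Letter.sumDeg w) • Letter.tensorAlg w := by
    rcases w with x | x
    · change TensorProduct.map (augC k c).sgn (augC k c).sgn (x.toAlg ⊗ₜ (augC k c).unit) =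
        ((-1 : k) ^ x.deg) • (x.toAlg ⊗ₜ[k] (augC k c).unit)
      rw [TensorProduct.map_tmul, h1, sgn_unit, TensorProduct.smul_tmul']
    · change TensorProduct.map (augC k c).sgn (augC k c).sgn ((augC k c).unit ⊗ₜ x.toAlg) =
        ((-1 : k) ^ x.deg) • ((augC k c).unit ⊗ₜ[k] x.toAlg)
      rw [TensorProduct.map_tmul, h1, sgn_unit, TensorProduct.tmul_smul]
  induction e with
  | zero => simp
  | succ e ih =>
    rw [pow_succ', Module.End.mul_apply, ih, map_smul, h, smul_smul, ← pow_add, mul_add, mul_one]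

/-- The bidegrees of the letters `a ⊗ 1` and `1 ⊗ b`. -/
def Letter.biDeg : Letter (augC k c) ⊕ Letter (augC k c) → ℕ × ℕ :=
  Sum.elim (fun x => (x.deg, 0)) (fun x => (0, x.deg))

/-- The homogeneous elements underlying the letters `a ⊗ 1` and `1 ⊗ b`. -/
def Letter.biVal (w : Letter (augC k c) ⊕ Letter (augC k c)) :
    Module.Dual k (NChain k X (Letter.biDeg w).1) ⊗[k]
      Module.Dual k (NChain k X (Letter.biDeg w).2) :=
  match w with
  | Sum.inl x => x.val ⊗ₜ counit k X
  | Sum.inr x => counit k X ⊗ₜ x.val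

lemma directSum_tensorAlg (w : Letter (augC k c) ⊕ Letter (augC k c)) :
    TensorProduct.directSum k k (fun p => Module.Dual k (NChain k X p))
      (fun q => Module.Dual k (NChain k X q)) (Letter.tensorAlg w) =
      DirectSum.lof k (ℕ × ℕ) (fun pq : ℕ × ℕ => Module.Dual k (NChain k X pq.1) ⊗[k]
        Module.Dual k (NChain k X pq.2)) (Letter.biDeg w) (Letter.biVal w) := by
  rcases w with x | x
  · exact TensorProduct.directSum_lof_tmul_lof (R := k) (S := k)
      (M₁ := fun p => Module.Dual k (NChain k X p)) (M₂ := fun p => Module.Dual k (NChain k X p))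
      x.deg x.val 0 (counit k X)
  · exact TensorProduct.directSum_lof_tmul_lof (R := k) (S := k)
      (M₁ := fun p => Module.Dual k (NChain k X p)) (M₂ := fun p => Module.Dual k (NChain k X p))
      0 (counit k X) x.deg x.val

lemma tensorDual_biVal (w : Letter (augC k c) ⊕ Letter (augC k c)) :
    tensorDual k X X (Letter.biDeg w).1 (Letter.biDeg w).2 (Letter.biVal w) =
      letterFun (Sum.map Letter.functional Letter.functional w) := by
  rcases w with x | x
  · exact tensorDual_counit_right x.val
  · exact tensorDual_counit_left x.val

/-- The functional on `C(X)` that is given by a word in the letters `a ⊗ 1` and `1 ⊗ b`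
and the Gugenheim–Munkholm map on the diagonal. -/
def gmFunctional (W : List (Letter (augC k c) ⊕ Letter (augC k c))) : Module.Dual k (Chains k X) :=
  (PiTensorProduct.dualDistrib (PiTensorProduct.tprod k fun i : Fin W.length =>
    letterFun (Sum.map Letter.functional Letter.functional (W.get i))) ∘ₗ
      gmPart k X X W.length) ∘ₗ chainsMap (diagMap X)

lemma gmFunctional_simplexChain (W : List (Letter (augC k c) ⊕ Letter (augC k c))) {n : ℕ}
    (x : X.nonDegenerate n) :
    gmFunctional W (simplexChain k x.1) =
      gmEval (W.map (Sum.map Letter.functional Letter.functional))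
        (pair x.1 x.1) := by
  rw [gmFunctional, LinearMap.comp_apply, chainsMap_simplexChain, LinearMap.comp_apply, gmEval_map]
  exact dualDistrib_gmPart _ _

lemma gmTranspose_tensorAlg (W : List (Letter (augC k c) ⊕ Letter (augC k c))) :
    cochainMap k (diagMap X) (gmTranspose k X X W.length fun i => Letter.tensorAlg (W.get i)) =
      ((-1 : k) ^ ((W.length - 1) * (W.map Letter.sumDeg).sum +
        listKoszul (W.map Letter.sumDeg))) •
        degreePart (W.map Letter.sumDeg).sum (W.length - 1) (gmFunctional W) := by
  rw [gmTranspose, MultilinearMap.compLinearMap_apply]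
  simp only [LinearEquiv.coe_coe, directSum_tensorAlg]
  rw [homMulti_lof, MultilinearMap.compLinearMap_apply]
  simp only [tensorDual_biVal]
  have hD : (fun i : Fin W.length => (Letter.biDeg (W.get i)).1 + (Letter.biDeg (W.get i)).2) =
      fun i => Letter.sumDeg (W.get i) := by
    funext i
    rcases W.get i with x | x
    · rfl
    · exact Nat.zero_add _
  rw [hD, transpose_apply, map_smul, cochainMap_degreePart, koszulExp_eq_listKoszul,
    sum_get_eq_wordDeg]
  rfl

/-- The three exponents come from the desuspensions, from transposing a map of degree `W.length -
1`, and from the Koszul rule for pairing a tensor product of functionals. -/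
lemma proj_twist_word (W : List (Letter (augC k c) ⊕ Letter (augC k c))) (hW : W ≠ []) :
    (augC k c).proj (cochainMap k (diagMap X) (((augC k c).tensor (augC k c)).twist (augCC k c)
      (gmTranspose k X X) (word k Letter.tensorIdeal W)).1) =
    ((-1 : k) ^ (suspExp (W.map Letter.sumDeg) + ((W.length - 1) * (W.map Letter.sumDeg).sum +
        listKoszul (W.map Letter.sumDeg)))) •
      (augC k c).proj (degreePart (W.map Letter.sumDeg).sum (W.length - 1) (gmFunctional W)) := by
  rw [Augmented.twist, wordLift_word, if_neg fun h => hW (List.length_eq_zero_iff.1 h),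
    LinearMap.compMultilinearMap_apply]
  refine (proj_cochainMap_proj c _).trans ?_
  rw [MultilinearMap.compLinearMap_apply]
  simp only [LinearMap.comp_apply, Submodule.subtype_apply, Letter.coe_tensorIdeal, sgn_tensorAlg]
  rw [MultilinearMap.map_smul_univ, Finset.prod_pow_eq_pow_sum, sum_eq_suspExp, map_smul,
    gmTranspose_tensorAlg, smul_smul, ← pow_add, map_smul]

/-- The functional on `C(X)` that is given by the interval cut operation and the letters of a
word. -/
def hgaFunctional (x : Letter (augC k c)) (W : List (Letter (augC k c))) :
    Module.Dual k (Chains k X) :=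
  PiTensorProduct.dualDistrib (PiTensorProduct.tprod k fun i : Fin (W.length + 1) =>
    Letter.functional ((x :: W).get i)) ∘ₗ intervalCut k X (hgaSurj W.length)

lemma hgaOp_toAlg (x : Letter (augC k c)) (W : List (Letter (augC k c))) :
    hgaOp k X W.length (fun i : Fin (W.length + 1) => Letter.toAlg ((x :: W).get i)) =
      ((-1 : k) ^ (W.length * ((x :: W).map Letter.deg).sum +
        listKoszul ((x :: W).map Letter.deg))) •
        degreePart ((x :: W).map Letter.deg).sum W.length (hgaFunctional x W) := by
  refine (homMulti_lof (M := fun n => Module.Dual k (NChain k X n)) _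
    (fun i : Fin (W.length + 1) => Letter.deg ((x :: W).get i))
    (fun i => Letter.val ((x :: W).get i))).trans ?_
  rw [MultilinearMap.compLinearMap_apply, transpose_apply]
  have h1 := koszulExp_eq_listKoszul Letter.deg (x :: W)
  have h2 := sum_get_eq_wordDeg Letter.deg (x :: W)
  rw [wordDeg] at h2
  rw [← h1, ← h2]
  rfl

lemma sumElim_get {Λ : Type*} (x y : Λ) (W : List Λ) (i : Fin (W.length + 1 + 1)) :
    Sum.elim [x].get (y :: W).get
      (((finCongr (Nat.add_comm (W.length + 1) 1)).trans finSumFinEquiv.symm) i) =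
        (x :: y :: W).get i := by
  refine Fin.cases ?_ (fun i => ?_) i
  · have h : ((finCongr (Nat.add_comm (W.length + 1) 1)).trans
        (finSumFinEquiv (m := 1) (n := W.length + 1)).symm) 0 = Sum.inl 0 := by
      rw [Equiv.trans_apply, Equiv.symm_apply_eq]
      rfl
    rw [h]
    rfl
  · have h : ((finCongr (Nat.add_comm (W.length + 1) 1)).trans
        (finSumFinEquiv (m := 1) (n := W.length + 1)).symm) i.succ = Sum.inr i := by
      rw [Equiv.trans_apply, Equiv.symm_apply_eq, finSumFinEquiv_apply_right]
      ext
      simp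
      omega
    rw [h]
    rfl

lemma hgaTwist_word (x y : Letter (augC k c)) (W : List (Letter (augC k c))) :
    hgaTwist k c (word k Letter.toIdeal [x] ⊗ₜ word k Letter.toIdeal (y :: W)) =
      ((-1 : k) ^ (suspExp ((x :: y :: W).map Letter.deg) +
        ((W.length + 1) * ((x :: y :: W).map Letter.deg).sum +
          listKoszul ((x :: y :: W).map Letter.deg)))) •
        (augC k c).proj (degreePart ((x :: y :: W).map Letter.deg).sum (W.length + 1)
          (hgaFunctional x (y :: W))) := by
  have h0 : hgaTwist k c (word k Letter.toIdeal [x] ⊗ₜ word k Letter.toIdeal (y :: W)) =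
      (augC k c).proj (hgaOp k X (W.length + 1) fun i : Fin (W.length + 1 + 1) =>
        ((augC k c).sgn ^ (W.length + 1 - i.val)) (Letter.toAlg ((x :: y :: W).get i))) := by
    rw [hgaTwist, wordLift₂_word]
    refine congrArg (augC k c).proj (congrArg (hgaOp k X (W.length + 1)) (funext fun i => ?_))
    exact congrArg (fun z => ((augC k c).sgn ^ (W.length + 1 - i.val)) (Letter.toAlg z))
      (sumElim_get x y W i)
  rw [h0]
  simp only [sgn_toAlg]
  rw [MultilinearMap.map_smul_univ, Finset.prod_pow_eq_pow_sum, map_smul]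
  have h1 := sum_eq_suspExp Letter.deg (x :: y :: W)
  have h2 := hgaOp_toAlg x (y :: W)
  rw [← h1, pow_add, mul_smul]
  refine congrArg _ ?_
  exact (congrArg _ h2).trans (map_smul _ _ _)

/-- On words `(1 ⊗ b₁) ⋯ (1 ⊗ b_l) (a ⊗ 1)` the Gugenheim–Munkholm map is given by the interval cut
operation. -/
lemma gmFunctional_eq_hgaFunctional (x : Letter (augC k c)) (W : List (Letter (augC k c))) :
    gmFunctional (W.map Sum.inr ++ [Sum.inl x]) =
      ((-1 : k) ^ (x.deg * wordDeg Letter.deg W + W.length)) • hgaFunctional x W := by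
  refine chains_hom_ext fun n z => ?_
  rw [gmFunctional_simplexChain, LinearMap.smul_apply]
  have h1 : (W.map Sum.inr ++ [Sum.inl x]).map
      (Sum.map Letter.functional Letter.functional) =
      (W.map fun b : Letter (augC k c) => homFun b.val).map Sum.inr ++ [Sum.inl (homFun x.val)] := by
    rw [List.map_append, List.map_map, List.map_map]
    rfl
  have h3 := gmEval_eq_sum_subdivisions x.val Letter.deg (fun b : Letter (augC k c) => b.val) W
    z.1 z.1
  rw [h1, h3]
  have h2 : intervalCut k X (hgaSurj W.length) (simplexChain k z.1) =
      ∑ m ∈ subdivisions (2 * W.length + 1) n,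
        ((-1 : k) ^ (permExp (hgaSurj W.length) (fun t => (m t).val) +
          posExp (hgaSurj W.length) (fun t => (m t).val))) •
        PiTensorProduct.tprod k fun j : Fin (W.length + 1) =>
          restr k z.1 (((List.finRange (2 * W.length + 1)).filter
            fun t => hgaSurj W.length t = j).flatMap
              fun t => interval (m t.castSucc) (m t.succ)) := by
    rw [intervalCut, chainLift, simplexChain, DirectSum.toModule_lof, simplexClass, dif_pos z.2,
      Finsupp.linearCombination_single, one_smul]
  rw [hgaFunctional, LinearMap.comp_apply, h2, map_sum, Finset.smul_sum]
  refine Finset.sum_congr rfl fun m _ => ?_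
  rw [map_smul, smul_smul, ← pow_add, PiTensorProduct.dualDistrib_apply, smul_eq_mul,
    Fin.prod_univ_succ]
  rfl

/-- Passing from letters to functionals preserves their kinds, so the exceptional form of a word can
be recognized on either side. -/
lemma gmFunctional_eq_zero (W : List (Letter (augC k c) ⊕ Letter (augC k c)))
    (hW : 2 ≤ W.length) (h : ∀ (V : List (Letter (augC k c))) x,
      W ≠ V.map Sum.inr ++ [Sum.inl x]) : gmFunctional W = 0 := by
  refine chains_hom_ext fun n z => ?_
  rw [gmFunctional_simplexChain, LinearMap.zero_apply]
  refine gmEval_eq_zero_of_ne _ (by rwa [List.length_map]) (fun Bs A hBA => ?_) _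
  obtain ⟨W₁, W₂, rfl, h1, h2⟩ := List.map_eq_append_iff.1 hBA
  obtain ⟨w, rfl, hw⟩ := List.map_eq_singleton_iff.1 h2
  obtain ⟨x, rfl⟩ : ∃ x, w = Sum.inl x := by
    rcases w with x | x
    · exact ⟨x, rfl⟩
    · simp at hw
  obtain ⟨V, rfl⟩ : ∃ V : List (Letter (augC k c)), W₁ = V.map Sum.inr := by
    clear hBA h2 h hW
    induction W₁ generalizing Bs with
    | nil => exact ⟨[], rfl⟩
    | cons w W₁ ih =>
      obtain _ | ⟨B, Bs⟩ := Bs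
      · simp at h1
      rw [List.map_cons, List.map_cons, List.cons.injEq] at h1
      obtain ⟨V, rfl⟩ := ih _ h1.2
      rcases w with y | y
      · simp at h1
      · exact ⟨y :: V, rfl⟩
  exact h V x rfl

end Cochain

/-! ### Shuffles with a single letter -/

section Shuffle

variable {k : Type v} [CommRing k] {N : Type w'} [AddCommMonoid N] [Module k N]
variable {Λ : Type w} (δ : Λ → ℕ)

/-- A shuffle sum over words that vanishes unless the single letter of the first word comes
last. -/
lemma shSum_singleton (f : List (Λ ⊕ Λ) → N) (x : Λ) (L' : List Λ)
    (h : ∀ V W : List Λ, W ≠ [] → f (V.map Sum.inr ++ Sum.inl x :: W.map Sum.inr) = 0) :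
    shSum k δ f [x] L' =
      ((-1 : k) ^ (wordDeg δ L' * δ x)) • f (L'.map Sum.inr ++ [Sum.inl x]) := by
  induction L' generalizing f with
  | nil => simp [shSum_nil_right]
  | cons y L' ih =>
    have h1 := h [] (y :: L') (List.cons_ne_nil y L')
    rw [List.map_nil, List.nil_append] at h1
    rw [shSum_cons_cons, shSum_nil_left, h1, zero_add,
      ih (fun W => f (Sum.inr y :: W)) fun V W hW => h (y :: V) W hW, smul_smul, ← pow_add,
      wordDeg_cons, wordDeg_cons, wordDeg_nil, add_zero, add_mul]
    rfl

end Shuffle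

/-! ### Equality of the twisting cochains -/

section Comparison

variable {k : Type v} [CommRing k] {X : SSet.{u}} {c : Coaugmentation k X}

lemma gmFunctional_singleton (x : Letter (augC k c)) (φ : Letter (augC k c) →
    Letter (augC k c) ⊕ Letter (augC k c)) (hφ : φ = Sum.inl ∨ φ = Sum.inr) :
    gmFunctional [φ x] = x.functional := by
  refine chains_hom_ext fun n z => ?_
  rw [gmFunctional_simplexChain, List.map_singleton, gmEval_singleton]
  rcases hφ with rfl | rfl
  · exact letterFun_inl_AW x.functional (pair z.1 z.1)
  · exact letterFun_inr_AW x.functional (pair z.1 z.1)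

/-- The twisting cochain of the composition on a word `[a ⊗ 1]` or `[1 ⊗ b]`. -/
lemma proj_twist_singleton (x : Letter (augC k c)) (φ : Letter (augC k c) →
    Letter (augC k c) ⊕ Letter (augC k c)) (hφ : φ = Sum.inl ∨ φ = Sum.inr) :
    (augC k c).proj (cochainMap k (diagMap X) (((augC k c).tensor (augC k c)).twist (augCC k c)
      (gmTranspose k X X) (word k Letter.tensorIdeal [φ x])).1) = x.toIdeal := by
  have h : Letter.sumDeg (φ x) = x.deg := by rcases hφ with rfl | rfl <;> rfl
  rw [proj_twist_word _ (List.cons_ne_nil _ _), gmFunctional_singleton x φ hφ, List.map_singleton,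
    h, List.sum_singleton]
  have h1 : suspExp [x.deg] + (([φ x].length - 1) * x.deg + listKoszul [x.deg]) = 0 := by
    simp [suspExp, listKoszul]
  rw [h1, pow_zero, one_smul]
  refine (congrArg _ (degreePart_homFun x.val)).trans ?_
  exact x.proj_toAlg

lemma proj_twist_eq_zero (W : List (Letter (augC k c) ⊕ Letter (augC k c)))
    (hW : 2 ≤ W.length) (h : ∀ (V : List (Letter (augC k c))) x,
      W ≠ V.map Sum.inr ++ [Sum.inl x]) :
    (augC k c).proj (cochainMap k (diagMap X) (((augC k c).tensor (augC k c)).twist (augCC k c)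
      (gmTranspose k X X) (word k Letter.tensorIdeal W)).1) = 0 := by
  rw [proj_twist_word _ (by rintro rfl; simp at hW), gmFunctional_eq_zero W hW h, degreePart_zero,
    map_zero, smul_zero]

lemma proj_twist_nil :
    (augC k c).proj (cochainMap k (diagMap X) (((augC k c).tensor (augC k c)).twist (augCC k c)
      (gmTranspose k X X) (word k Letter.tensorIdeal [])).1) = 0 := by
  rw [Augmented.twist, wordLift_word, if_pos List.length_nil, zero_apply]
  exact (congrArg _ (map_zero _)).trans (map_zero _)

/-- The twisting cochain of the composition on a word `[1 ⊗ b₁|…|1 ⊗ b_l|a ⊗ 1]`. -/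
lemma proj_twist_shuffle (x y : Letter (augC k c)) (W : List (Letter (augC k c))) :
    ((-1 : k) ^ (wordDeg Letter.sdeg (y :: W) * x.sdeg)) •
      (augC k c).proj (cochainMap k (diagMap X) (((augC k c).tensor (augC k c)).twist (augCC k c)
        (gmTranspose k X X)
          (word k Letter.tensorIdeal ((y :: W).map Sum.inr ++ [Sum.inl x]))).1) =
      hgaTwist k c (word k Letter.toIdeal [x] ⊗ₜ word k Letter.toIdeal (y :: W)) := by
  have h1 : ((y :: W).map Sum.inr ++ [Sum.inl x]).map Letter.sumDeg =
      (y :: W).map Letter.deg ++ [x.deg] := by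
    rw [List.map_append, List.map_map]
    rfl
  have h2 : ((y :: W).map Letter.deg ++ [x.deg]).sum = ((x :: y :: W).map Letter.deg).sum := by
    rw [List.sum_append, List.sum_singleton, List.map_cons (a := x), List.sum_cons, add_comm]
  have h3 : ((y :: W).map (Sum.inr (α := Letter (augC k c))) ++ [Sum.inl x]).length - 1 =
      W.length + 1 := by simp
  have h4 : wordDeg Letter.sdeg (y :: W) = wordDeg Letter.deg (y :: W) + (W.length + 1) :=
    wordDeg_succ Letter.deg (y :: W)
  rw [proj_twist_word _ (by simp), hgaTwist_word, h1, h2, h3, gmFunctional_eq_hgaFunctional,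
    degreePart_smul, map_smul, smul_smul, smul_smul, ← pow_add, ← pow_add, suspExp_append,
    listKoszul_append, h4]
  congr 1
  refine neg_one_pow_congr ?_
  rw [List.map_cons (a := x), suspExp, listKoszul, List.length_map, List.length_cons]
  rw [← ZMod.natCast_eq_zero_iff_even, ← ZMod.natCast_eq_zero_iff_even, Letter.sdeg, wordDeg]
  refine iff_of_eq (congrArg (· = 0) ?_)
  push_cast
  have two : (2 : ZMod 2) = 0 := rfl
  generalize (((y :: W).map Letter.deg).map (Nat.cast : ℕ → ZMod 2)).sum = s
  -- With `s = ∑ |bᵢ|` and `n = W.length + 1`, the two exponents differ by `2 (s + s |a| + n)`: the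
  -- shuffle sign `(s + n)(|a| + 1)` compensates for moving `a` to the end of the word and for the
  -- sign relating the recursion to the interval cut.
  linear_combination (1 + s + s * x.deg + W.length) * two


/-- The cases follow the pattern of `E`. Words with a single letter in total give that letter. With
one `a` and at least one `b`, only the shuffle with `a` last survives. With two letters from the
first word, or none from the first and several from the second, no shuffle has the surviving form.
-/
lemma hgaTwist_eq_shSum (L L' : List (Letter (augC k c))) :
    hgaTwist k c (word k Letter.toIdeal L ⊗ₜ word k Letter.toIdeal L') =
      shSum k Letter.sdeg (fun W => (augC k c).proj (cochainMap k (diagMap X)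
        (((augC k c).tensor (augC k c)).twist (augCC k c) (gmTranspose k X X)
          (word k Letter.tensorIdeal W)).1)) L L' := by
  rcases L with _ | ⟨x, _ | ⟨x', L⟩⟩
  · rw [shSum_nil_left]
    rcases L' with _ | ⟨y, _ | ⟨y', L'⟩⟩
    · rw [List.map_nil, proj_twist_nil, hgaTwist, wordLift₂_word]
      rfl
    · rw [List.map_singleton, proj_twist_singleton y Sum.inr (Or.inr rfl), hgaTwist, wordLift₂_word]
      rfl
    · rw [proj_twist_eq_zero _ (by simp), hgaTwist, wordLift₂_word]
      · rfl
      · intro V x h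
        have h1 : Sum.inl x ∈ (y :: y' :: L').map (Sum.inr (α := Letter (augC k c))) := by
          rw [h]
          simp
        simp at h1
  · rcases L' with _ | ⟨y, L'⟩
    · rw [shSum_nil_right, List.map_singleton, proj_twist_singleton x Sum.inl (Or.inl rfl),
        hgaTwist, wordLift₂_word]
      rfl
    · rw [shSum_singleton, proj_twist_shuffle]
      intro V W hW
      refine proj_twist_eq_zero _ ?_ fun V' x' h => ?_
      · have := List.length_pos_of_ne_nil hW
        simp
        omega
      -- As `W` is non-empty, this shuffle ends in a letter `1 ⊗ b`, whereas a surviving word ends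
      -- in `a ⊗ 1`.
      · have h1 := congrArg List.getLast? h
        obtain ⟨W', w, rfl⟩ := List.eq_nil_or_concat W |>.resolve_left hW
        rw [List.concat_eq_append, List.map_append, List.map_singleton, ← List.cons_append,
          ← List.append_assoc, List.getLast?_concat, List.getLast?_concat] at h1
        simp at h1
  · rw [hgaTwist, wordLift₂_word]
    refine Eq.trans ?_ ((shSum_congr (g := fun _ => 0) Letter.sdeg fun W h1 h2 => ?_).trans
      (shSum_zero _ _ _)).symm
    · rcases L' with _ | ⟨y, L'⟩ <;> rfl
    · refine proj_twist_eq_zero W ?_ ?_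
      · rw [length_of_filterMap W, h1]
        simp
        omega
      · rintro V z rfl
        have h3 := congrArg List.length h1
        rw [List.filterMap_append, List.filterMap_map, List.length_append] at h3
        have e : (Sum.getLeft? ∘ Sum.inr : Letter (augC k c) → Option (Letter (augC k c))) =
          fun _ => none := rfl
        rw [e] at h3
        simp at h3

end Comparison

/-- `barMap_barInfinity_shuffleMap` with the universe levels at which the cochain algebras live. -/
theorem barMap_barInfinity_shuffleMap_max {k : Type v} [CommRing k] {M : ℕ → Type (max v u)} [∀ n, AddCommMonoid (M n)]
    [∀ n, Module k (M n)] {a : Augmented k (⨁ n, M n)}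
    (haug : ∀ n ≠ 0, ∀ m, a.aug (DirectSum.lof k ℕ M n m) = 0) {B : Type (max u v)}
    [AddCommMonoid B] [Module k B] (b : Augmented.{v, max u v} k B)
    (F : ∀ n, MultilinearMap k (fun _ : Fin n => (⨁ n, M n) ⊗[k] ⨁ n, M n) B)
    (f : B →ₗ[k] ⨁ n, M n) (E : a.Bar ⊗[k] a.Bar →ₗ[k] a.ideal)
    (h : ∀ L L' : List (Letter a),
      E (word k Letter.toIdeal L ⊗ₜ word k Letter.toIdeal L') =
        shSum k Letter.sdeg (fun W => a.proj (f
          (Augmented.twist.{v, max u v, max v u} (Augmented.tensor.{v, max u v, max v u} a a) b F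
          (word k Letter.tensorIdeal W)).1)) L L') :
    Augmented.barMap.{v, max u v, max v u} b a f ∘ₗ
      Augmented.barInfinity.{v, max u v, max v u}
        (Augmented.tensor.{v, max u v, max v u} a a) b F ∘ₗ shuffleMap.{v, max v u} a =
          barProduct.{v, max v u} a E :=
  barMap_barInfinity_shuffleMap haug b F f E h

end BarGM

end

theorem mainTheorem5 {k : Type v} [CommRing k] (X : SSet.{u})
    (c : BarGM.Coaugmentation k X) :
    BarGM.barDiag k c ∘ₗ BarGM.barGM k c ∘ₗ BarGM.shuffleMap (BarGM.augC k c) =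
      BarGM.hgaMul k c :=
  BarGM.barMap_barInfinity_shuffleMap_max.{u, v} BarGM.aug_lof (BarGM.augCC k c)
    (BarGM.gmTranspose k X X) (BarGM.cochainMap k (BarGM.diagMap X)) (BarGM.hgaTwist k c)
    BarGM.hgaTwist_eq_shSum
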